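/- Let $G$ be a compact Lie group. Spaces are compactly generated weak Hausdorff. Let $\mathcal N$ be an $N_\infty$ $G$-operad: an operad in $G$-spaces such that, for each $n$, $\mathcal N(n)^G\neq\emptyset$, $\mathcal N(n)$ is $(G\times\Sigma_n)$-homotopy equivalent to a $(G\times\Sigma_n)$-cell complex, $\Sigma_n$ acts freely on $\mathcal N(n)$, and for every closed subgroup $\tilde H\le G\times\Sigma_n$ the space $\mathcal N(n)^{\tilde H}$ is empty or contractible. Let $\mathcal N$ have a self-interchange map, i.e. a pairing $\boxtimes\colon\mathcal N(k)\times\mathcal N(n)\to\mathcal N(kn)$ of $G$-operads (continuous, $G$-equivariant, equivariant for permutations, with $1\boxtimes 1=1$ and compatible with operadic composition). Let $K\le G$ be an open subgroup, choose an enumeration $G/K\cong\{1,\dots,m\}$, let $\sigma\colon G\to\Sigma_m$ be the resulting permutation representation and $G_\sigma=\{(g,\sigma(g))\}\le G\times\Sigma_m$ its graph, and assume that $G/K$ is admissible: $\mathcal N(m)^{G_\sigma}\ne\emptyset$. Let $WK=N_G(K)/K$ and let $\alpha\colon WK\to\Sigma_m$ be the permutation representation given by $w\cdot gK=gw^{-1}K$.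 Then $\mathcal N(m)^{G_\sigma}$ is contractible, and $WK$ acts on it through $1\times\alpha\colon WK\to G\times\Sigma_m$; this action is continuous, free and natural in $\mathcal N$. Let $A$ be an $\mathcal N$-algebra in orthogonal $G$-spectra. Give $A$ the $\mathcal N$-algebra structure induced by the interchange map, in which $\eta\in\mathcal N(n)$ acts through $1\boxtimes\eta$; give the norm $N_K^GA=A^{\wedge G/K}$ (with $G$ acting diagonally on $A$ and $G/K$) the diagonal $\mathcal N$-algebra structure, and give the point-set geometric fixed points $\Phi^HB=\int^{V}J(V^H,-)\wedge B(V)^H$ ($V$ running over the orthogonal representations of $H$, and $J$ the indexing category of orthogonal spectra) the resulting $\mathcal N^G$-algebra structures. Write $X\langle c\rangle$ for the pullback of an orthogonal spectrum $X$ along the symmetric monoidal automorphism $(f,w)\mapsto(f,cw)$ of $J$ $(c>0)$; it has the same algebra structures. The diagonal $$\Delta\colon\Phi^KA\to(\Phi^GN_K^GA)\langle\sqrt m\rangle$$ takes the point given by $x\in A(V)^K$ to the one given by its norm $\bigwedge_{gK}gx\in (N_K^GA)(\mathrm{Ind}_K^GV)^G$, where $V^K\cong(\mathrm{Ind}_K^GV)^G$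 by the diagonal divided by $\sqrt m$. Each $\xi\in\mathcal N(m)^{G_\sigma}$, acting through $\xi\boxtimes1$, gives a $G$-equivariant map of $\mathcal N$-algebras $\mu_\xi\colon N_K^GA\to A$, and there are well defined continuous maps $$\mathcal N(m)^{G_\sigma}\to \mathcal S^G[\mathcal N](N_K^GA,A)\to\mathcal S[\mathcal N^G](\Phi^GN_K^GA,\Phi^GA)\to\mathcal S[\mathcal N^G]\bigl(\Phi^KA,(\Phi^GA)\langle\sqrt m\rangle\bigr),$$ $\xi\mapsto\mu_\xi$, $f\mapsto\Phi^Gf$, $f\mapsto f\langle\sqrt m\rangle\circ\Delta$, between spaces of (equivariant) algebra maps. The residual action of $WK$ on $\Phi^KA$, in which the class of $n\in N_G(K)$ takes the point given by $x\in A(V)^K$ to the point given by $nx\in A(nV)^K$ (where $nV$ is $V$ with $k\in K$ acting as $n^{-1}kn$), is by maps of $\mathcal N^G$-algebras. The composite $\xi\mapsto\nu_\xi$ is $WK$-equivariant for the residual action on $\Phi^KA$ and the trivial action on $\Phi^GA$: $\nu_{w\xi}=\nu_\xi\circ w^{-1}$ for all $w\in WK$ and $\xi\in\mathcal N(m)^{G_\sigma}$.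 -/

import Mathlib

open Topology

noncomputable section

namespace MultTransfer

/-! ### Compactly generated weak Hausdorff spaces

All spaces are taken in `Type 1`, and compact generation is tested on compact Hausdorff spaces in
`Type 1`; indexing inner product spaces, arities of operads and groups live in `Type`, so that
coends indexed by all inner product spaces exist. -/

/-- Continuity for the compactly generated topology on the source.  In particular, a map out of a
product is `KCont` exactly when it is continuous on the product formed in compactly generated
spaces. -/
def KCont {X Y : Type*} [TopologicalSpace X] [TopologicalSpace Y] (f : X → Y) : Prop :=
  ∀ (C : CompHaus.{1}) (u : C(C, X)), Continuous (f ∘ u)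

/-- The weak Hausdorff condition, in the form: the diagonal of `X` is closed in the product `X × X`
formed in compactly generated spaces. -/
class WeakHausdorff (X : Type*) [TopologicalSpace X] : Prop where
  isClosed_eq : ∀ (C : CompHaus.{1}) (u v : C(C, X)), IsClosed {c | u c = v c}

section KCont
variable {X Y Z : Type*} [TopologicalSpace X] [TopologicalSpace Y] [TopologicalSpace Z]

lemma _root_.Continuous.kcont {f : X → Y} (hf : Continuous f) : KCont f :=
  fun _ u => hf.comp u.continuous

lemma KCont.comp {g : Y → Z} {f : X → Y} (hg : KCont g) (hf : KCont f) : KCont (g ∘ f) :=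
  fun C u => hg C ⟨f ∘ u, hf C u⟩

lemma KCont.continuous [UCompactlyGeneratedSpace.{1} X] {f : X → Y} (hf : KCont f) :
    Continuous f :=
  continuous_from_uCompactlyGeneratedSpace f hf

lemma KCont.prodMk {f : X → Y} {g : X → Z} (hf : KCont f) (hg : KCont g) :
    KCont (fun x => (f x, g x)) :=
  fun C u => (hf C u).prodMk (hg C u)

lemma KCont.pi {ι : Type*} {Y : ι → Type*} [∀ i, TopologicalSpace (Y i)] {f : X → ∀ i, Y i}
    (hf : ∀ i, KCont (fun x => f x i)) : KCont f :=
  fun C u => continuous_pi fun i => hf i C u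

lemma KCont.test {f : X → Y} (hf : KCont f) {C : Type 1} [TopologicalSpace C] [CompactSpace C]
    [T2Space C] {u : C → X} (hu : Continuous u) : Continuous (fun c => f (u c)) :=
  hf (CompHaus.of C) ⟨u, hu⟩

lemma WeakHausdorff.of_injective [WeakHausdorff Y] {f : X → Y} (hf : Continuous f)
    (hi : Function.Injective f) : WeakHausdorff X where
  isClosed_eq C u v := by
    have := WeakHausdorff.isClosed_eq C (X := Y) ⟨f ∘ u, hf.comp u.continuous⟩
      ⟨f ∘ v, hf.comp v.continuous⟩
    exact (congrArg IsClosed (Set.ext fun c => hi.eq_iff (a := u c) (b := v c))).mp this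

/-- A closed subspace of a compactly generated space is compactly generated. -/
lemma cg_subtype_of_isClosed [UCompactlyGeneratedSpace.{1} X] {s : Set X} (hs : IsClosed s) :
    UCompactlyGeneratedSpace.{1} s := by
  refine uCompactlyGeneratedSpace_of_isClosed fun t ht => ?_
  rw [hs.isClosedEmbedding_subtypeVal.isClosed_iff_image_isClosed]
  refine UCompactlyGeneratedSpace.isClosed fun C f => ?_
  have hcl : IsClosed (f ⁻¹' s) := hs.preimage f.continuous
  have : CompactSpace (f ⁻¹' s) := isCompact_iff_compactSpace.mp hcl.isCompact
  have := ht (CompHaus.of (f ⁻¹' s))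
    ⟨fun c => ⟨f c.1, c.2⟩, (f.continuous.comp continuous_subtype_val).subtype_mk _⟩
  have h2 := hcl.isClosedEmbedding_subtypeVal.isClosedMap _ this
  convert h2 using 1
  ext c
  constructor
  · rintro ⟨y, hy, hyc⟩
    exact ⟨⟨c, by rw [Set.mem_preimage, ← hyc]; exact y.2⟩, by
      have : y = ⟨f c, by rw [← hyc]; exact y.2⟩ := Subtype.ext hyc
      rw [this] at hy; exact hy, rfl⟩
  · rintro ⟨c', hc', rfl⟩
    exact ⟨_, hc', rfl⟩

/-- Coincidence sets are closed in compactly generated spaces with weak Hausdorff target. -/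
lemma isClosed_eq_of_kcont [UCompactlyGeneratedSpace.{1} X] [WeakHausdorff Y] {f g : X → Y}
    (hf : Continuous f) (hg : Continuous g) : IsClosed {x | f x = g x} :=
  UCompactlyGeneratedSpace.isClosed fun C u =>
    WeakHausdorff.isClosed_eq C ⟨f ∘ u, hf.comp u.continuous⟩ ⟨g ∘ u, hg.comp u.continuous⟩

/-- The least equivalence relation containing `r` whose quotient is weak Hausdorff.  The quotient
by it is the quotient by `r` in the category of compactly generated weak Hausdorff spaces. -/
def whSetoid (r : X → X → Prop) : Setoid X :=
  sInf {s | (∀ x y, r x y → s x y) ∧ WeakHausdorff (Quotient s)}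

lemma whSetoid_of_rel {r : X → X → Prop} {x y : X} (h : r x y) : whSetoid r x y := by
  intro s hs
  exact hs.1 _ _ h

lemma whSetoid_le {r : X → X → Prop} [WeakHausdorff Y] {f : X → Y} (hf : Continuous f)
    (hr : ∀ x y, r x y → f x = f y) {x y : X} (h : whSetoid r x y) : f x = f y := by
  refine h (Setoid.ker f) ⟨hr, ?_⟩
  exact WeakHausdorff.of_injective (f := Quotient.lift f fun a b hab => hab)
    (hf.quotient_lift _) (by
      rintro ⟨a⟩ ⟨b⟩ hab
      exact Quotient.sound hab)

instance (r : X → X → Prop) : WeakHausdorff (Quotient (whSetoid r)) where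
  isClosed_eq C u v := by
    let π (s : Setoid X) (hs : (∀ x y, r x y → s x y) ∧ WeakHausdorff (Quotient s)) :
        Quotient (whSetoid r) → Quotient s :=
      Quotient.map' id fun x y (h : whSetoid r x y) => h s hs
    have key : {c | u c = v c} = ⋂ (s : Setoid X) (hs : (∀ x y, r x y → s x y) ∧
        WeakHausdorff (Quotient s)), {c | π s hs (u c) = π s hs (v c)} := by
      ext c
      simp only [Set.mem_ofPred_eq, Set.mem_iInter]
      constructor
      · intro h s hs; rw [h]
      · intro h
        induction' hu : u c using Quotient.inductionOn' with a
        induction' hv : v c using Quotient.inductionOn' with b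
        refine Quotient.sound' fun s hs => ?_
        have := h s hs
        rw [hu, hv] at this
        exact Quotient.exact' this
    rw [key]
    refine isClosed_iInter fun s => isClosed_iInter fun hs => ?_
    have := hs.2
    have hc : Continuous (π s hs) := continuous_id.quotient_map' _
    exact WeakHausdorff.isClosed_eq C ⟨_, hc.comp u.continuous⟩ ⟨_, hc.comp v.continuous⟩

end KCont

section MultiLift
variable {Λ : Type*} [TopologicalSpace Λ] {S : Type} [Finite S] {X : S → Type 1}
  [∀ s, TopologicalSpace (X s)] [∀ s, UCompactlyGeneratedSpace.{1} (X s)]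
  (r : ∀ s, X s → X s → Prop) {Z : Type 1} [TopologicalSpace Z] [WeakHausdorff Z]

/-- Descent of a function of several variables to quotients. -/
def multiLift (f : Λ → (∀ s, X s) → Z) (l : Λ) (q : ∀ s, Quotient (whSetoid (r s))) : Z :=
  f l fun s => (q s).out

variable {r}

open Classical in
lemma multiLift_mk {f : Λ → (∀ s, X s) → Z} (hf : KCont fun p : Λ × (∀ s, X s) => f p.1 p.2)
    (hr : ∀ l x s y, r s (x s) y → f l x = f l (Function.update x s y)) (l : Λ) (x : ∀ s, X s) :
    multiLift r f l (fun s => Quotient.mk _ (x s)) = f l x := by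
  have step : ∀ (x : ∀ s, X s) (s : S) (y : X s), whSetoid (r s) (x s) y →
      f l x = f l (Function.update x s y) := by
    intro x s y h
    have hc : Continuous fun z : X s => f l (Function.update x s z) := by
      have : KCont fun z : X s => f l (Function.update x s z) :=
        hf.comp (f := fun z : X s => (l, Function.update x s z))
          (Continuous.kcont (by fun_prop))
      exact this.continuous
    have := whSetoid_le hc (r := r s) (fun a b hab => by
      have := hr l (Function.update x s a) s b (by simpa using hab)
      simpa using this) h
    simpa using this
  have key : ∀ (F : Finset S) (x y : ∀ s, X s), (∀ s, whSetoid (r s) (x s) (y s)) →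
      (∀ s, s ∉ F → x s = y s) → f l x = f l y := by
    intro F
    induction F using Finset.induction_on with
    | empty =>
      intro x y _ h
      rw [show x = y from funext fun s => h s (by simp)]
    | insert a F ha ih =>
      intro x y hxy h
      rw [step x a (y a) (hxy a)]
      refine ih _ _ (fun s => ?_) (fun s hs => ?_)
      · rcases eq_or_ne s a with rfl | hne
        · simp
        · simpa [hne] using hxy s
      · rcases eq_or_ne s a with rfl | hne
        · simp
        · simpa [hne] using h s (by simp [hne, hs])
  cases nonempty_fintype S
  exact key Finset.univ _ _ (fun s => Quotient.mk_out (s := whSetoid (r s)) (x s)) (by simp)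

open Classical in
lemma multiLift_kcont {f : Λ → (∀ s, X s) → Z} (hf : KCont fun p : Λ × (∀ s, X s) => f p.1 p.2)
    (hr : ∀ l x s y, r s (x s) y → f l x = f l (Function.update x s y)) :
    KCont fun p : Λ × (∀ s, Quotient (whSetoid (r s))) => multiLift r f p.1 p.2 := by
  have key : ∀ (F : Finset S) (C : Type 1) [TopologicalSpace C] [CompactSpace C] [T2Space C]
      (l : C → Λ) (u : ∀ s, C → Quotient (whSetoid (r s))), Continuous l → (∀ s, Continuous (u s)) →
      (∀ s, s ∉ F → ∃ v : C → X s, Continuous v ∧ ∀ c, u s c = Quotient.mk _ (v c)) →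
      Continuous fun c => multiLift r f (l c) (fun s => u s c) := by
    intro F
    induction F using Finset.induction_on with
    | empty =>
      intro C _ _ _ l u hl hu h
      choose v hv huv using fun s => h s (by simp)
      simp only [huv, multiLift_mk hf hr]
      exact hf.test (u := fun c => (l c, fun s => v s c))
        (hl.prodMk (continuous_pi fun s => hv s))
    | insert a F ha ih =>
      intro C _ _ _ l u hl hu h
      let g : Quotient (whSetoid (r a)) → C → Z := fun q c =>
        multiLift r f (l c) (Function.update (fun s => u s c) a q)
      have hg : ∀ (K : Type 1) [TopologicalSpace K] [CompactSpace K] [T2Space K] (v : K → X a),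
          Continuous v → Continuous fun p : K × C => g (Quotient.mk _ (v p.1)) p.2 := by
        intro K _ _ _ v hv
        have := ih (K × C) (fun p => l p.2)
          (fun s p => Function.update (fun s => u s p.2) a (Quotient.mk _ (v p.1)) s)
          (hl.comp continuous_snd) (fun s => ?_) (fun s hs => ?_)
        · exact this
        · rcases eq_or_ne s a with rfl | hne
          · simp only [Function.update_self]
            exact continuous_quotient_mk'.comp (hv.comp continuous_fst)
          · simp only [Function.update_of_ne hne]
            exact (hu s).comp continuous_snd
        · rcases eq_or_ne s a with rfl | hne
          · exact ⟨fun p => v p.1, hv.comp continuous_fst, by simp⟩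
          · obtain ⟨w, hw, h'⟩ := h s (by simp [hne, hs])
            exact ⟨fun p => w p.2, hw.comp continuous_snd, by simpa [hne] using fun _ c => h' c⟩
      have hgc : ∀ x : X a, Continuous (g (Quotient.mk _ x)) := by
        intro x
        have := hg PUnit (fun _ => x) continuous_const
        exact this.comp (f := fun c : C => ((PUnit.unit : PUnit.{2}), c)) (by fun_prop)
      have hgc' : ∀ q, Continuous (g q) := by
        intro q
        induction q using Quotient.inductionOn with
        | _ x => exact hgc x
      let g' : Quotient (whSetoid (r a)) → C(C, Z) := fun q => ⟨g q, hgc' q⟩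
      have hg' : Continuous g' := by
        refine isQuotientMap_quotient_mk'.continuous_iff.2 ?_
        refine continuous_from_uCompactlyGeneratedSpace.{1} _ fun K v => ?_
        refine ContinuousMap.continuous_of_continuous_uncurry _ ?_
        exact hg K v v.continuous
      have := ContinuousMap.continuous_uncurry_of_continuous ⟨g', hg'⟩
      have := this.comp (f := fun c => (u a c, c)) ((hu a).prodMk continuous_id)
      convert this using 2 with c
      simp [Function.uncurry, g', g]
  intro C u
  cases nonempty_fintype S
  exact key Finset.univ C (fun c => (u c).1) (fun s c => (u c).2 s)
    (continuous_fst.comp u.continuous)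
    (fun s => (continuous_apply s).comp (continuous_snd.comp u.continuous)) (by simp)

end MultiLift

/-! ### The indexing category of orthogonal spectra -/

/-- A finite dimensional real inner product space. -/
structure IPS : Type 1 where
  carrier : Type
  [nacg : NormedAddCommGroup carrier]
  [ips : InnerProductSpace ℝ carrier]
  [fd : FiniteDimensional ℝ carrier]

attribute [instance] IPS.nacg IPS.ips IPS.fd

instance : CoeSort IPS Type := ⟨IPS.carrier⟩

/-- The zero inner product space. -/
def IPS.zero : IPS := ⟨EuclideanSpace ℝ (Fin 0)⟩

/-- The orthogonal direct sum of a finite family. -/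
def IPS.sum {S : Type} [Finite S] (V : S → IPS) : IPS :=
  letI := Fintype.ofFinite S
  ⟨PiLp 2 fun s => V s⟩

/-- The inner product space structure restricted to a linear subspace. -/
def IPS.ofSubmodule {V : IPS} (U : Submodule ℝ V) : IPS := ⟨U⟩

namespace IPS
variable {S T : Type} [Finite S] [Finite T]

/-- The `s`-th component of an element of a direct sum. -/
def comp {V : S → IPS} (x : sum V) (s : S) : V s := WithLp.ofLp x s

/-- The element of a direct sum with given components. -/
def tup {V : S → IPS} (x : ∀ s, V s) : sum V := WithLp.toLp 2 x

@[simp] lemma comp_tup {V : S → IPS} (x : ∀ s, V s) (s : S) : comp (tup x) s = x s := rfl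

@[ext] lemma sum_ext {V : S → IPS} {x y : sum V} (h : ∀ s, comp x s = comp y s) : x = y :=
  WithLp.ofLp_injective 2 (funext h)

@[simp] lemma comp_add {V : S → IPS} (x y : sum V) (s : S) :
    comp (x + y) s = comp x s + comp y s := rfl
@[simp] lemma comp_smul {V : S → IPS} (c : ℝ) (x : sum V) (s : S) :
    comp (c • x) s = c • comp x s := rfl
@[simp] lemma comp_zero {V : S → IPS} (s : S) : comp (0 : sum V) s = 0 := rfl

lemma inner_eq {V : S → IPS} [inst : Fintype S] (x y : sum V) :
    inner ℝ x y = ∑ s, inner ℝ (comp x s) (comp y s) := by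
  obtain rfl : inst = Fintype.ofFinite S := Subsingleton.elim _ _
  exact @PiLp.inner_apply ℝ _ S (Fintype.ofFinite S) (fun s => V s) _ _ x y

lemma norm_sq_eq {V : S → IPS} [Fintype S] (x : sum V) : ‖x‖ ^ 2 = ∑ s, ‖comp x s‖ ^ 2 := by
  simp only [← real_inner_self_eq_norm_sq, inner_eq]

lemma continuous_comp {V : S → IPS} (s : S) : Continuous fun x : sum V => comp x s := by
  let f : sum V →ₗ[ℝ] V s := ⟨⟨fun x => comp x s, fun _ _ => rfl⟩, fun _ _ => rfl⟩
  exact f.continuous_of_finiteDimensional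

lemma continuous_sum_iff {X : Type*} [TopologicalSpace X] {V : S → IPS} {f : X → sum V} :
    Continuous f ↔ ∀ s, Continuous fun x => comp (f x) s := by
  refine ⟨fun h s => (continuous_comp s).comp h, fun h => ?_⟩
  let _ := Fintype.ofFinite S
  exact (PiLp.continuous_toLp 2 (fun s => (V s : Type))).comp (continuous_pi h)

/-- A linear isometry from a linear map preserving the sum of squares of norms. -/
def isoOfSq {V W : IPS} (f : V →ₗ[ℝ] W) (h : ∀ x, ‖f x‖ ^ 2 = ‖x‖ ^ 2) : V →ₗᵢ[ℝ] W :=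
  ⟨f, fun x => by
    have := h x
    exact (sq_eq_sq₀ (norm_nonneg _) (norm_nonneg _)).mp this⟩

/-- The direct sum of linear isometries. -/
def sumLI {V W : S → IPS} (f : ∀ s, V s →ₗᵢ[ℝ] W s) : sum V →ₗᵢ[ℝ] sum W :=
  isoOfSq ⟨⟨fun x => tup fun s => f s (comp x s), fun x y => by ext; simp⟩,
    fun c x => by ext; simp⟩ fun x => by
      cases nonempty_fintype S
      simp [norm_sq_eq]

/-- Reindexing of a direct sum along a bijection. -/
def pull (e : S ≃ T) (V : T → IPS) : sum V →ₗᵢ[ℝ] sum (fun s => V (e s)) :=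
  isoOfSq ⟨⟨fun x => tup fun s => comp x (e s), fun x y => by ext; simp⟩,
    fun c x => by ext; simp⟩ fun x => by
      cases nonempty_fintype S
      cases nonempty_fintype T
      simp only [norm_sq_eq, LinearMap.coe_mk, AddHom.coe_mk, comp_tup]
      exact e.sum_comp (fun t => ‖comp x t‖ ^ 2)

/-- A direct sum over a disjoint union as an iterated direct sum. -/
def curry {T : S → Type} [∀ s, Finite (T s)] (V : (Σ s, T s) → IPS) :
    sum V →ₗᵢ[ℝ] sum (fun s => sum fun t => V ⟨s, t⟩) :=
  isoOfSq ⟨⟨fun x => tup fun s => tup fun t => comp x ⟨s, t⟩, fun x y => by ext; simp⟩,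
    fun c x => by ext; simp⟩ fun x => by
      cases nonempty_fintype S
      let _ := fun s => Fintype.ofFinite (T s)
      simp only [norm_sq_eq, LinearMap.coe_mk, AddHom.coe_mk, comp_tup, Fintype.sum_sigma]

/-- The identification of `V` with the direct sum of the one-member family `V`. -/
def single (V : IPS) : V →ₗᵢ[ℝ] sum (fun _ : Unit => V) :=
  isoOfSq ⟨⟨fun x => tup fun _ => x, fun x y => rfl⟩, fun c x => rfl⟩ fun x => by
    rw [norm_sq_eq]
    simp only [Finset.univ_unique, Finset.sum_singleton]
    rfl

/-- Interchange of the order of summation. -/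
def swap (V : S → T → IPS) :
    (sum fun t => sum fun s => V s t) →ₗᵢ[ℝ] (sum fun s => sum fun t => V s t) :=
  isoOfSq ⟨⟨fun x => tup fun s => tup fun t => comp (comp x t) s, fun x y => by ext; simp⟩,
    fun c x => by ext; simp⟩ fun x => by
      cases nonempty_fintype S
      cases nonempty_fintype T
      simp only [norm_sq_eq, LinearMap.coe_mk, AddHom.coe_mk, comp_tup]
      exact Finset.sum_comm

variable (e : S ≃ T) (V : T → IPS)

lemma pull_bijective : Function.Bijective (pull e V) := by
  refine ⟨(pull e V).injective, fun y => ⟨tup (Equiv.piCongrLeft (fun t => (V t : Type)) e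
    (comp y)), ?_⟩⟩
  ext s
  exact Equiv.piCongrLeft_apply_apply (fun t => (V t : Type)) e _ s

/-- The inverse of the reindexing isometry. -/
def push : sum (fun s => V (e s)) →ₗᵢ[ℝ] sum V :=
  (LinearIsometryEquiv.ofSurjective (pull e V) (pull_bijective e V).2).symm.toLinearIsometry

@[simp] lemma sumLI_comp {V W : S → IPS} (f : ∀ s, V s →ₗᵢ[ℝ] W s) (x : sum V) (s : S) :
    comp (sumLI f x) s = f s (comp x s) := rfl
@[simp] lemma pull_comp (x : sum V) (s : S) : comp (pull e V x) s = comp x (e s) := rfl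
@[simp] lemma curry_comp {T : S → Type} [∀ s, Finite (T s)] (V : (Σ s, T s) → IPS) (x : sum V)
    (s : S) (t : T s) : comp (comp (curry V x) s) t = comp x ⟨s, t⟩ := rfl
@[simp] lemma single_comp (V : IPS) (x : V) (s : Unit) : comp (single V x) s = x := rfl
@[simp] lemma swap_comp (V : S → T → IPS) (x : sum fun t => sum fun s => V s t) (s : S) (t : T) :
    comp (comp (swap V x) s) t = comp (comp x t) s := rfl
@[simp] lemma push_comp (x : sum (fun s => V (e s))) (s : S) :
    comp (push e V x) (e s) = comp x s := by
  have : pull e V (push e V x) = x :=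
    (LinearIsometryEquiv.ofSurjective (pull e V) (pull_bijective e V).2).apply_symm_apply x
  conv_rhs => rw [← this]
  rfl

end IPS

/-- A point of the total space over the space of linear isometries `V → W` of the bundle whose
fibre over `f` is the orthogonal complement of `f(V)` in `W`. -/
@[ext]
structure JHom (V W : IPS) where
  iso : V →ₗᵢ[ℝ] W
  vec : W
  orth : ∀ v, inner ℝ (iso v) vec = 0

namespace JHom
variable {U V W : IPS}

instance : TopologicalSpace (JHom V W) :=
  .induced (fun h => (h.iso.toContinuousLinearMap, h.vec)) inferInstance

/-- A linear isometry, with the zero vector of the complement. -/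
@[simps] def ofIso (f : V →ₗᵢ[ℝ] W) : JHom V W := ⟨f, 0, by simp⟩

/-- The identity. -/
def id (V : IPS) : JHom V V := ofIso LinearIsometry.id

/-- Composition. -/
@[simps] def comp (g : JHom V W) (f : JHom U V) : JHom U W where
  iso := g.iso.comp f.iso
  vec := g.vec + g.iso f.vec
  orth u := by
    rw [inner_add_right]
    simp [g.orth, f.orth]

/-- Orthogonal direct sum. -/
@[simps] def sum {S : Type} [Finite S] {V W : S → IPS} (f : ∀ s, JHom (V s) (W s)) :
    JHom (IPS.sum V) (IPS.sum W) where
  iso := IPS.sumLI fun s => (f s).iso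
  vec := IPS.tup fun s => (f s).vec
  orth v := by
    cases nonempty_fintype S
    simp [IPS.inner_eq, (f _).orth]

/-- Rescaling of the vector of the complement. -/
@[simps] def scale (c : ℝ) (f : JHom V W) : JHom V W where
  iso := f.iso
  vec := c • f.vec
  orth v := by rw [inner_smul_right, f.orth, mul_zero]

@[simp] lemma id_iso_apply (v : V) : (id V).iso v = v := rfl
@[simp] lemma id_vec : (id V).vec = 0 := rfl

lemma ext' {f g : JHom V W} (h : ∀ v, f.iso v = g.iso v) (h' : f.vec = g.vec) : f = g :=
  JHom.ext (LinearIsometry.ext h) h'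

@[simp] lemma comp_id (f : JHom V W) : f.comp (id V) = f := by apply ext' <;> simp
@[simp] lemma id_comp (f : JHom V W) : (id W).comp f = f := by apply ext' <;> simp
lemma comp_assoc {X : IPS} (h : JHom W X) (g : JHom V W) (f : JHom U V) :
    (h.comp g).comp f = h.comp (g.comp f) := by
  apply ext' <;> simp [add_assoc]
lemma sum_comp {S : Type} [Finite S] {U V W : S → IPS} (g : ∀ s, JHom (V s) (W s))
    (f : ∀ s, JHom (U s) (V s)) : (sum g).comp (sum f) = sum fun s => (g s).comp (f s) := by
  apply ext'
  · intro v; ext s; simp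
  · ext s; simp
@[simp] lemma sum_id {S : Type} [Finite S] (V : S → IPS) :
    sum (fun s => id (V s)) = id (IPS.sum V) := by
  apply ext'
  · intro v; ext s; simp
  · ext s; simp
lemma scale_comp (c : ℝ) (g : JHom V W) (f : JHom U V) :
    (g.comp f).scale c = (g.scale c).comp (f.scale c) := by
  apply ext' <;> simp
lemma scale_sum (c : ℝ) {S : Type} [Finite S] {V W : S → IPS} (f : ∀ s, JHom (V s) (W s)) :
    (sum f).scale c = sum fun s => (f s).scale c := by
  apply ext'
  · intro v; rfl
  · ext s; simp

lemma comp_norm_sq (g : JHom V W) (f : JHom U V) :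
    ‖(g.comp f).vec‖ ^ 2 = ‖g.vec‖ ^ 2 + ‖f.vec‖ ^ 2 := by
  have h : inner ℝ g.vec (g.iso f.vec) = 0 := by rw [real_inner_comm]; exact g.orth _
  rw [comp_vec, norm_add_sq_real, h, g.iso.norm_map]
  ring

end JHom

namespace JHom
variable {U V W : IPS}

lemma continuous_vec : Continuous (JHom.vec : JHom V W → W) :=
  continuous_snd.comp (continuous_induced_dom
    (f := fun h : JHom V W => (h.iso.toContinuousLinearMap, h.vec)))

lemma continuous_iso : Continuous fun h : JHom V W => h.iso.toContinuousLinearMap :=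
  continuous_fst.comp (continuous_induced_dom
    (f := fun h : JHom V W => (h.iso.toContinuousLinearMap, h.vec)))

lemma continuous_rng {X : Type*} [TopologicalSpace X] {f : X → JHom V W}
    (h : ∀ v, Continuous fun x => (f x).iso v) (h' : Continuous fun x => (f x).vec) :
    Continuous f :=
  continuous_induced_rng.2 ((continuous_clm_apply.2 h).prodMk h')

lemma continuous_iso_apply {X : Type*} [TopologicalSpace X] {f : X → JHom V W} {v : X → V}
    (h : Continuous f) (h' : Continuous v) : Continuous fun x => (f x).iso (v x) :=
  (continuous_iso.comp h).clm_apply h'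

lemma isCompact_le (R : ℝ) : IsCompact {h : JHom V W | ‖h.vec‖ ≤ R} := by
  let ι : JHom V W → (V →L[ℝ] W) × W := fun h => (h.iso.toContinuousLinearMap, h.vec)
  have hind : IsInducing ι := ⟨rfl⟩
  let K : Set ((V →L[ℝ] W) × W) := {p | (∀ v, ‖p.1 v‖ = ‖v‖) ∧ (∀ v, inner ℝ (p.1 v) p.2 = 0)} ∩
    (Metric.closedBall 0 1 ×ˢ Metric.closedBall 0 R)
  have hK : IsCompact K := by
    refine IsCompact.inter_left ((isCompact_closedBall _ _).prod (isCompact_closedBall _ _)) ?_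
    refine IsClosed.and ?_ ?_
    · simp only [Set.ofPred_forall]
      exact isClosed_iInter fun v => isClosed_eq (by fun_prop) (by fun_prop)
    · simp only [Set.ofPred_forall]
      exact isClosed_iInter fun v => isClosed_eq (by fun_prop) (by fun_prop)
  have him : ι '' {h : JHom V W | ‖h.vec‖ ≤ R} = K := by
    ext p
    constructor
    · rintro ⟨h, hh, rfl⟩
      refine ⟨⟨fun v => h.iso.norm_map v, h.orth⟩, ?_, ?_⟩
      · simpa using h.iso.norm_toContinuousLinearMap_le
      · simpa [ι] using hh
    · rintro ⟨⟨h1, h2⟩, -, h3⟩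
      exact ⟨⟨⟨p.1, h1⟩, p.2, h2⟩, by simpa using h3, rfl⟩
  rw [hind.isCompact_iff, him]
  exact hK

lemma continuous_comp₂ : Continuous fun p : JHom V W × JHom U V => p.1.comp p.2 := by
  refine continuous_rng (fun v => ?_) ?_
  · exact continuous_iso_apply (f := fun p : JHom V W × JHom U V => p.1) (v := fun p => p.2.iso v)
      continuous_fst (continuous_iso_apply continuous_snd continuous_const)
  · exact (continuous_vec.comp continuous_fst).add
      (continuous_iso_apply continuous_fst (continuous_vec.comp continuous_snd))

lemma continuous_sum {S : Type} [Finite S] {V W : S → IPS} :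
    Continuous fun f : (∀ s, JHom (V s) (W s)) => sum f := by
  refine continuous_rng (fun v => ?_) ?_
  · refine IPS.continuous_sum_iff.2 fun s => ?_
    exact continuous_iso_apply (continuous_apply s) continuous_const
  · exact IPS.continuous_sum_iff.2 fun s => continuous_vec.comp (continuous_apply s)

end JHom

/-- The morphism space of the indexing category: the Thom space of the bundle of orthogonal
complements, that is, the one-point compactification of its total space. -/
abbrev J (V W : IPS) := OnePoint (JHom V W)

namespace J
variable {U V W : IPS}

/-- Composition of morphisms; the point at infinity is a zero. -/
def comp : J V W → J U V → J U W
  | OnePoint.some g, OnePoint.some f => OnePoint.some (g.comp f)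
  | _, _ => OnePoint.infty

open Classical in
/-- Orthogonal direct sum of morphisms. -/
def sum {S : Type} [Finite S] {V W : S → IPS} (q : ∀ s, J (V s) (W s)) :
    J (IPS.sum V) (IPS.sum W) :=
  if h : ∀ s, ∃ f : JHom (V s) (W s), q s = OnePoint.some f then
    OnePoint.some (JHom.sum fun s => (h s).choose)
  else OnePoint.infty

/-- Rescaling of the sphere coordinate. -/
def scale (c : ℝ) : J V W → J V W
  | OnePoint.some f => OnePoint.some (f.scale c)
  | _ => OnePoint.infty

@[simp] lemma comp_some (g : JHom V W) (f : JHom U V) :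
    comp (OnePoint.some g) (OnePoint.some f) = OnePoint.some (g.comp f) := rfl
@[simp] lemma infty_comp (f : J U V) : comp (OnePoint.infty : J V W) f = OnePoint.infty := rfl
@[simp] lemma comp_infty (g : J V W) : comp g (OnePoint.infty : J U V) = OnePoint.infty := by
  cases g <;> rfl
@[simp] lemma scale_some (c : ℝ) (f : JHom V W) :
    scale c (OnePoint.some f) = OnePoint.some (f.scale c) := rfl
@[simp] lemma scale_infty (c : ℝ) : scale c (OnePoint.infty : J V W) = OnePoint.infty := rfl

@[simp] lemma sum_some {S : Type} [Finite S] {V W : S → IPS} (f : ∀ s, JHom (V s) (W s)) :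
    sum (fun s => OnePoint.some (f s)) = OnePoint.some (JHom.sum f) := by
  have h : ∀ s, ∃ g : JHom (V s) (W s), (OnePoint.some (f s) : J (V s) (W s)) = OnePoint.some g :=
    fun s => ⟨f s, rfl⟩
  rw [sum, dif_pos h]
  congr
  funext s
  exact (OnePoint.coe_injective (h s).choose_spec).symm

lemma sum_infty {S : Type} [Finite S] {V W : S → IPS} {q : ∀ s, J (V s) (W s)} {s : S}
    (h : q s = OnePoint.infty) : sum q = OnePoint.infty := by
  rw [sum, dif_neg]
  intro h'
  obtain ⟨f, hf⟩ := h' s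
  rw [h] at hf
  exact OnePoint.infty_ne_coe _ hf

lemma sum_cases {S : Type} [Finite S] {V W : S → IPS} (q : ∀ s, J (V s) (W s)) :
    (∃ f : ∀ s, JHom (V s) (W s), q = fun s => OnePoint.some (f s)) ∨
      ∃ s, q s = OnePoint.infty := by
  by_cases h : ∃ s, q s = OnePoint.infty
  · exact .inr h
  · push Not at h
    choose f hf using fun s => OnePoint.ne_infty_iff_exists.1 (h s)
    exact .inl ⟨f, funext fun s => (hf s).symm⟩

lemma comp_assoc {X : IPS} (h : J W X) (g : J V W) (f : J U V) :
    comp (comp h g) f = comp h (comp g f) := by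
  induction h using OnePoint.rec <;> induction g using OnePoint.rec <;>
    induction f using OnePoint.rec <;> simp [JHom.comp_assoc]

lemma sum_comp {S : Type} [Finite S] {U V W : S → IPS} (g : ∀ s, J (V s) (W s))
    (f : ∀ s, J (U s) (V s)) : comp (sum g) (sum f) = sum fun s => comp (g s) (f s) := by
  rcases sum_cases g with ⟨g, rfl⟩ | ⟨s, hs⟩
  · rcases sum_cases f with ⟨f, rfl⟩ | ⟨s, hs⟩
    · simp [JHom.sum_comp]
    · rw [sum_infty hs, comp_infty, sum_infty (s := s)]
      rw [hs, comp_infty]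
  · rw [sum_infty hs, infty_comp, sum_infty (s := s)]
    rw [hs, infty_comp]

lemma tendsto_infty {α : Type*} {l : Filter α} {u : α → J V W} :
    Filter.Tendsto u l (𝓝 OnePoint.infty) ↔
      ∀ R : ℝ, ∀ᶠ a in l, ∀ h : JHom V W, u a = OnePoint.some h → R < ‖h.vec‖ := by
  constructor
  · intro H R
    have ho : IsOpen {q : J V W | ∀ h : JHom V W, q = OnePoint.some h → R < ‖h.vec‖} := by
      rw [OnePoint.isOpen_iff_of_mem (by
        intro h hh; exact absurd hh (OnePoint.infty_ne_coe _))]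
      have : ((OnePoint.some : JHom V W → J V W) ⁻¹'
          {q : J V W | ∀ h : JHom V W, q = OnePoint.some h → R < ‖h.vec‖})ᶜ =
          {h | ‖h.vec‖ ≤ R} := by
        ext h
        simp
      rw [this]
      exact ⟨isClosed_le JHom.continuous_vec.norm continuous_const, JHom.isCompact_le R⟩
    exact H (ho.mem_nhds (by intro h hh; exact absurd hh (OnePoint.infty_ne_coe _)))
  · intro H s hs
    rw [mem_nhds_iff] at hs
    obtain ⟨t, hts, hto, hmem⟩ := hs
    rw [OnePoint.isOpen_iff_of_mem hmem] at hto
    obtain ⟨R, hR⟩ := hto.2.bddAbove_image (f := fun h : JHom V W => ‖h.vec‖)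
      JHom.continuous_vec.norm.continuousOn
    rw [Filter.mem_map]
    filter_upwards [H R] with a ha
    refine hts ?_
    rcases hq : u a with _ | h
    · exact hmem
    · by_contra hn
      have := hR ⟨h, hn, rfl⟩
      exact absurd (ha h hq) (not_lt.2 this)

lemma continuous_comp : Continuous fun p : J V W × J U V => comp p.1 p.2 := by
  rw [continuous_iff_continuousAt]
  rintro ⟨q, p⟩
  by_cases hc : q = OnePoint.infty ∨ p = OnePoint.infty
  · have h0 : comp q p = OnePoint.infty := by rcases hc with rfl | rfl <;> simp
    change Filter.Tendsto _ _ (𝓝 (comp q p))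
    rw [h0, tendsto_infty]
    intro R
    have aux : ∀ᶠ a : J V W × J U V in 𝓝 (q, p),
        (∀ g, a.1 = OnePoint.some g → |R| < ‖g.vec‖) ∨ (∀ f, a.2 = OnePoint.some f → |R| < ‖f.vec‖) := by
      rcases hc with rfl | rfl
      · exact ((tendsto_infty (u := fun q : J V W => q)).1 Filter.tendsto_id |R|).prod_inl_nhds p
          |>.mono fun _ h => .inl h
      · exact ((tendsto_infty (u := fun q : J U V => q)).1 Filter.tendsto_id |R|).prod_inr_nhds q
          |>.mono fun _ h => .inr h
    filter_upwards [aux]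
    rintro ⟨a, b⟩ hab h hh
    induction a using OnePoint.rec with
    | infty => simp at hh
    | coe g =>
      induction b using OnePoint.rec with
      | infty => simp at hh
      | coe f =>
        obtain rfl := OnePoint.coe_injective hh
        have := JHom.comp_norm_sq g f
        refine (le_abs_self R).trans_lt (lt_of_pow_lt_pow_left₀ 2 (norm_nonneg _) ?_)
        rw [this]
        rcases hab with h | h
        · have := pow_lt_pow_left₀ (h g rfl) (abs_nonneg R) two_ne_zero
          nlinarith [sq_nonneg ‖f.vec‖]
        · have := pow_lt_pow_left₀ (h f rfl) (abs_nonneg R) two_ne_zero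
          nlinarith [sq_nonneg ‖g.vec‖]
  · push Not at hc
    obtain ⟨g, rfl⟩ := OnePoint.ne_infty_iff_exists.1 hc.1
    obtain ⟨f, rfl⟩ := OnePoint.ne_infty_iff_exists.1 hc.2
    have he := (OnePoint.isOpenEmbedding_coe (X := JHom V W)).prodMap
      (OnePoint.isOpenEmbedding_coe (X := JHom U V))
    refine (he.continuousAt_iff (x := (g, f))).1 ?_
    exact (OnePoint.continuous_coe.comp JHom.continuous_comp₂).continuousAt

lemma continuous_sum {S : Type} [Finite S] {V W : S → IPS} :
    Continuous fun q : (∀ s, J (V s) (W s)) => sum q := by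
  rw [continuous_iff_continuousAt]
  intro q
  rcases sum_cases q with ⟨f, rfl⟩ | ⟨s, hs⟩
  · have he : IsOpenEmbedding (Pi.map fun s => (OnePoint.some : JHom (V s) (W s) → _)) :=
      IsOpenEmbedding.piMap fun s => OnePoint.isOpenEmbedding_coe
    refine (he.continuousAt_iff (x := f)).1 ?_
    have : (fun q : (∀ s, J (V s) (W s)) => sum q) ∘ (Pi.map fun s =>
        (OnePoint.some : JHom (V s) (W s) → _)) = OnePoint.some ∘ JHom.sum := by
      funext f
      exact sum_some f
    rw [this]
    exact (OnePoint.continuous_coe.comp JHom.continuous_sum).continuousAt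
  · change Filter.Tendsto _ _ (𝓝 (sum q))
    rw [sum_infty hs, tendsto_infty]
    intro R
    have h1 : Filter.Tendsto (fun q : (∀ s, J (V s) (W s)) => q s) (𝓝 q) (𝓝 OnePoint.infty) := by
      rw [← hs]; exact (continuous_apply s).continuousAt
    filter_upwards [tendsto_infty.1 h1 R]
    intro a ha h hh
    rcases sum_cases a with ⟨f, rfl⟩ | ⟨t, ht⟩
    · rw [sum_some] at hh
      obtain rfl := OnePoint.coe_injective hh
      refine (ha (f s) rfl).trans_le ?_
      cases nonempty_fintype S
      refine (pow_le_pow_iff_left₀ (norm_nonneg _) (norm_nonneg _) two_ne_zero).1 ?_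
      rw [IPS.norm_sq_eq]
      exact Finset.single_le_sum (f := fun s => ‖IPS.comp (JHom.sum f).vec s‖ ^ 2)
        (fun _ _ => sq_nonneg _) (Finset.mem_univ s)
    · rw [sum_infty ht] at hh
      exact absurd hh (OnePoint.infty_ne_coe _)

lemma continuous_scale {c : ℝ} (hc : 0 < c) : Continuous (scale c : J V W → J V W) := by
  rw [continuous_iff_continuousAt]
  intro q
  induction q using OnePoint.rec with
  | infty =>
    change Filter.Tendsto _ _ (𝓝 OnePoint.infty)
    rw [tendsto_infty]
    intro R
    filter_upwards [(tendsto_infty (u := fun q : J V W => q)).1 Filter.tendsto_id (R / c)]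
    intro a ha h hh
    induction a using OnePoint.rec with
    | infty => simp at hh
    | coe f =>
      obtain rfl := OnePoint.coe_injective hh
      have := ha f rfl
      rw [div_lt_iff₀ hc] at this
      simpa [norm_smul, abs_of_pos hc, mul_comm] using this
  | coe f =>
    refine ((OnePoint.isOpenEmbedding_coe (X := JHom V W)).continuousAt_iff (x := f)).1 ?_
    refine (OnePoint.continuous_coe.comp (Y := JHom V W) (f := JHom.scale c) ?_).continuousAt
    exact JHom.continuous_rng (fun v => JHom.continuous_iso_apply (f := fun h : JHom V W => h)
      continuous_id continuous_const)
      (JHom.continuous_vec.const_smul c)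

end J

/-! ### Orthogonal spectra -/

/-- An orthogonal spectrum: a continuous functor from the indexing category to based compactly
generated weak Hausdorff spaces.  The functor is given on points of `J V W` other than infinity, and
infinity acts as the constant map to the base point. -/
structure Spectrum where
  obj : IPS → Type 1
  [top : ∀ V, TopologicalSpace (obj V)]
  [cg : ∀ V, UCompactlyGeneratedSpace.{1} (obj V)]
  [wh : ∀ V, WeakHausdorff (obj V)]
  pt : ∀ V, obj V
  map : ∀ {V W : IPS}, JHom V W → obj V → obj W
  map_pt : ∀ {V W : IPS} (f : JHom V W), map f (pt V) = pt W
  map_id : ∀ {V : IPS} (x : obj V), map (JHom.id V) x = x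
  map_comp : ∀ {U V W : IPS} (g : JHom V W) (f : JHom U V) (x : obj U),
    map (g.comp f) x = map g (map f x)
  kcont : ∀ {V W : IPS},
    KCont fun p : J V W × obj V => p.1.elim (pt W) fun f => map f p.2

attribute [instance] Spectrum.top Spectrum.cg Spectrum.wh

namespace Spectrum

/-- The action of the morphism space, including infinity. -/
def mapJ (X : Spectrum) {V W : IPS} (q : J V W) (x : X.obj V) : X.obj W :=
  q.elim (X.pt W) fun f => X.map f x

section
variable (X : Spectrum) {U V W : IPS}

@[simp] lemma mapJ_some (f : JHom V W) (x : X.obj V) : X.mapJ (OnePoint.some f) x = X.map f x := rfl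
@[simp] lemma mapJ_infty (x : X.obj V) : X.mapJ (OnePoint.infty : J V W) x = X.pt W := rfl
@[simp] lemma mapJ_pt (q : J V W) : X.mapJ q (X.pt V) = X.pt W := by
  induction q using OnePoint.rec <;> simp [X.map_pt]
lemma mapJ_comp (g : J V W) (f : J U V) (x : X.obj U) :
    X.mapJ (J.comp g f) x = X.mapJ g (X.mapJ f x) := by
  induction g using OnePoint.rec <;> induction f using OnePoint.rec <;>
    simp [X.map_comp]
lemma mapJ_kcont : KCont fun p : J V W × X.obj V => X.mapJ p.1 p.2 := X.kcont
lemma continuous_map (f : JHom V W) : Continuous (X.map f) :=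
  (X.mapJ_kcont.comp (f := fun x : X.obj V => ((OnePoint.some f : J V W), x))
    (Continuous.kcont (by fun_prop))).continuous

end

/-- Maps of orthogonal spectra. -/
@[ext]
structure Hom (X Y : Spectrum) where
  app : ∀ V, X.obj V → Y.obj V
  continuous_app : ∀ V, Continuous (app V)
  app_pt : ∀ V, app V (X.pt V) = Y.pt V
  naturality : ∀ {V W : IPS} (f : JHom V W) (x : X.obj V),
    app W (X.map f x) = Y.map f (app V x)

/-- The identity map. -/
@[simps] def Hom.id (X : Spectrum) : Hom X X :=
  ⟨fun _ x => x, fun _ => continuous_id, fun _ => rfl, fun _ _ => rfl⟩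

/-- Composition of maps of spectra. -/
@[simps] def Hom.comp {X Y Z : Spectrum} (g : Hom Y Z) (f : Hom X Y) : Hom X Z where
  app V x := g.app V (f.app V x)
  continuous_app V := (g.continuous_app V).comp (f.continuous_app V)
  app_pt V := by rw [f.app_pt, g.app_pt]
  naturality f' x := by rw [f.naturality, g.naturality]

/-- Endomorphisms under composition. -/
instance (X : Spectrum) : Monoid (Hom X X) where
  mul g f := g.comp f
  one := Hom.id X
  mul_assoc _ _ _ := rfl
  one_mul _ := rfl
  mul_one _ := rfl

/-- The space of maps of spectra.  Its topology is that of the mapping space in compactly generated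
spaces: the finest one for which `C → Hom X Y` is continuous for every compact Hausdorff `C` and
every family of maps whose adjoints `C × X(V) → Y(V)` are continuous. -/
instance Hom.topology (X Y : Spectrum) : TopologicalSpace (Hom X Y) :=
  ⨆ (C : CompHaus.{1}) (u : {u : C → Hom X Y //
      ∀ V, KCont fun p : C × X.obj V => (u p.1).app V p.2}), .coinduced u.1 inferInstance

/-- The spectrum `X` with sphere coordinates rescaled by `c > 0`: the pullback of the functor `X`
along the automorphism `(f, w) ↦ (f, c w)` of the indexing category. -/
@[simps obj] def rescale (c : ℝ) (hc : 0 < c) (X : Spectrum) : Spectrum where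
  obj := X.obj
  top := X.top
  cg := X.cg
  wh := X.wh
  pt := X.pt
  map f x := X.map (f.scale c) x
  map_pt f := X.map_pt _
  map_id {V} x := by
    have : (JHom.id V).scale c = JHom.id V := JHom.ext' (fun _ => rfl) (by simp)
    rw [this, X.map_id]
  map_comp g f x := by rw [JHom.scale_comp, X.map_comp]
  kcont {V W} := by
    have := X.mapJ_kcont.comp (f := fun p : J V W × X.obj V => (J.scale c p.1, p.2))
      (Continuous.kcont (((J.continuous_scale hc).comp continuous_fst).prodMk continuous_snd))
    convert this using 2 with p
    rcases p with ⟨_ | f, x⟩ <;> rfl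

/-- Rescaling is a functor. -/
@[simps] def Hom.rescale (c : ℝ) (hc : 0 < c) {X Y : Spectrum} (f : Hom X Y) :
    Hom (X.rescale c hc) (Y.rescale c hc) where
  app := f.app
  continuous_app := f.continuous_app
  app_pt := f.app_pt
  naturality g x := f.naturality (g.scale c) x

end Spectrum

/-- An orthogonal `G`-spectrum, as an orthogonal spectrum with a continuous action of `G`.  Its value
at a `G`-representation `V` is `obj V` with `G` acting both through the given action and through
the action on `V`; in this form the universe plays no role on the point-set level. -/
structure GSpectrum (G : Type) [Group G] [TopologicalSpace G] extends Spectrum where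
  act : ∀ {V : IPS}, G → obj V → obj V
  act_one : ∀ {V : IPS} (x : obj V), act 1 x = x
  act_mul : ∀ {V : IPS} (g h : G) (x : obj V), act (g * h) x = act g (act h x)
  act_pt : ∀ {V : IPS} (g : G), act g (pt V) = pt V
  act_map : ∀ {V W : IPS} (g : G) (f : JHom V W) (x : obj V), act g (map f x) = map f (act g x)
  act_kcont : ∀ {V : IPS}, KCont fun p : G × obj V => act p.1 p.2

/-- Equivariance of a map of spectra. -/
def Spectrum.Hom.IsEquivariant {G : Type} [Group G] [TopologicalSpace G] {X Y : GSpectrum G}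
    (f : Spectrum.Hom X.toSpectrum Y.toSpectrum) : Prop :=
  ∀ (V : IPS) (g : G) (x : X.obj V), f.app V (X.act g x) = Y.act g (f.app V x)

lemma GSpectrum.continuous_act {G : Type} [Group G] [TopologicalSpace G] (X : GSpectrum G) {V : IPS}
    (g : G) : Continuous (X.act g : X.obj V → X.obj V) :=
  (X.act_kcont.comp (f := fun x : X.obj V => (g, x))
    (Continuous.kcont (by fun_prop))).continuous

/-! ### Spectra presented by generators: enriched coends -/

/-- Data for a coend `∫ⁱ J(P i, -) ∧ Y i`: an indexing type of generators `y` at level `P i`, the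
set of generators identified with the base point, and relations: `R p y y'` imposes that the
structure map of `p` takes the generator `y` to the generator `y'`. -/
structure Presentation where
  I : Type 1
  P : I → IPS
  Y : I → Type 1
  [top : ∀ i, TopologicalSpace (Y i)]
  base : ∀ i, Set (Y i)
  i₀ : I
  y₀ : Y i₀
  R : ∀ {i j : I}, JHom (P i) (P j) → Y i → Y j → Prop
  R_id : ∀ {i : I} (y : Y i), R (JHom.id (P i)) y y

attribute [instance] Presentation.top

namespace Presentation
variable (D : Presentation)

/-- A point of the disjoint union of the products `J(P i, V) × Y i`. -/
structure Pre (V : IPS) : Type 1 where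
  idx : D.I
  mor : J (D.P idx) V
  gen : D.Y idx

/-- The identification with the disjoint union. -/
def Pre.toSigma {D : Presentation} {V : IPS} (x : D.Pre V) : Σ i : D.I, J (D.P i) V × D.Y i :=
  ⟨x.idx, x.mor, x.gen⟩

/-- The disjoint union carries the compactly generated topology. -/
instance (V : IPS) : TopologicalSpace (D.Pre V) :=
  @TopologicalSpace.compactlyGenerated.{1} (D.Pre V) (.induced Pre.toSigma inferInstance)

/-- The relation defining the coend. -/
inductive Rel (V : IPS) : D.Pre V → D.Pre V → Prop
  | glue {i j : D.I} (p : JHom (D.P i) (D.P j)) (y : D.Y i) (y' : D.Y j) (h : D.R p y y')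
      (q : J (D.P j) V) : Rel V ⟨i, J.comp q (OnePoint.some p), y⟩ ⟨j, q, y'⟩
  | base (a b : D.Pre V) (ha : a.mor = OnePoint.infty ∨ a.gen ∈ D.base a.idx)
      (hb : b.mor = OnePoint.infty ∨ b.gen ∈ D.base b.idx) : Rel V a b

/-- The coend at level `V`, formed in compactly generated weak Hausdorff spaces. -/
def Obj (V : IPS) : Type 1 := Quotient (whSetoid (D.Rel V))

variable {D}

lemma continuous_toSigma (V : IPS) : Continuous (Pre.toSigma : D.Pre V → _) := by
  let t : TopologicalSpace (D.Pre V) := .induced Pre.toSigma inferInstance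
  have h : Continuous[t, _] (Pre.toSigma : D.Pre V → _) := continuous_induced_dom
  exact @continuous_from_compactlyGenerated.{1} (D.Pre V) _ t _ _
    fun C u => h.comp (@ContinuousMap.continuous C (D.Pre V) _ t u)

lemma continuous_pre {V : IPS} {C : CompHaus.{1}} {u : C → D.Pre V}
    (hu : Continuous fun c => (u c).toSigma) : Continuous u := by
  let t : TopologicalSpace (D.Pre V) := .induced Pre.toSigma inferInstance
  let u' : @ContinuousMap C (D.Pre V) _ t := @ContinuousMap.mk _ _ _ t u (continuous_induced_rng.2 hu)
  have h1 : Continuous fun c : C =>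
      (⟨⟨C, u'⟩, c⟩ : Σ (i : (T : CompHaus.{1}) × @ContinuousMap T (D.Pre V) _ t), i.fst) :=
    continuous_sigmaMk (σ := fun i : (T : CompHaus.{1}) × @ContinuousMap T (D.Pre V) _ t => i.fst)
      (i := ⟨C, u'⟩)
  let f : (Σ (i : (T : CompHaus.{1}) × @ContinuousMap T (D.Pre V) _ t), i.fst) → D.Pre V :=
    fun p => p.1.2.toFun p.2
  exact @Continuous.comp _ _ _ _ _ (instTopologicalSpacePre D V) (fun c : C => ⟨⟨C, u'⟩, c⟩) f
    continuous_coinduced_rng h1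

instance cgPre (V : IPS) : UCompactlyGeneratedSpace.{1} (D.Pre V) := by
  refine uCompactlyGeneratedSpace_of_continuous_maps fun f hf => ?_
  let t : TopologicalSpace (D.Pre V) := .induced Pre.toSigma inferInstance
  have h : Continuous[t, _] (Pre.toSigma : D.Pre V → _) := continuous_induced_dom
  exact @continuous_from_compactlyGenerated.{1} (D.Pre V) _ t _ f fun C u =>
    hf C (@ContinuousMap.mk _ _ _ (instTopologicalSpacePre D V) u.toFun
      (continuous_pre (h.comp (@ContinuousMap.continuous C (D.Pre V) _ t u))))

lemma kcont_preMk (V : IPS) (i : D.I) :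
    KCont (fun x : J (D.P i) V × D.Y i => (⟨i, x.1, x.2⟩ : D.Pre V)) := fun _ u =>
  continuous_pre (continuous_sigmaMk.comp u.continuous)

instance (V : IPS) : TopologicalSpace (D.Obj V) :=
  inferInstanceAs (TopologicalSpace (Quotient (whSetoid (D.Rel V))))
instance (V : IPS) : UCompactlyGeneratedSpace.{1} (D.Obj V) :=
  inferInstanceAs (UCompactlyGeneratedSpace.{1} (Quotient (whSetoid (D.Rel V))))
instance (V : IPS) : WeakHausdorff (D.Obj V) :=
  inferInstanceAs (WeakHausdorff (Quotient (whSetoid (D.Rel V))))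

/-- The class of `q ∧ y`. -/
def cls {V : IPS} (i : D.I) (q : J (D.P i) V) (y : D.Y i) : D.Obj V :=
  Quotient.mk (whSetoid (D.Rel V)) (⟨i, q, y⟩ : D.Pre V)

lemma cls_surj {V : IPS} (x : D.Obj V) : ∃ i q y, x = cls (D := D) i q y := by
  induction x using Quotient.inductionOn with
  | _ a => exact ⟨a.idx, a.mor, a.gen, rfl⟩

lemma cls_glue {V : IPS} {i j : D.I} (p : JHom (D.P i) (D.P j)) {y : D.Y i} {y' : D.Y j}
    (h : D.R p y y') (q : J (D.P j) V) :
    cls (D := D) i (J.comp q (OnePoint.some p)) y = cls j q y' :=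
  Quotient.sound (whSetoid_of_rel (.glue p y y' h q))

/-- The form of the gluing relation that is convenient for morphisms other than infinity. -/
lemma cls_glue' {V : IPS} {i j : D.I} (p : JHom (D.P i) (D.P j)) {y : D.Y i} {y' : D.Y j}
    (h : D.R p y y') {q : JHom (D.P j) V} {q' : JHom (D.P i) V} (hq : q' = q.comp p) :
    cls (D := D) i (OnePoint.some q') y = cls j (OnePoint.some q) y' := by
  rw [← cls_glue p h, hq]; rfl

lemma cls_base {V : IPS} {i j : D.I} {q : J (D.P i) V} {q' : J (D.P j) V} {y : D.Y i} {y' : D.Y j}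
    (h : q = OnePoint.infty ∨ y ∈ D.base i) (h' : q' = OnePoint.infty ∨ y' ∈ D.base j) :
    cls (D := D) i q y = cls j q' y' :=
  Quotient.sound (whSetoid_of_rel (.base _ _ h h'))

lemma cls_kcont {V : IPS} (i : D.I) :
    KCont fun p : J (D.P i) V × D.Y i => cls (D := D) i p.1 p.2 :=
  (Continuous.kcont continuous_quotient_mk').comp (kcont_preMk V i)

/-- Continuity on a finite product of disjoint unions is tested on the summands. -/
lemma kcont_sigma {Λ : Type*} [TopologicalSpace Λ] {S : Type} [Finite S] {I : S → Type 1}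
    {X : ∀ s, I s → Type 1} [∀ s i, TopologicalSpace (X s i)] {Z : Type*} [TopologicalSpace Z]
    (f : Λ → (∀ s, Σ i, X s i) → Z)
    (hf : ∀ i : ∀ s, I s, KCont fun p : Λ × (∀ s, X s (i s)) => f p.1 fun s => ⟨i s, p.2 s⟩) :
    KCont fun p : Λ × (∀ s, Σ i, X s i) => f p.1 p.2 := by
  intro C u
  rw [continuous_iff_continuousAt]
  intro c₀
  let i : ∀ s, I s := fun s => ((u c₀).2 s).1
  have hu : ∀ s, Continuous fun c => (u c).2 s := fun s =>
    (continuous_apply s).comp (continuous_snd.comp u.continuous)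
  let O : Set C := ⋂ s, (fun c => (u c).2 s) ⁻¹' (Set.range (Sigma.mk (i s)))
  have hO : IsClopen O := isClopen_iInter_of_finite fun s =>
    (show IsClopen (Set.range (Sigma.mk (i s))) from
      ⟨isClosed_range_sigmaMk, isOpen_range_sigmaMk⟩).preimage (hu s)
  have hc₀ : c₀ ∈ O := Set.mem_iInter.2 fun s => ⟨((u c₀).2 s).2, rfl⟩
  have : CompactSpace O := isCompact_iff_compactSpace.mp hO.1.isCompact
  choose v hv using fun (s : S) (c : O) => Set.mem_iInter.1 c.2 s
  have hvc : ∀ s, Continuous (v s) := fun s => by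
    rw [(IsEmbedding.sigmaMk (σ := X s) (i := i s)).continuous_iff]
    have : Sigma.mk (i s) ∘ v s = fun c : O => (u c).2 s := funext fun c => hv s c
    rw [this]
    exact (hu s).comp continuous_subtype_val
  have hk := (hf i).test (C := O) (u := fun c => ((u c).1, fun s => v s c))
    (((continuous_fst.comp u.continuous).comp continuous_subtype_val).prodMk
      (continuous_pi hvc))
  have hk' : Continuous fun c : O => f (u c).1 (u c).2 := by
    convert hk using 3 with c
    funext s
    exact (hv s c).symm
  exact (hO.2.isOpenEmbedding_subtypeVal.continuousAt_iff (x := ⟨c₀, hc₀⟩)).1 hk'.continuousAt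

/-- Data defining a multilinear map, with parameters in `Λ`, out of presented spectra. -/
structure MultiFamily (Λ : Type*) [TopologicalSpace Λ] {S : Type} [Finite S]
    (D : S → Presentation) (Z : Spectrum) where
  fn : Λ → ∀ (i : ∀ s, (D s).I), (∀ s, (D s).Y (i s)) → Z.obj (IPS.sum fun s => (D s).P (i s))
  kcont : ∀ i, KCont fun p : Λ × (∀ s, (D s).Y (i s)) => fn p.1 i p.2
  base : ∀ l i (y : ∀ s, (D s).Y (i s)), (∃ s, (y s : (D s).Y (i s)) ∈ ((D s).base (i s) : Set ((D s).Y (i s)))) → fn l i y = Z.pt _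
  rel : ∀ l (i j : ∀ s, (D s).I) (p : ∀ s, JHom ((D s).P (i s)) ((D s).P (j s)))
    (y : ∀ s, (D s).Y (i s)) (y' : ∀ s, (D s).Y (j s)), (∀ s, (D s).R (p s) (y s) (y' s)) →
    Z.map (JHom.sum p) (fn l i y) = fn l j y'

namespace MultiFamily
variable {Λ : Type*} [TopologicalSpace Λ] {S : Type} [Finite S] {D : S → Presentation}
  {Z : Spectrum} (F : MultiFamily Λ D Z) (V : S → IPS)

/-- The multilinear map on representatives. -/
def pre (l : Λ) (x : ∀ s, (D s).Pre (V s)) : Z.obj (IPS.sum V) :=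
  Z.mapJ (J.sum fun s => (x s).mor) (F.fn l (fun s => (x s).idx) fun s => (x s).gen)

lemma pre_kcont : KCont fun p : Λ × (∀ s, (D s).Pre (V s)) => F.pre V p.1 p.2 := by
  have h := kcont_sigma (Λ := Λ) (I := fun s => (D s).I)
    (X := fun s i => J ((D s).P i) (V s) × (D s).Y i) 
    (fun l x => F.pre V l fun s => ⟨(x s).1, (x s).2.1, (x s).2.2⟩) fun i => by
      refine Z.mapJ_kcont.comp (f := fun p : Λ × (∀ s, J ((D s).P (i s)) (V s) × (D s).Y (i s)) =>
        (J.sum fun s => (p.2 s).1, F.fn p.1 i fun s => (p.2 s).2)) (KCont.prodMk ?_ ?_)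
      · exact Continuous.kcont (J.continuous_sum.comp (by fun_prop))
      · exact (F.kcont i).comp (f := fun p : Λ × (∀ s, J ((D s).P (i s)) (V s) × (D s).Y (i s)) =>
          (p.1, fun s => (p.2 s).2)) (Continuous.kcont (by fun_prop))
  exact h.comp (f := fun p : Λ × (∀ s, (D s).Pre (V s)) =>
    (p.1, fun s => (p.2 s).toSigma))
    (Continuous.kcont (continuous_fst.prodMk (continuous_pi fun s =>
      (continuous_toSigma (V s)).comp ((continuous_apply s).comp continuous_snd))))

lemma pre_base (l : Λ) (x : ∀ s, (D s).Pre (V s)) (s : S)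
    (h : (x s).mor = OnePoint.infty ∨ (x s).gen ∈ (D s).base (x s).idx) :
    F.pre V l x = Z.pt _ := by
  rw [pre]
  rcases h with h | h
  · rw [J.sum_infty (s := s) h, Z.mapJ_infty]
  · rw [F.base _ _ _ ⟨s, h⟩, Z.mapJ_pt]

lemma pre_glue (l : Λ) (x x' : ∀ s, (D s).Pre (V s))
    (h : ∀ s, ∃ p : JHom ((D s).P (x s).idx) ((D s).P (x' s).idx),
      (D s).R p (x s).gen (x' s).gen ∧ (x s).mor = J.comp (x' s).mor (OnePoint.some p)) : F.pre V l x = F.pre V l x' := by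
  choose p hp hq using h
  simp only [pre, hq]
  rw [← J.sum_comp, J.sum_some, Z.mapJ_comp, Z.mapJ_some, F.rel _ _ _ p _ _ hp]

open Classical in
lemma pre_rel (l : Λ) (x : ∀ s, (D s).Pre (V s)) (s : S) (y : (D s).Pre (V s))
    (h : (D s).Rel (V s) (x s) y) : F.pre V l x = F.pre V l (Function.update x s y) := by
  have hid : ∀ t, ∀ z : (D t).Pre (V t), ∃ p : JHom ((D t).P z.idx) ((D t).P z.idx),
      (D t).R p z.gen z.gen ∧ z.mor = J.comp z.mor (OnePoint.some p) := fun t z =>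
    ⟨JHom.id _, (D t).R_id _, by
      rcases z with ⟨i, q, y⟩
      induction q using OnePoint.rec <;> simp⟩
  generalize hxs : x s = xs at h
  cases h with
  | glue p y y' h q =>
    refine F.pre_glue V l _ _ fun t => ?_
    rcases eq_or_ne t s with rfl | hne
    · rw [Function.update_self, hxs]
      exact ⟨p, h, rfl⟩
    · rw [Function.update_of_ne hne]
      exact hid t (x t)
  | base a b ha hb =>
    rw [F.pre_base V l x s (by rw [hxs]; exact ha), F.pre_base V l _ s (by
      rw [Function.update_self]; exact hb)]

/-- The multilinear map out of the presented spectra. -/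
def lift (l : Λ) (x : ∀ s, (D s).Obj (V s)) : Z.obj (IPS.sum V) :=
  multiLift (fun s => (D s).Rel (V s)) (fun l x => F.pre V l x) l x

lemma lift_mk (l : Λ) (i : ∀ s, (D s).I) (q : ∀ s, J ((D s).P (i s)) (V s))
    (y : ∀ s, (D s).Y (i s)) :
    F.lift V l (fun s => cls (i s) (q s) (y s)) = Z.mapJ (J.sum q) (F.fn l i y) :=
  multiLift_mk (F.pre_kcont V) (F.pre_rel V) l fun s => ⟨i s, q s, y s⟩

lemma lift_kcont : KCont fun p : Λ × (∀ s, (D s).Obj (V s)) => F.lift V p.1 p.2 :=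
  multiLift_kcont (F.pre_kcont V) (F.pre_rel V)

end MultiFamily

/-- Data defining a map, with parameters in `Λ`, out of a presented spectrum. -/
structure Family (Λ : Type*) [TopologicalSpace Λ] (D : Presentation) (Z : Spectrum) where
  fn : Λ → ∀ i : D.I, D.Y i → Z.obj (D.P i)
  kcont : ∀ i, KCont fun p : Λ × D.Y i => fn p.1 i p.2
  base : ∀ l i (y : D.Y i), y ∈ D.base i → fn l i y = Z.pt _
  rel : ∀ l (i j : D.I) (p : JHom (D.P i) (D.P j)) (y : D.Y i) (y' : D.Y j), D.R p y y' →
    Z.map p (fn l i y) = fn l j y'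

namespace Family
variable {Λ : Type*} [TopologicalSpace Λ] {D : Presentation} {Z : Spectrum} (F : Family Λ D Z)
  (V : IPS)

/-- The map on representatives. -/
def pre (l : Λ) (x : D.Pre V) : Z.obj V := Z.mapJ x.mor (F.fn l x.idx x.gen)

lemma pre_kcont : KCont fun p : Λ × D.Pre V => F.pre V p.1 p.2 := by
  have h := kcont_sigma (Λ := Λ) (S := Unit) (I := fun _ => D.I)
    (X := fun _ i => J (D.P i) V × D.Y i) 
    (fun l x => F.pre V l ⟨(x ()).1, (x ()).2.1, (x ()).2.2⟩) fun i => by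
      refine Z.mapJ_kcont.comp (f := fun p : Λ × (∀ s, J (D.P (i s)) V × D.Y (i s)) =>
        ((p.2 ()).1, F.fn p.1 (i ()) (p.2 ()).2)) (KCont.prodMk ?_ ?_)
      · exact Continuous.kcont (by fun_prop)
      · exact (F.kcont (i ())).comp (f := fun p : Λ × (∀ s, J (D.P (i s)) V × D.Y (i s)) =>
          (p.1, (p.2 ()).2)) (Continuous.kcont (by fun_prop))
  exact h.comp (f := fun p : Λ × D.Pre V =>
    (p.1, fun _ : Unit => p.2.toSigma))
    (Continuous.kcont (continuous_fst.prodMk (continuous_pi fun s =>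
      (continuous_toSigma V).comp continuous_snd)))

lemma pre_rel (l : Λ) (x y : D.Pre V) (h : D.Rel V x y) : F.pre V l x = F.pre V l y := by
  cases h with
  | glue p y y' h q =>
    simp only [pre]
    rw [Z.mapJ_comp, Z.mapJ_some, F.rel _ _ _ p _ _ h]
  | base a b ha hb =>
    have : ∀ a : D.Pre V, (a.mor = OnePoint.infty ∨ a.gen ∈ D.base a.idx) →
        F.pre V l a = Z.pt _ := by
      rintro a (h | h)
      · rw [pre, h, Z.mapJ_infty]
      · rw [pre, F.base _ _ _ h, Z.mapJ_pt]
    rw [this _ ha, this _ hb]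

/-- The map out of the presented spectrum. -/
def lift (l : Λ) (x : D.Obj V) : Z.obj V :=
  multiLift (S := Unit) (fun _ => D.Rel V) (fun l x => F.pre V l (x ())) l fun _ => x

lemma lift_aux : KCont fun p : Λ × (Unit → D.Pre V) => F.pre V p.1 (p.2 ()) :=
  (F.pre_kcont V).comp (f := fun p : Λ × (Unit → D.Pre V) => (p.1, p.2 ()))
    (Continuous.kcont (by fun_prop))

lemma lift_mk (l : Λ) (i : D.I) (q : J (D.P i) V) (y : D.Y i) :
    F.lift V l (cls i q y) = Z.mapJ q (F.fn l i y) :=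
  multiLift_mk (r := fun _ : Unit => D.Rel V) (F.lift_aux V)
    (fun l x s y h => by simpa using F.pre_rel V l _ _ h) l fun _ => ⟨i, q, y⟩

lemma lift_kcont : KCont fun p : Λ × D.Obj V => F.lift V p.1 p.2 :=
  (multiLift_kcont (r := fun _ : Unit => D.Rel V) (F.lift_aux V)
    (fun l x s y h => by simpa using F.pre_rel V l _ _ h)).comp
    (f := fun p : Λ × D.Obj V => (p.1, fun _ : Unit => p.2)) (Continuous.kcont (by fun_prop))

end Family
end Presentation

namespace Presentation
variable (D : Presentation)

section
variable {D} {V W : IPS}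

/-- Postcomposition on representatives. -/
def preComp (q : J V W) (x : D.Pre V) : D.Obj W := cls x.idx (J.comp q x.mor) x.gen

lemma preComp_kcont : KCont fun p : J V W × (Unit → D.Pre V) => preComp p.1 (p.2 ()) := by
  have h := kcont_sigma (Λ := J V W) (S := Unit) (I := fun _ => D.I)
    (X := fun _ i => J (D.P i) V × D.Y i)
    (fun l x => (preComp l ⟨(x ()).1, (x ()).2.1, (x ()).2.2⟩ : D.Obj W)) fun i => by
      refine (cls_kcont (D := D) (V := W) (i ())).comp
        (f := fun p : J V W × (∀ s, J (D.P (i s)) V × D.Y (i s)) =>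
        (J.comp p.1 (p.2 ()).1, (p.2 ()).2)) (Continuous.kcont ?_)
      refine (J.continuous_comp.comp (f := fun p : J V W × (∀ s, J (D.P (i s)) V × D.Y (i s)) =>
        (p.1, (p.2 ()).1)) (by fun_prop)).prodMk (by fun_prop)
  exact h.comp (f := fun p : J V W × (Unit → D.Pre V) =>
    (p.1, fun _ : Unit => (p.2 ()).toSigma))
    (Continuous.kcont (continuous_fst.prodMk (continuous_pi fun s =>
      (continuous_toSigma V).comp ((continuous_apply ()).comp continuous_snd))))

lemma preComp_rel (q : J V W) (x y : D.Pre V) (h : D.Rel V x y) : preComp q x = preComp q y := by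
  cases h with
  | glue p y y' h q' =>
    simp only [preComp]
    rw [← J.comp_assoc]
    exact cls_glue p h _
  | base a b ha hb =>
    refine cls_base ?_ ?_
    · exact ha.imp (fun h => by rw [h, J.comp_infty]) fun h => h
    · exact hb.imp (fun h => by rw [h, J.comp_infty]) fun h => h

/-- Postcomposition on the coend. -/
def objMap (q : J V W) (x : D.Obj V) : D.Obj W :=
  multiLift (S := Unit) (fun _ => D.Rel V) (fun l x => preComp l (x ())) q fun _ => x

lemma objMap_cls (q : J V W) (i : D.I) (p : J (D.P i) V) (y : D.Y i) :
    objMap q (cls i p y) = cls (D := D) i (J.comp q p) y :=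
  multiLift_mk (r := fun _ : Unit => D.Rel V) preComp_kcont
    (fun l x s y h => by simpa using preComp_rel l _ _ h) q fun _ => ⟨i, p, y⟩

lemma objMap_kcont : KCont fun p : J V W × D.Obj V => objMap p.1 p.2 :=
  (multiLift_kcont (r := fun _ : Unit => D.Rel V) preComp_kcont
    (fun l x s y h => by simpa using preComp_rel l _ _ h)).comp
    (f := fun p : J V W × D.Obj V => (p.1, fun _ : Unit => p.2)) (Continuous.kcont (by fun_prop))

end

/-- The spectrum presented by `D`, that is, the coend `∫ⁱ J(P i, -) ∧ Y i`. -/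
def spectrum : Spectrum where
  obj := D.Obj
  pt V := cls D.i₀ OnePoint.infty D.y₀
  map f x := objMap (OnePoint.some f) x
  map_pt f := by rw [objMap_cls, J.comp_infty]
  map_id x := by
    obtain ⟨i, q, y, rfl⟩ := cls_surj x
    rw [objMap_cls]
    congr 1
    induction q using OnePoint.rec <;> simp
  map_comp g f x := by
    obtain ⟨i, q, y, rfl⟩ := cls_surj x
    rw [objMap_cls, objMap_cls, objMap_cls, ← J.comp_some, J.comp_assoc]
  kcont {V W} := by
    have : (fun p : J V W × D.Obj V => p.1.elim (cls (D := D) D.i₀ OnePoint.infty D.y₀)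
        fun f => objMap (OnePoint.some f) p.2) = fun p => objMap p.1 p.2 := by
      funext ⟨q, x⟩
      obtain ⟨i, q', y, rfl⟩ := cls_surj x
      induction q using OnePoint.rec with
      | infty =>
        change cls _ _ _ = _
        rw [objMap_cls]
        exact cls_base (.inl rfl) (.inl rfl)
      | coe f => rfl
    rw [this]
    exact objMap_kcont

variable {D}

lemma map_cls {V W : IPS} (f : JHom V W) (i : D.I) (q : J (D.P i) V) (y : D.Y i) :
    D.spectrum.map f (cls i q y) = cls (D := D) i (J.comp (OnePoint.some f) q) y :=
  objMap_cls _ _ _ _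

lemma mapJ_cls {V W : IPS} (f : J V W) (i : D.I) (q : J (D.P i) V) (y : D.Y i) :
    D.spectrum.mapJ f (cls i q y) = cls (D := D) i (J.comp f q) y := by
  induction f using OnePoint.rec with
  | infty => exact cls_base (.inl rfl) (.inl rfl)
  | coe f => exact map_cls _ _ _ _

lemma cls_eq_pt {V : IPS} {i : D.I} {q : J (D.P i) V} {y : D.Y i}
    (h : q = OnePoint.infty ∨ y ∈ D.base i) : cls (D := D) i q y = D.spectrum.pt V :=
  cls_base h (.inl rfl)

/-- The generator `y`, as a point of the coend. -/
def gen {i : D.I} (y : D.Y i) : D.spectrum.obj (D.P i) := cls i (OnePoint.some (JHom.id _)) y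

lemma cls_eq_mapJ_gen {V : IPS} (i : D.I) (q : J (D.P i) V) (y : D.Y i) :
    cls (D := D) i q y = D.spectrum.mapJ q (gen y) := by
  rw [gen, mapJ_cls]
  congr 1
  induction q using OnePoint.rec <;> simp

lemma cls_some {V : IPS} (i : D.I) (q : JHom (D.P i) V) (y : D.Y i) :
    cls (D := D) i (OnePoint.some q) y = D.spectrum.map q (gen y) :=
  cls_eq_mapJ_gen i (OnePoint.some q) y

lemma gen_rel {i j : D.I} (p : JHom (D.P i) (D.P j)) {y : D.Y i} {y' : D.Y j} (h : D.R p y y') :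
    D.spectrum.map p (gen y) = gen y' := by
  rw [← cls_some]
  exact cls_glue' p h (by simp)

lemma gen_base {i : D.I} {y : D.Y i} (h : y ∈ D.base i) :
    gen (D := D) y = D.spectrum.pt _ := cls_eq_pt (.inr h)

lemma gen_kcont (i : D.I) : KCont fun y : D.Y i => gen (D := D) y :=
  (cls_kcont i).comp (f := fun y : D.Y i => (OnePoint.some (JHom.id _), y))
    (Continuous.kcont (by fun_prop))

lemma spectrum_ind {V : IPS} {motive : D.spectrum.obj V → Prop}
    (pt : motive (D.spectrum.pt V))
    (gen : ∀ (i : D.I) (q : JHom (D.P i) V) (y : D.Y i), motive (D.spectrum.map q (gen y)))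
    (x : D.spectrum.obj V) : motive x := by
  obtain ⟨i, q, y, rfl⟩ := cls_surj x
  induction q using OnePoint.rec with
  | infty => rw [cls_eq_pt (.inl rfl)]; exact pt
  | coe q => rw [cls_some]; exact gen i q y

namespace Family
variable {Λ : Type*} [TopologicalSpace Λ] {Z : Spectrum} (F : Family Λ D Z)

lemma lift_mapJ (l : Λ) {V W : IPS} (q : J V W) (x : D.spectrum.obj V) :
    F.lift W l (D.spectrum.mapJ q x) = Z.mapJ q (F.lift V l x) := by
  obtain ⟨i, q', y, rfl⟩ := cls_surj x
  rw [mapJ_cls, lift_mk, lift_mk, Z.mapJ_comp]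

/-- The map of spectra determined by a compatible family. -/
def hom (l : Λ) : Spectrum.Hom D.spectrum Z where
  app V x := F.lift V l x
  continuous_app V := ((F.lift_kcont V).comp (f := fun x : D.Obj V => (l, x))
    (Continuous.kcont (by fun_prop))).continuous
  app_pt V := (F.lift_mk V l _ _ _).trans (Z.mapJ_infty _)
  naturality f x := F.lift_mapJ l (OnePoint.some f) x

lemma hom_gen (l : Λ) {i : D.I} (y : D.Y i) : (F.hom l).app _ (gen y) = F.fn l i y :=
  (F.lift_mk _ l i _ y).trans (Z.map_id _)

lemma hom_kcont (V : IPS) : KCont fun p : Λ × D.spectrum.obj V => (F.hom p.1).app V p.2 :=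
  F.lift_kcont V

end Family

/-- Maps out of a presented spectrum agree if they agree on generators. -/
lemma hom_ext {Z : Spectrum} {f g : Spectrum.Hom D.spectrum Z}
    (h : ∀ (i : D.I) (y : D.Y i), f.app _ (gen y) = g.app _ (gen y)) : f = g := by
  ext V x
  induction x using spectrum_ind with
  | pt => rw [f.app_pt, g.app_pt]
  | gen i q y => rw [f.naturality, g.naturality, h]

namespace MultiFamily
variable {Λ : Type*} [TopologicalSpace Λ] {S : Type} [Finite S] {D : S → Presentation}
  {Z : Spectrum} (F : MultiFamily Λ D Z)

lemma lift_map (l : Λ) {V W : S → IPS} (f : ∀ s, JHom (V s) (W s))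
    (x : ∀ s, (D s).spectrum.obj (V s)) :
    F.lift W l (fun s => (D s).spectrum.map (f s) (x s)) = Z.map (JHom.sum f) (F.lift V l x) := by
  choose i q y hx using fun s => cls_surj (x s)
  obtain rfl : x = fun s => cls (i s) (q s) (y s) := funext hx
  simp only [map_cls]
  rw [lift_mk, lift_mk, ← Z.mapJ_some, ← Z.mapJ_comp, ← J.sum_some, J.sum_comp]

lemma lift_gen (l : Λ) {i : ∀ s, (D s).I} (y : ∀ s, (D s).Y (i s)) :
    F.lift _ l (fun s => gen (y s)) = F.fn l i y := by
  refine (F.lift_mk _ l i _ y).trans ?_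
  rw [J.sum_some, JHom.sum_id]
  exact Z.map_id _

lemma lift_pt (l : Λ) {V : S → IPS} (x : ∀ s, (D s).spectrum.obj (V s))
    (h : ∃ s, x s = (D s).spectrum.pt (V s)) : F.lift V l x = Z.pt _ := by
  obtain ⟨s, hs⟩ := h
  choose i q y hx using fun s => cls_surj (x s)
  classical
  have h0 : ∀ t, ∃ i, ∃ q : J ((D t).P i) (V t), ∃ y : (D t).Y i, x t = cls (D := D t) i q y ∧
      (t = s → q = OnePoint.infty) := fun t => by
    rcases eq_or_ne t s with rfl | hne
    · exact ⟨_, OnePoint.infty, _, hs, fun _ => rfl⟩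
    · exact ⟨i t, q t, y t, hx t, fun h => absurd h hne⟩
  choose i q y hx hq using h0
  obtain rfl : x = fun s => cls (i s) (q s) (y s) := funext hx
  rw [lift_mk, J.sum_infty (hq s rfl), Z.mapJ_infty]

end MultiFamily

/-- A finite family of points of presented spectra: one of them is a base point, or all of them
come from generators. -/
lemma multi_cases {S : Type} [Finite S] {D : S → Presentation} {V : S → IPS}
    (x : ∀ s, (D s).spectrum.obj (V s)) :
    (∃ s, x s = (D s).spectrum.pt (V s)) ∨
    ∃ (i : ∀ s, (D s).I) (q : ∀ s, JHom ((D s).P (i s)) (V s)) (y : ∀ s, (D s).Y (i s)),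
      x = fun s => (D s).spectrum.map (q s) (gen (y s)) := by
  by_cases h : ∃ s, x s = (D s).spectrum.pt (V s)
  · exact .inl h
  · push Not at h
    have h0 : ∀ s, ∃ (i : (D s).I) (q : JHom ((D s).P i) (V s)) (y : (D s).Y i),
        x s = (D s).spectrum.map q (gen y) := fun s => by
      have := h s
      revert this
      induction x s using spectrum_ind with
      | pt => intro h; exact absurd rfl h
      | gen i q y => intro _; exact ⟨i, q, y, rfl⟩
    choose i q y hx using h0
    exact .inr ⟨i, q, y, funext hx⟩

end Presentation

/-! ### Operads -/

/-- An operad in compactly generated weak Hausdorff spaces, with arities indexed by finite sets and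
bijections; `obj (Fin n)` is the usual space of `n`-ary operations, on which a permutation `σ` acts
from the left by `map σ` (and from the right by `map σ⁻¹`). -/
structure Operad where
  obj : (S : Type) → [Finite S] → Type 1
  [top : ∀ (S : Type) [Finite S], TopologicalSpace (obj S)]
  [cg : ∀ (S : Type) [Finite S], UCompactlyGeneratedSpace.{1} (obj S)]
  [wh : ∀ (S : Type) [Finite S], WeakHausdorff (obj S)]
  map : ∀ {S T : Type} [Finite S] [Finite T], (S ≃ T) → obj S → obj T
  continuous_map : ∀ {S T : Type} [Finite S] [Finite T] (e : S ≃ T), Continuous (map e)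
  map_refl : ∀ {S : Type} [Finite S] (ξ : obj S), map (Equiv.refl S) ξ = ξ
  map_trans : ∀ {S T U : Type} [Finite S] [Finite T] [Finite U] (e : S ≃ T) (e' : T ≃ U)
    (ξ : obj S), map (e.trans e') ξ = map e' (map e ξ)
  one : obj Unit
  comp : ∀ {S : Type} [Finite S] {T : S → Type} [∀ s, Finite (T s)],
    obj S → (∀ s, obj (T s)) → obj (Σ s, T s)
  comp_kcont : ∀ {S : Type} [Finite S] {T : S → Type} [∀ s, Finite (T s)],
    KCont fun p : obj S × (∀ s, obj (T s)) => comp p.1 p.2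
  comp_map_left : ∀ {S S' : Type} [Finite S] [Finite S'] {T : S' → Type} [∀ s, Finite (T s)]
    (e : S ≃ S') (ξ : obj S) (η : ∀ s, obj (T s)),
    comp (map e ξ) η = map (Equiv.sigmaCongrLeft e) (comp ξ fun s => η (e s))
  comp_map_right : ∀ {S : Type} [Finite S] {T T' : S → Type} [∀ s, Finite (T s)]
    [∀ s, Finite (T' s)] (e : ∀ s, T s ≃ T' s) (ξ : obj S) (η : ∀ s, obj (T s)),
    comp ξ (fun s => map (e s) (η s)) = map (Equiv.sigmaCongrRight e) (comp ξ η)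
  comp_assoc : ∀ {S : Type} [Finite S] {T : S → Type} [∀ s, Finite (T s)]
    {U : ∀ s, T s → Type} [∀ s t, Finite (U s t)] (ξ : obj S) (η : ∀ s, obj (T s))
    (ζ : ∀ s t, obj (U s t)),
    map (Equiv.sigmaAssoc U) (comp (comp ξ η) fun p => ζ p.1 p.2) =
      comp ξ fun s => comp (η s) (ζ s)
  one_comp : ∀ {S : Type} [Finite S] (ξ : obj S),
    map (Equiv.uniqueSigma fun _ : Unit => S) (comp one fun _ => ξ) = ξ
  comp_one : ∀ {S : Type} [Finite S] (ξ : obj S),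
    map (Equiv.sigmaPUnit S) (comp ξ fun _ => one) = ξ

attribute [instance] Operad.top Operad.cg Operad.wh

/-- An operad in `G`-spaces. -/
structure GOperad (G : Type) [Group G] [TopologicalSpace G] extends Operad where
  act : ∀ {S : Type} [Finite S], G → obj S → obj S
  act_one : ∀ {S : Type} [Finite S] (ξ : obj S), act 1 ξ = ξ
  act_mul : ∀ {S : Type} [Finite S] (g h : G) (ξ : obj S), act (g * h) ξ = act g (act h ξ)
  act_kcont : ∀ {S : Type} [Finite S], KCont fun p : G × obj S => act p.1 p.2
  act_map : ∀ {S T : Type} [Finite S] [Finite T] (g : G) (e : S ≃ T) (ξ : obj S),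
    act g (map e ξ) = map e (act g ξ)
  act_unit : ∀ g : G, act g one = one
  act_comp : ∀ {S : Type} [Finite S] {T : S → Type} [∀ s, Finite (T s)] (g : G) (ξ : obj S)
    (η : ∀ s, obj (T s)), act g (comp ξ η) = comp (act g ξ) fun s => act g (η s)

section
variable {G : Type} [Group G] [TopologicalSpace G]

lemma GOperad.continuous_act (N : GOperad G) {S : Type} [Finite S] (g : G) :
    Continuous (N.act g : N.obj S → N.obj S) :=
  (N.act_kcont.comp (f := fun x : N.obj S => (g, x)) (Continuous.kcont (by fun_prop))).continuous

lemma GOperad.isClosed_fixed (N : GOperad G) (S : Type) [Finite S] :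
    IsClosed {ξ : N.obj S | ∀ g, N.act g ξ = ξ} := by
  rw [Set.ofPred_forall]
  exact isClosed_iInter fun g => isClosed_eq_of_kcont (N.continuous_act g) continuous_id

/-- The operad of `G`-fixed points. -/
def GOperad.fixed (N : GOperad G) : Operad where
  obj S _ := {ξ : N.obj S // ∀ g, N.act g ξ = ξ}
  cg S _ := cg_subtype_of_isClosed (N.isClosed_fixed S)
  wh S _ := WeakHausdorff.of_injective continuous_subtype_val Subtype.val_injective
  map e ξ := ⟨N.map e ξ.1, fun g => by rw [N.act_map, ξ.2]⟩
  continuous_map e := ((N.continuous_map e).comp continuous_subtype_val).subtype_mk _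
  map_refl ξ := Subtype.ext (N.map_refl _)
  map_trans e e' ξ := Subtype.ext (N.map_trans _ _ _)
  one := ⟨N.one, N.act_unit⟩
  comp ξ η := ⟨N.comp ξ.1 fun s => (η s).1, fun g => by
    rw [N.act_comp, ξ.2]; congr; funext s; rw [(η s).2]⟩
  comp_kcont {S _ T _} := fun C u => by
    refine Continuous.subtype_mk ?_ _
    exact N.comp_kcont.test (u := fun c => ((u c).1.1, fun s => ((u c).2 s).1))
      (by fun_prop)
  comp_map_left e ξ η := Subtype.ext (N.comp_map_left _ _ _)
  comp_map_right e ξ η := Subtype.ext (N.comp_map_right _ _ _)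
  comp_assoc ξ η ζ := Subtype.ext (N.comp_assoc ξ.1 (fun s => (η s).1) fun s t => (ζ s t).1)
  one_comp ξ := Subtype.ext (N.one_comp _)
  comp_one ξ := Subtype.ext (N.comp_one _)

/-- Maps of operads in `G`-spaces. -/
structure GOperadHom (N N' : GOperad G) where
  app : ∀ {S : Type} [Finite S], N.obj S → N'.obj S
  continuous_app : ∀ {S : Type} [Finite S], Continuous (app : N.obj S → N'.obj S)
  app_map : ∀ {S T : Type} [Finite S] [Finite T] (e : S ≃ T) (ξ : N.obj S),
    app (N.map e ξ) = N'.map e (app ξ)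
  app_one : app N.one = N'.one
  app_comp : ∀ {S : Type} [Finite S] {T : S → Type} [∀ s, Finite (T s)] (ξ : N.obj S)
    (η : ∀ s, N.obj (T s)), app (N.comp ξ η) = N'.comp (app ξ) fun s => app (η s)
  app_act : ∀ {S : Type} [Finite S] (g : G) (ξ : N.obj S), app (N.act g ξ) = N'.act g (app ξ)

/-- The distributivity bijection. -/
def sigmaProdEquiv {S T : Type} (X : S → Type) (Y : T → Type) :
    (Σ p : S × T, X p.1 × Y p.2) ≃ (Σ s, X s) × (Σ t, Y t) where
  toFun p := (⟨p.1.1, p.2.1⟩, ⟨p.1.2, p.2.2⟩)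
  invFun q := ⟨(q.1.1, q.2.1), (q.1.2, q.2.2)⟩
  left_inv _ := rfl
  right_inv _ := rfl

/-- A self-interchange map: a pairing of the `G`-operad `N` with itself to itself, consisting of
`G`-maps `N(m) × N(n) → N(mn)`. -/
structure SelfInterchange (N : GOperad G) where
  op : ∀ {S T : Type} [Finite S] [Finite T], N.obj S → N.obj T → N.obj (S × T)
  op_kcont : ∀ {S T : Type} [Finite S] [Finite T],
    KCont fun p : N.obj S × N.obj T => op p.1 p.2
  op_act : ∀ {S T : Type} [Finite S] [Finite T] (g : G) (ξ : N.obj S) (η : N.obj T),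
    op (N.act g ξ) (N.act g η) = N.act g (op ξ η)
  op_map : ∀ {S S' T T' : Type} [Finite S] [Finite S'] [Finite T] [Finite T'] (e : S ≃ S')
    (e' : T ≃ T') (ξ : N.obj S) (η : N.obj T),
    op (N.map e ξ) (N.map e' η) = N.map (Equiv.prodCongr e e') (op ξ η)
  op_one : op N.one N.one = N.map (Equiv.prodPUnit Unit).symm N.one
  op_comp : ∀ {S T : Type} [Finite S] [Finite T] {X : S → Type} {Y : T → Type}
    [∀ s, Finite (X s)] [∀ t, Finite (Y t)] (ξ : N.obj S) (η : N.obj T)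
    (ξ' : ∀ s, N.obj (X s)) (η' : ∀ t, N.obj (Y t)),
    op (N.comp ξ ξ') (N.comp η η') =
      N.map (sigmaProdEquiv X Y) (N.comp (op ξ η) fun p : S × T => op (ξ' p.1) (η' p.2))

namespace SelfInterchange
variable {N : GOperad G} (I : SelfInterchange N)

/-- The operation of `N` through which `ξ` acts: `ξ ⊠ 1`. -/
def left {S : Type} [Finite S] (ξ : N.obj S) : N.obj S :=
  N.map (Equiv.prodPUnit S) (I.op ξ N.one)

/-- The operation `1 ⊠ η`. -/
def right {S : Type} [Finite S] (η : N.obj S) : N.obj S :=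
  N.map (Equiv.punitProd S) (I.op N.one η)

lemma left_act {S : Type} [Finite S] (g : G) (ξ : N.obj S) :
    I.left (N.act g ξ) = N.act g (I.left ξ) := by
  rw [left, left, N.act_map, ← I.op_act, N.act_unit]

lemma left_map {S T : Type} [Finite S] [Finite T] (e : S ≃ T) (ξ : N.obj S) :
    I.left (N.map e ξ) = N.map e (I.left ξ) := by
  have h := I.op_map e (Equiv.refl Unit) ξ N.one
  rw [N.map_refl] at h
  rw [left, left, h, ← N.map_trans, ← N.map_trans]
  rfl

lemma continuous_left {S : Type} [Finite S] : Continuous (I.left : N.obj S → N.obj S) :=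
  (N.continuous_map _).comp (I.op_kcont.comp (f := fun ξ : N.obj S => (ξ, N.one))
    (Continuous.kcont (by fun_prop))).continuous

/-- The map of operads `η ↦ 1 ⊠ η`. -/
def rightHom : GOperadHom N N where
  app η := I.right η
  continuous_app := (N.continuous_map _).comp (I.op_kcont.comp (f := fun ξ => (N.one, ξ))
    (Continuous.kcont (by fun_prop))).continuous
  app_map e ξ := by
    have h := I.op_map (Equiv.refl Unit) e N.one ξ
    rw [N.map_refl] at h
    rw [right, right, h, ← N.map_trans, ← N.map_trans]
    rfl
  app_one := by
    rw [right, I.op_one, ← N.map_trans]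
    exact N.map_refl _
  app_comp {S _ T _} ξ η := by
    have h1 : N.one = N.map (Equiv.uniqueSigma fun _ : Unit => Unit)
        (N.comp N.one fun _ => N.one) := (N.one_comp N.one).symm
    have h2 := I.op_map (Equiv.uniqueSigma fun _ : Unit => Unit) (Equiv.refl _)
      (N.comp N.one fun _ => N.one) (N.comp ξ η)
    rw [N.map_refl, ← h1] at h2
    have h3 : N.comp (I.right ξ) (fun s => I.right (η s)) =
        N.map (Equiv.sigmaCongrLeft (Equiv.punitProd S)) (N.map
          (Equiv.sigmaCongrRight fun p : Unit × S => Equiv.punitProd (T p.2))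
          (N.comp (I.op N.one ξ) fun p : Unit × S => I.op N.one (η p.2))) := by
      rw [right, N.comp_map_left]
      exact congrArg _ (N.comp_map_right (fun p : Unit × S => Equiv.punitProd (T p.2))
        (I.op N.one ξ) fun p => I.op N.one (η p.2))
    rw [right, h2, I.op_comp, h3, ← N.map_trans, ← N.map_trans, ← N.map_trans]
    congr 1
  app_act g ξ := by rw [right, right, N.act_map, ← I.op_act, N.act_unit]

end SelfInterchange

/-! ### Algebras -/

/-- An algebra over the operad `O` in orthogonal spectra.  A map `O(S)₊ ∧ X^{∧S} → X` is given by
the corresponding maps `O(S) × ∏ₛ X(V s) → X(⊕ₛ V s)`, multilinear over the indexing category. -/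
structure Algebra (O : Operad) (X : Spectrum) where
  op : ∀ {S : Type} [Finite S] {V : S → IPS}, O.obj S → (∀ s, X.obj (V s)) → X.obj (IPS.sum V)
  op_kcont : ∀ {S : Type} [Finite S] {V : S → IPS},
    KCont fun p : O.obj S × (∀ s, X.obj (V s)) => op p.1 p.2
  op_pt : ∀ {S : Type} [Finite S] {V : S → IPS} (ξ : O.obj S) (a : ∀ s, X.obj (V s)),
    (∃ s, a s = X.pt (V s)) → op ξ a = X.pt _
  op_nat : ∀ {S : Type} [Finite S] {V W : S → IPS} (f : ∀ s, JHom (V s) (W s)) (ξ : O.obj S)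
    (a : ∀ s, X.obj (V s)), op ξ (fun s => X.map (f s) (a s)) = X.map (JHom.sum f) (op ξ a)
  op_map : ∀ {S T : Type} [Finite S] [Finite T] {V : T → IPS} (e : S ≃ T) (ξ : O.obj S)
    (a : ∀ t, X.obj (V t)),
    X.map (JHom.ofIso (IPS.pull e V)) (op (O.map e ξ) a) = op ξ fun s => a (e s)
  op_one : ∀ {V : IPS} (a : X.obj V),
    op O.one (fun _ => a) = X.map (JHom.ofIso (IPS.single V)) a
  op_comp : ∀ {S : Type} [Finite S] {T : S → Type} [∀ s, Finite (T s)] {V : (Σ s, T s) → IPS}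
    (ξ : O.obj S) (η : ∀ s, O.obj (T s)) (a : ∀ p, X.obj (V p)),
    X.map (JHom.ofIso (IPS.curry V)) (op (O.comp ξ η) a) =
      op ξ fun s => op (η s) fun t => a ⟨s, t⟩

/-- An algebra over the `G`-operad `N` in orthogonal `G`-spectra. -/
structure GAlgebra (N : GOperad G) (X : GSpectrum G) extends Algebra N.toOperad X.toSpectrum where
  op_act : ∀ {S : Type} [Finite S] {V : S → IPS} (g : G) (ξ : N.obj S) (a : ∀ s, X.obj (V s)),
    X.act g (op ξ a) = op (N.act g ξ) fun s => X.act g (a s)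

/-- Compatibility of a map of spectra with algebra structures. -/
def IsAlgHom {O : Operad} {X Y : Spectrum} (A : Algebra O X) (B : Algebra O Y)
    (f : Spectrum.Hom X Y) : Prop :=
  ∀ {S : Type} [Finite S] {V : S → IPS} (ξ : O.obj S) (a : ∀ s, X.obj (V s)),
    f.app _ (A.op ξ a) = B.op ξ fun s => f.app _ (a s)

/-- The space of maps of algebras in orthogonal spectra. -/
abbrev AlgHom {O : Operad} {X Y : Spectrum} (A : Algebra O X) (B : Algebra O Y) :=
  {f : Spectrum.Hom X Y // IsAlgHom A B f}

/-- The space of maps of algebras in orthogonal `G`-spectra. -/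
abbrev GAlgHom {N : GOperad G} {X Y : GSpectrum G} (A : GAlgebra N X) (B : GAlgebra N Y) :=
  {f : Spectrum.Hom X.toSpectrum Y.toSpectrum //
    f.IsEquivariant ∧ IsAlgHom A.toAlgebra B.toAlgebra f}

/-- Restriction of an algebra structure along a map of operads. -/
def GAlgebra.pullback {N N' : GOperad G} (j : GOperadHom N N') {X : GSpectrum G}
    (A : GAlgebra N' X) : GAlgebra N X where
  op ξ a := A.op (j.app ξ) a
  op_kcont {S _ V} := A.op_kcont.comp (f := fun p : N.obj S × (∀ s, X.obj (V s)) =>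
    (j.app p.1, p.2)) (Continuous.kcont
      ((j.continuous_app.comp continuous_fst).prodMk continuous_snd))
  op_pt ξ a h := A.op_pt _ a h
  op_nat f ξ a := A.op_nat f _ a
  op_map e ξ a := by rw [j.app_map, A.op_map]
  op_one a := by rw [j.app_one, A.op_one]
  op_comp ξ η a := by rw [j.app_comp, A.op_comp]
  op_act g ξ a := by rw [j.app_act, A.op_act]

/-- Rescaling of sphere coordinates preserves algebra structures. -/
def Algebra.rescale (c : ℝ) (hc : 0 < c) {O : Operad} {X : Spectrum} (A : Algebra O X) :
    Algebra O (X.rescale c hc) where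
  op ξ a := A.op ξ a
  op_kcont := A.op_kcont
  op_pt := A.op_pt
  op_nat f ξ a := by
    change A.op ξ (fun s => X.map ((f s).scale c) (a s)) = X.map ((JHom.sum f).scale c) (A.op ξ a)
    rw [JHom.scale_sum]
    exact A.op_nat _ ξ a
  op_map {S T _ _ V} e ξ a := by
    have h : (JHom.ofIso (IPS.pull e V)).scale c = JHom.ofIso (IPS.pull e V) :=
      JHom.ext' (fun _ => rfl) (by simp)
    change X.map ((JHom.ofIso (IPS.pull e V)).scale c) (A.op (O.map e ξ) a) = _
    rw [h]
    exact A.op_map e ξ a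
  op_one {V} a := by
    have h : (JHom.ofIso (IPS.single V)).scale c = JHom.ofIso (IPS.single V) :=
      JHom.ext' (fun _ => rfl) (by simp)
    change _ = X.map ((JHom.ofIso (IPS.single V)).scale c) a
    rw [h]
    exact A.op_one a
  op_comp {S _ T _ V} ξ η a := by
    have h : (JHom.ofIso (IPS.curry V)).scale c = JHom.ofIso (IPS.curry V) :=
      JHom.ext' (fun _ => rfl) (by simp)
    change X.map ((JHom.ofIso (IPS.curry V)).scale c) (A.op (O.comp ξ η) a) = _
    rw [h]
    exact A.op_comp ξ η a

end

/-! ### Smash powers and norms -/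

lemma IPS.sum_ext_equiv {S T : Type} [Finite S] [Finite T] (e : S ≃ T) {V : T → IPS}
    {x y : IPS.sum V} (h : ∀ s, IPS.comp x (e s) = IPS.comp y (e s)) : x = y := by
  ext t
  obtain ⟨s, rfl⟩ := e.surjective t
  exact h s

@[simp] lemma IPS.tup_zero {S : Type} [Finite S] (V : S → IPS) :
    IPS.tup (fun s => (0 : V s)) = 0 := rfl

/-- The smash power `X^{∧T}` indexed by a finite set `T`, as the `T`-fold Day convolution
`∫^{W : T → IPS} J(⊕ₜ W t, -) ∧ ⋀ₜ X(W t)`. -/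
abbrev smashPower (X : Spectrum) (T : Type) [Finite T] : Presentation where
  I := T → IPS
  P W := IPS.sum W
  Y W := ∀ t, X.obj (W t)
  base W := {a | ∃ t, a t = X.pt (W t)}
  i₀ := fun _ => IPS.zero
  y₀ := fun _ => X.pt _
  R {W W'} p a a' := ∃ h : ∀ t, JHom (W t) (W' t), p = JHom.sum h ∧ ∀ t, a' t = X.map (h t) (a t)
  R_id {W} _ := ⟨fun _ => JHom.id _, (JHom.sum_id W).symm, fun _ => (X.map_id _).symm⟩

namespace smashPower
open Presentation

section
variable {X : Spectrum} {T : Type} [Finite T]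

/-- The point `⋀ₜ a t` of the smash power. -/
def wedge {W : T → IPS} (a : ∀ t, X.obj (W t)) : (smashPower X T).spectrum.obj (IPS.sum W) :=
  gen (D := smashPower X T) (i := W) a

lemma wedge_map {W W' : T → IPS} (h : ∀ t, JHom (W t) (W' t)) (a : ∀ t, X.obj (W t)) :
    wedge (fun t => X.map (h t) (a t)) = (smashPower X T).spectrum.map (JHom.sum h) (wedge a) :=
  (gen_rel (D := smashPower X T) (i := W) (j := W') (JHom.sum h) ⟨h, rfl, fun _ => rfl⟩).symm

lemma wedge_pt {W : T → IPS} {a : ∀ t, X.obj (W t)} (h : ∃ t, a t = X.pt (W t)) :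
    wedge a = (smashPower X T).spectrum.pt _ :=
  gen_base (D := smashPower X T) (i := W) h

lemma wedge_kcont (W : T → IPS) : KCont fun a : (∀ t, X.obj (W t)) => wedge a :=
  gen_kcont (D := smashPower X T) W

end

section
variable {G : Type} [Group G] [TopologicalSpace G] (A : GSpectrum G) {T : Type} [Finite T]

/-- The family defining `permHom`. -/
def permFamily (e : Equiv.Perm T) :
    Family G (smashPower A.toSpectrum T) (smashPower A.toSpectrum T).spectrum where
  fn g (W : T → IPS) (a : ∀ t, A.obj (W t)) := (smashPower A.toSpectrum T).spectrum.map (JHom.ofIso (IPS.push e W))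
    (wedge fun t => A.act g (a (e t)))
  kcont (W : T → IPS) := by
    refine (Continuous.kcont (Spectrum.continuous_map _ _)).comp ((wedge_kcont _).comp ?_)
    refine KCont.pi fun t => ?_
    exact A.act_kcont.comp (f := fun p : G × (∀ t, A.obj (W t)) => (p.1, p.2 (e t)))
      (Continuous.kcont (by fun_prop))
  base g (W : T → IPS) (a : ∀ t, A.obj (W t)) h := by
    obtain ⟨t, ht⟩ := h
    rw [wedge_pt, Spectrum.map_pt]
    refine ⟨e.symm t, ?_⟩
    have : ∀ t', t' = t → A.act g (a t') = A.pt (W t') := by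
      rintro _ rfl
      rw [ht, A.act_pt]
    exact this _ (e.apply_symm_apply t)
  rel g (W W' : T → IPS) p (a : ∀ t, A.obj (W t)) (a' : ∀ t, A.obj (W' t)) h := by
    obtain ⟨h, rfl, h'⟩ := h
    have : (fun t => A.act g (a' (e t))) = fun t => A.map (h (e t)) (A.act g (a (e t))) := by
      funext t; rw [h', A.act_map]
    rw [this, wedge_map, ← Spectrum.map_comp, ← Spectrum.map_comp]
    congr 1
    apply JHom.ext'
    · intro v
      refine IPS.sum_ext_equiv e fun t => ?_
      change (h (e t)).iso (IPS.comp (IPS.push e W v) (e t)) =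
        IPS.comp (IPS.push e W' (IPS.sumLI (fun t => (h (e t)).iso) v)) (e t)
      rw [IPS.push_comp, IPS.push_comp]
      rfl
    · refine IPS.sum_ext_equiv e fun t => ?_
      change IPS.comp ((JHom.sum h).vec + IPS.sumLI _ 0) (e t) =
        IPS.comp (0 + IPS.push e W' (IPS.tup fun t => (h (e t)).vec)) (e t)
      rw [IPS.comp_add, IPS.comp_add, IPS.push_comp]
      simp

/-- The self-map of the smash power applying `g` to every factor and permuting the factors; the
factor indexed by `t` of the image comes from the factor indexed by `e t`. -/
def permHom (g : G) (e : Equiv.Perm T) :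
    Spectrum.Hom (smashPower A.toSpectrum T).spectrum (smashPower A.toSpectrum T).spectrum :=
  (permFamily A e).hom g

lemma permHom_wedge (g : G) (e : Equiv.Perm T) {W : T → IPS} (a : ∀ t, A.obj (W t)) :
    (permHom A g e).app _ (wedge a) = (smashPower A.toSpectrum T).spectrum.map
      (JHom.ofIso (IPS.push e W)) (wedge fun t => A.act g (a (e t))) :=
  (permFamily A e).hom_gen g a

lemma permHom_comp (g h : G) (e e' : Equiv.Perm T) :
    (permHom A g e).comp (permHom A h e') = permHom A (g * h) (e.trans e') := by
  refine hom_ext fun (W : T → IPS) (a : ∀ t, A.obj (W t)) => ?_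
  change (permHom A g e).app _ ((permHom A h e').app _ (wedge a)) =
    (permHom A (g * h) (e.trans e')).app _ (wedge a)
  rw [permHom_wedge, Spectrum.Hom.naturality, permHom_wedge, permHom_wedge, ← Spectrum.map_comp]
  have : (fun t => A.act (g * h) (a ((e.trans e') t))) =
    fun t => A.act g (A.act h (a (e' (e t)))) := funext fun t => A.act_mul _ _ _
  rw [this]
  refine congrArg (fun f => (smashPower A.toSpectrum T).spectrum.map f
    (wedge fun t => A.act g (A.act h (a (e' (e t)))))) ?_
  apply JHom.ext'
  · intro v
    refine IPS.sum_ext_equiv (e.trans e') fun t => ?_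
    change IPS.comp (IPS.push e' W (IPS.push e (fun t => W (e' t)) v)) (e' (e t)) = 
      IPS.comp (IPS.push (e.trans e') W v) ((e.trans e') t)
    rw [IPS.push_comp, IPS.push_comp]
    exact (IPS.push_comp (e.trans e') W v t).symm
  · change 0 + IPS.push e' W 0 = 0
    simp

lemma permHom_one : permHom A 1 (Equiv.refl T) = Spectrum.Hom.id _ := by
  refine hom_ext fun (W : T → IPS) (a : ∀ t, A.obj (W t)) => ?_
  change (permHom A 1 (Equiv.refl T)).app _ (wedge a) = wedge a
  rw [permHom_wedge]
  simp only [A.act_one]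
  refine Eq.trans (congrArg (fun f => (smashPower A.toSpectrum T).spectrum.map f (wedge a)) ?_)
    (Spectrum.map_id _ (wedge a))
  apply JHom.ext'
  · intro v
    refine IPS.sum_ext_equiv (Equiv.refl T) fun t => ?_
    exact IPS.push_comp (Equiv.refl T) W v t
  · rfl

variable [MulAction G T]

/-- The smash power of a `G`-spectrum indexed by a finite `G`-set `T`, with `G` acting diagonally
on the factors and on `T`. -/
def gSpectrum (hT : ∀ t t' : T, IsOpen {g : G | g • t = t'}) : GSpectrum G where
  toSpectrum := (smashPower A.toSpectrum T).spectrum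
  act {V} g x := (permHom A g (MulAction.toPerm g⁻¹)).app V x
  act_one x := by
    have : (MulAction.toPerm (1 : G)⁻¹ : Equiv.Perm T) = Equiv.refl T := by ext; simp
    rw [this, permHom_one]; rfl
  act_mul {V} g h x := by
    have : (MulAction.toPerm (g * h)⁻¹ : Equiv.Perm T) =
        (MulAction.toPerm g⁻¹).trans (MulAction.toPerm h⁻¹) := by ext; simp [mul_smul]
    rw [this, ← permHom_comp]; rfl
  act_pt g := Spectrum.Hom.app_pt _ _
  act_map g f x := Spectrum.Hom.naturality _ _ _
  act_kcont {V} := by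
    intro C u
    rw [continuous_iff_continuousAt]
    intro c₀
    let e : Equiv.Perm T := MulAction.toPerm (u c₀).1⁻¹
    have hev : ∀ᶠ c in 𝓝 c₀, (MulAction.toPerm (u c).1⁻¹ : Equiv.Perm T) = e := by
      have : ∀ t : T, ∀ᶠ c in 𝓝 c₀, (u c).1⁻¹ • t = (u c₀).1⁻¹ • t := by
        intro t
        have ho := (hT ((u c₀).1⁻¹ • t) t).preimage (continuous_fst.comp u.continuous)
        filter_upwards [ho.mem_nhds (by simp)] with c hc
        have hc : (u c).1 • (u c₀).1⁻¹ • t = t := hc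
        rw [inv_smul_eq_iff, hc]
      filter_upwards [Filter.eventually_all.2 this] with c hc
      exact Equiv.ext hc
    have h1 : Continuous fun c => (permHom A (u c).1 e).app V (u c).2 :=
      ((permFamily A e).hom_kcont V).test u.continuous
    refine h1.continuousAt.congr ?_
    filter_upwards [hev] with c hc
    simp only [Function.comp, hc]

lemma gSpectrum_act (hT : ∀ t t' : T, IsOpen {g : G | g • t = t'}) {V : IPS} (g : G)
    (x : (gSpectrum A hT).obj V) :
    (gSpectrum A hT).act g x = (permHom A g (MulAction.toPerm g⁻¹)).app V x := rfl

end

section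
variable {X : Spectrum} {O : Operad} (A : Algebra O X) (T : Type) [Finite T]

/-- The family defining the diagonal algebra structure on a smash power. -/
def algFamily (S : Type) [Finite S] :
    MultiFamily (O.obj S) (fun _ : S => smashPower X T) (smashPower X T).spectrum where
  fn η (W : S → T → IPS) (a : ∀ s t, X.obj (W s t)) := (smashPower X T).spectrum.map (JHom.ofIso (IPS.swap W))
    (wedge fun t => A.op η fun s => a s t)
  kcont (W : S → T → IPS) := by
    refine (Continuous.kcont (Spectrum.continuous_map _ _)).comp ((wedge_kcont _).comp ?_)
    refine KCont.pi fun t => ?_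
    exact A.op_kcont.comp (f := fun p : O.obj S × (∀ s t, X.obj (W s t)) =>
      (p.1, fun s => p.2 s t)) (Continuous.kcont (by fun_prop))
  base η (W : S → T → IPS) (a : ∀ s t, X.obj (W s t)) h := by
    obtain ⟨s, t, h⟩ := h
    rw [wedge_pt ⟨t, A.op_pt _ _ ⟨s, h⟩⟩, Spectrum.map_pt]
  rel η (W W' : S → T → IPS) p (a : ∀ s t, X.obj (W s t)) (a' : ∀ s t, X.obj (W' s t)) h := by
    choose h hp h' using h
    obtain rfl : p = fun s => JHom.sum (h s) := funext hp
    have : (fun t => A.op η fun s => a' s t) =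
        fun t => X.map (JHom.sum fun s => h s t) (A.op η fun s => a s t) := by
      funext t
      rw [← A.op_nat]
      congr 1
      funext s
      exact h' s t
    rw [this, wedge_map, ← Spectrum.map_comp, ← Spectrum.map_comp]
    refine congrArg (fun f => (smashPower X T).spectrum.map f
      (wedge fun t => A.op η fun s => a s t)) ?_
    apply JHom.ext'
    · intro v; rfl
    · apply IPS.sum_ext; intro s
      apply IPS.sum_ext; intro t
      simp

lemma algFamily_wedge {S : Type} [Finite S] (η : O.obj S) {W : S → T → IPS}
    (a : ∀ s t, X.obj (W s t)) :
    (algFamily A T S).lift _ η (fun s => wedge (a s)) = (smashPower X T).spectrum.map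
      (JHom.ofIso (IPS.swap W)) (wedge fun t => A.op η fun s => a s t) :=
  (algFamily A T S).lift_gen η a

variable {T}

/-- Every finite family of points of smash powers either contains a base point or consists of images
of wedges. -/
lemma cases {S : Type} [Finite S] {V : S → IPS}
    (x : ∀ s, (smashPower X T).spectrum.obj (V s)) :
    (∃ s, x s = (smashPower X T).spectrum.pt (V s)) ∨
    ∃ (W : S → T → IPS) (q : ∀ s, JHom (IPS.sum (W s)) (V s)) (a : ∀ s t, X.obj (W s t)),
      x = fun s => (smashPower X T).spectrum.map (q s) (wedge (a s)) :=
  multi_cases (D := fun _ => smashPower X T) x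

lemma ind {V : IPS} {motive : (smashPower X T).spectrum.obj V → Prop}
    (pt : motive ((smashPower X T).spectrum.pt V))
    (wedge : ∀ (W : T → IPS) (q : JHom (IPS.sum W) V) (a : ∀ t, X.obj (W t)),
      motive ((smashPower X T).spectrum.map q (wedge a)))
    (x : (smashPower X T).spectrum.obj V) : motive x :=
  spectrum_ind pt wedge x

lemma algFamily_map {S : Type} [Finite S] (η : O.obj S) {V V' : S → IPS}
    (q : ∀ s, JHom (V s) (V' s)) (x : ∀ s, (smashPower X T).spectrum.obj (V s)) :
    (algFamily A T S).lift V' η (fun s => (smashPower X T).spectrum.map (q s) (x s)) =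
      (smashPower X T).spectrum.map (JHom.sum q) ((algFamily A T S).lift V η x) :=
  (algFamily A T S).lift_map η q x

lemma algFamily_pt {S : Type} [Finite S] (η : O.obj S) {V : S → IPS}
    (x : ∀ s, (smashPower X T).spectrum.obj (V s))
    (h : ∃ s, x s = (smashPower X T).spectrum.pt (V s)) :
    (algFamily A T S).lift V η x = (smashPower X T).spectrum.pt _ :=
  (algFamily A T S).lift_pt η x h

/-- The diagonal algebra structure on a smash power. -/
def algebra : Algebra O (smashPower X T).spectrum where
  op {S _ V} η x := (algFamily A T S).lift V η x
  op_kcont {S _ V} := (algFamily A T S).lift_kcont V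
  op_pt η x h := algFamily_pt A η x h
  op_nat f η x := algFamily_map A η f x
  op_map {S S' _ _ V} e ξ x := by
    rcases cases x with ⟨s, hs⟩ | ⟨W, q, a, rfl⟩
    · rw [algFamily_pt A _ _ ⟨s, hs⟩, algFamily_pt A _ _ ⟨e.symm s, ?_⟩, Spectrum.map_pt]
      have : ∀ s', s' = s → x s' = (smashPower X T).spectrum.pt (V s') := by
        rintro _ rfl; exact hs
      exact this _ (e.apply_symm_apply s)
    · rw [algFamily_map, algFamily_wedge]
      refine Eq.trans ?_ (algFamily_map A ξ (fun s => q (e s)) fun s => wedge (a (e s))).symm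
      rw [algFamily_wedge A T ξ fun s => a (e s)]
      have : (fun t => A.op ξ fun s => a (e s) t) = fun t =>
          X.map (JHom.ofIso (IPS.pull e fun s => W s t)) (A.op (O.map e ξ) fun s => a s t) :=
        funext fun t => (A.op_map e ξ fun s => a s t).symm
      rw [this, wedge_map]
      simp only [← Spectrum.map_comp]
      refine congrArg (fun f => (smashPower X T).spectrum.map f
        (wedge fun t => A.op (O.map e ξ) fun s => a s t)) ?_
      apply JHom.ext'
      · intro v; rfl
      · apply IPS.sum_ext; intro s
        simp
  op_one {V} x := by
    induction x using ind with
    | pt => rw [algFamily_pt A _ _ ⟨(), rfl⟩, Spectrum.map_pt]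
    | wedge W q a =>
      refine Eq.trans (algFamily_map A O.one (fun _ : Unit => q) fun _ => wedge a) ?_
      rw [algFamily_wedge A T O.one fun _ => a]
      simp only [A.op_one]
      rw [wedge_map]
      simp only [← Spectrum.map_comp]
      refine congrArg (fun f => (smashPower X T).spectrum.map f (wedge a)) ?_
      apply JHom.ext'
      · intro v; rfl
      · apply IPS.sum_ext; intro s
        simp
  op_comp {S _ S' _ V} ξ η x := by
    rcases cases x with ⟨⟨s, s'⟩, hs⟩ | ⟨W, q, a, rfl⟩
    · rw [algFamily_pt A _ _ ⟨_, hs⟩, Spectrum.map_pt]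
      exact (algFamily_pt A _ _ ⟨s, algFamily_pt A _ _ ⟨s', hs⟩⟩).symm
    · rw [algFamily_map, algFamily_wedge]
      have h1 : ∀ s, (algFamily A T (S' s)).lift _ (η s) (fun s' =>
          (smashPower X T).spectrum.map (q ⟨s, s'⟩) (wedge (a ⟨s, s'⟩))) =
          (smashPower X T).spectrum.map ((JHom.sum fun s' => q ⟨s, s'⟩).comp
            (JHom.ofIso (IPS.swap fun s' => W ⟨s, s'⟩)))
            (wedge fun t => A.op (η s) fun s' => a ⟨s, s'⟩ t) := fun s => by
        refine Eq.trans (algFamily_map A (η s) (fun s' => q ⟨s, s'⟩)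
          fun s' => wedge (a ⟨s, s'⟩)) ?_
        rw [algFamily_wedge A T (η s) fun s' => a ⟨s, s'⟩, ← Spectrum.map_comp]
      simp only [h1]
      refine Eq.trans ?_ (algFamily_map A ξ (fun s => ((JHom.sum fun s' => q ⟨s, s'⟩).comp
            (JHom.ofIso (IPS.swap fun s' => W ⟨s, s'⟩))))
            fun s => (wedge fun t => A.op (η s) fun s' => a ⟨s, s'⟩ t)).symm
      rw [algFamily_wedge A T ξ fun s t => A.op (η s) fun s' => a ⟨s, s'⟩ t]
      have : (fun t => A.op ξ fun s => A.op (η s) fun s' => a ⟨s, s'⟩ t) = fun t =>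
          X.map (JHom.ofIso (IPS.curry fun p => W p t)) (A.op (O.comp ξ η) fun p => a p t) :=
        funext fun t => (A.op_comp ξ η fun p => a p t).symm
      rw [this, wedge_map]
      simp only [← Spectrum.map_comp]
      refine congrArg (fun f => (smashPower X T).spectrum.map f
        (wedge fun t => A.op (O.comp ξ η) fun p => a p t)) ?_
      apply JHom.ext'
      · intro v; rfl
      · apply IPS.sum_ext; intro s
        apply IPS.sum_ext; intro s'
        simp

end

/-- The diagonal algebra structure on the smash power indexed by a finite `G`-set. -/
def gAlgebra {G : Type} [Group G] [TopologicalSpace G] {N : GOperad G} {X : GSpectrum G}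
    (A : GAlgebra N X) {T : Type} [Finite T] [MulAction G T]
    (hT : ∀ t t' : T, IsOpen {g : G | g • t = t'}) : GAlgebra N (gSpectrum X hT) where
  toAlgebra := algebra A.toAlgebra
  op_act {S _ V} g ξ x := by
    change (permHom X g (MulAction.toPerm g⁻¹)).app _ ((algFamily A.toAlgebra T S).lift V ξ x) =
      (algFamily A.toAlgebra T S).lift V (N.act g ξ)
        fun s => (permHom X g (MulAction.toPerm g⁻¹)).app _ (x s)
    generalize (MulAction.toPerm g⁻¹ : Equiv.Perm T) = e
    rcases cases x with ⟨s, hs⟩ | ⟨W, q, a, rfl⟩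
    · rw [algFamily_pt _ _ _ ⟨s, hs⟩, Spectrum.Hom.app_pt, algFamily_pt _ _ _ ⟨s, ?_⟩]
      rw [hs, Spectrum.Hom.app_pt]
    · rw [algFamily_map, algFamily_wedge, Spectrum.Hom.naturality, Spectrum.Hom.naturality,
        permHom_wedge]
      have h1 : ∀ s, (permHom X g e).app _ ((smashPower X.toSpectrum T).spectrum.map (q s)
          (wedge (a s))) = (smashPower X.toSpectrum T).spectrum.map
            ((q s).comp (JHom.ofIso (IPS.push e (W s)))) (wedge fun t => X.act g (a s (e t))) :=
        fun s => by rw [Spectrum.Hom.naturality, permHom_wedge, ← Spectrum.map_comp]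
      simp only [h1]
      rw [algFamily_map, algFamily_wedge A.toAlgebra T (N.act g ξ) fun s t => X.act g (a s (e t))]
      have : (fun t => X.act g (A.op ξ fun s => a s (e t))) = fun t =>
          A.op (N.act g ξ) fun s => X.act g (a s (e t)) := funext fun t => A.op_act g ξ _
      rw [this]
      simp only [← Spectrum.map_comp]
      refine congrArg (fun f => (smashPower X.toSpectrum T).spectrum.map f
        (wedge fun t => A.op (N.act g ξ) fun s => X.act g (a s (e t)))) ?_
      apply JHom.ext'
      · intro v
        apply IPS.sum_ext; intro s
        change (q s).iso _ = (q s).iso _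
        congr 1
        refine IPS.sum_ext_equiv e fun t => ?_
        change IPS.comp (IPS.comp (IPS.push e (fun t => IPS.sum fun s => W s t) v) (e t)) s =
          IPS.comp (IPS.push e (W s) _) (e t)
        rw [IPS.push_comp, IPS.push_comp]
        rfl
      · apply IPS.sum_ext; intro s
        simp

end smashPower

section
variable {G : Type} [Group G] [TopologicalSpace G] [IsTopologicalGroup G] (K : Subgroup G)

lemma isOpen_smul_eq (hK : IsOpen (K : Set G)) (t t' : G ⧸ K) : IsOpen {g : G | g • t = t'} := by
  induction t using QuotientGroup.induction_on with
  | H a =>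
    induction t' using QuotientGroup.induction_on with
    | H b =>
      have : {g : G | g • (a : G ⧸ K) = (b : G ⧸ K)} = (fun g : G => b⁻¹ * (g * a)) ⁻¹' (K : Set G) := by
        ext g
        change ((g * a : G) : G ⧸ K) = (b : G ⧸ K) ↔ _
        rw [eq_comm, QuotientGroup.eq]
        rfl
      rw [this]
      exact hK.preimage (by fun_prop)

/-- The norm `N_K^G A` of (the restriction to `K` of) a `G`-spectrum `A`: the smash power indexed by
`G/K` with the diagonal action. -/
def norm [K.FiniteIndex] (hK : IsOpen (K : Set G)) (A : GSpectrum G) : GSpectrum G :=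
  smashPower.gSpectrum A (T := G ⧸ K) (isOpen_smul_eq K hK)

/-- The algebra structure on the norm of an algebra. -/
def normAlgebra [K.FiniteIndex] (hK : IsOpen (K : Set G)) {N : GOperad G} {X : GSpectrum G}
    (A : GAlgebra N X) : GAlgebra N (norm K hK X) :=
  smashPower.gAlgebra A (isOpen_smul_eq K hK)

end

/-! ### Representations -/

/-- A finite dimensional orthogonal representation. -/
structure Rep (H : Type) [Group H] [TopologicalSpace H] : Type 1 where
  V : IPS
  ρ : H →* (V ≃ₗᵢ[ℝ] V)
  cont : ∀ v, Continuous fun h => ρ h v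

namespace Rep
variable {H : Type} [Group H] [TopologicalSpace H]

lemma ρ_mul (V : Rep H) (h k : H) (v : V.V) : V.ρ (h * k) v = V.ρ h (V.ρ k v) := by
  rw [map_mul]; rfl

@[simp] lemma ρ_one (V : Rep H) (v : V.V) : V.ρ 1 v = v := by
  rw [map_one]; rfl

/-- The subspace of fixed vectors. -/
def fixedSubmodule (V : Rep H) : Submodule ℝ V.V where
  carrier := {v | ∀ h, V.ρ h v = v}
  add_mem' hv hw h := by rw [map_add, hv h, hw h]
  zero_mem' h := map_zero _
  smul_mem' c v hv h := by rw [map_smul, hv h]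

/-- The inner product space `V^H` of fixed vectors. -/
def fix (V : Rep H) : IPS := IPS.ofSubmodule V.fixedSubmodule

/-- The inclusion `V^H → V`. -/
def incl (V : Rep H) : V.fix →ₗᵢ[ℝ] V.V := V.fixedSubmodule.subtypeₗᵢ

/-- A fixed vector as an element of `V^H`. -/
def vec (V : Rep H) (v : V.V) (h : ∀ k, V.ρ k v = v) : V.fix := (⟨v, h⟩ : V.fixedSubmodule)

@[simp] lemma incl_vec (V : Rep H) (v : V.V) (h : ∀ k, V.ρ k v = v) : V.incl (V.vec v h) = v := rfl

lemma ρ_incl (V : Rep H) (v : V.fix) (k : H) : V.ρ k (V.incl v) = V.incl v :=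
  (show V.fixedSubmodule from v).2 k

lemma fix_ext (V : Rep H) {v w : V.fix} (h : V.incl v = V.incl w) : v = w := V.incl.injective h

/-- A linear isometry with fixed values. -/
def lift (V : Rep H) {U : IPS} (f : U →ₗᵢ[ℝ] V.V) (h : ∀ u k, V.ρ k (f u) = f u) :
    U →ₗᵢ[ℝ] V.fix :=
  ⟨⟨⟨fun u => V.vec (f u) (h u), fun u v => V.fix_ext (by simp)⟩, fun c u => V.fix_ext (by simp)⟩,
    fun u => by
      rw [← V.incl.norm_map]
      exact f.norm_map u⟩

@[simp] lemma incl_lift (V : Rep H) {U : IPS} (f : U →ₗᵢ[ℝ] V.V) (h : ∀ u k, V.ρ k (f u) = f u)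
    (u : U) : V.incl (V.lift f h u) = f u := rfl

/-- The trivial representation on the zero space. -/
def zero : Rep H := ⟨IPS.zero, 1, fun _ => continuous_const⟩

/-- The direct sum of linear isometric automorphisms. -/
def sumEquiv {S : Type} [Finite S] {V : S → IPS} (f : ∀ s, V s ≃ₗᵢ[ℝ] V s) :
    IPS.sum V ≃ₗᵢ[ℝ] IPS.sum V :=
  LinearIsometryEquiv.ofSurjective (IPS.sumLI fun s => (f s).toLinearIsometry) fun y =>
    ⟨IPS.tup fun s => (f s).symm (IPS.comp y s), by ext s; simp⟩

@[simp] lemma sumEquiv_comp {S : Type} [Finite S] {V : S → IPS} (f : ∀ s, V s ≃ₗᵢ[ℝ] V s)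
    (x : IPS.sum V) (s : S) : IPS.comp (sumEquiv f x) s = f s (IPS.comp x s) := rfl

/-- The direct sum of representations. -/
def sum {S : Type} [Finite S] (V : S → Rep H) : Rep H where
  V := IPS.sum fun s => (V s).V
  ρ := 
    { toFun := fun h => sumEquiv fun s => (V s).ρ h
      map_one' := by ext x s; simp
      map_mul' := fun h k => by
        ext x s
        change (V s).ρ (h * k) _ = (V s).ρ h ((V s).ρ k _)
        exact ρ_mul _ _ _ _ }
  cont v := IPS.continuous_sum_iff.2 fun s => (V s).cont _

@[simp] lemma sum_ρ_comp {S : Type} [Finite S] (V : S → Rep H) (h : H) (x : (sum V).V) (s : S) :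
    IPS.comp ((sum V).ρ h x) s = (V s).ρ h (IPS.comp x s) := rfl

/-- The inclusion of the fixed vectors of a direct sum. -/
def inclSum {S : Type} [Finite S] (V : S → Rep H) :
    (sum V).fix →ₗᵢ[ℝ] IPS.sum fun s => (V s).V := (sum V).incl

lemma ρ_inclSum {S : Type} [Finite S] (V : S → Rep H) (x : (sum V).fix) (s : S) (k : H) :
    (V s).ρ k (IPS.comp (inclSum V x) s) = IPS.comp (inclSum V x) s :=
  congrArg (fun y : IPS.sum fun s => (V s).V => IPS.comp y s) ((sum V).ρ_incl x k)

/-- The identification of the fixed vectors of a direct sum. -/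
def fixSum {S : Type} [Finite S] (V : S → Rep H) :
    (sum V).fix →ₗᵢ[ℝ] IPS.sum fun s => (V s).fix :=
  IPS.isoOfSq ⟨⟨fun x => IPS.tup fun s => (V s).vec (IPS.comp (inclSum V x) s) (ρ_inclSum V x s),
      fun x y => by ext s; exact (V s).fix_ext (by simp)⟩,
      fun c x => by ext s; exact (V s).fix_ext (by simp)⟩ fun x => by
    cases nonempty_fintype S
    rw [← (inclSum V).norm_map x, IPS.norm_sq_eq, IPS.norm_sq_eq]
    rfl

@[simp] lemma incl_fixSum {S : Type} [Finite S] (V : S → Rep H) (x : (sum V).fix) (s : S) :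
    (V s).incl (IPS.comp (fixSum V x) s) = IPS.comp (inclSum V x) s := rfl

/-- A morphism of the indexing category fixed by the group. -/
structure Hom (V W : Rep H) extends JHom V.V W.V where
  iso_ρ : ∀ h v, iso (V.ρ h v) = W.ρ h (iso v)
  ρ_vec : ∀ h, W.ρ h vec = vec

/-- The morphism between fixed vectors induced by a fixed morphism. -/
def Hom.fix {V W : Rep H} (f : Hom V W) : JHom V.fix W.fix where
  iso := W.lift (f.iso.comp V.incl) fun u k => by
    change W.ρ k (f.iso (V.incl u)) = f.iso (V.incl u)
    rw [← f.iso_ρ, ρ_incl]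
  vec := W.vec f.vec f.ρ_vec
  orth v := by
    rw [← W.incl.inner_map_map]
    exact f.orth _

@[simp] lemma Hom.fix_iso {V W : Rep H} (f : Hom V W) (v : V.fix) :
    W.incl (f.fix.iso v) = f.iso (V.incl v) := rfl
@[simp] lemma Hom.fix_vec {V W : Rep H} (f : Hom V W) : W.incl f.fix.vec = f.vec := rfl

/-- The identity. -/
def Hom.id (V : Rep H) : Hom V V := ⟨JHom.id V.V, fun _ _ => rfl, fun _ => map_zero _⟩

/-- An equivariant linear isometry. -/
def Hom.ofIso {V W : Rep H} (f : V.V →ₗᵢ[ℝ] W.V) (h : ∀ k v, f (V.ρ k v) = W.ρ k (f v)) :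
    Hom V W := ⟨JHom.ofIso f, h, fun _ => map_zero _⟩

@[simp] lemma Hom.ofIso_fix_vec {V W : Rep H} (f : V.V →ₗᵢ[ℝ] W.V)
    (h : ∀ k v, f (V.ρ k v) = W.ρ k (f v)) : (Hom.ofIso f h).fix.vec = 0 := rfl

/-- Direct sums. -/
def Hom.sum {S : Type} [Finite S] {V W : S → Rep H} (f : ∀ s, Hom (V s) (W s)) :
    Hom (Rep.sum V) (Rep.sum W) where
  toJHom := JHom.sum fun s => (f s).toJHom
  iso_ρ h v := by apply IPS.sum_ext; intro s; exact (f s).iso_ρ h _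
  ρ_vec h := by apply IPS.sum_ext; intro s; exact (f s).ρ_vec h

end Rep

/-! ### Geometric fixed points -/

section
variable {G : Type} [Group G] [TopologicalSpace G]

/-- The space `X(V)^K` for a representation `V` of `K`. -/
abbrev GSpectrum.fixedAt (X : GSpectrum G) (K : Subgroup G) (V : Rep K) : Type 1 :=
  {x : X.obj V.V // ∀ k : K, X.map (JHom.ofIso (V.ρ k).toLinearIsometry) (X.act (k : G) x) = x}

/-- The point-set geometric fixed points `Φ^K X`: the left Kan extension along `V ↦ V^K` of
`V ↦ X(V)^K`, that is, the coend `∫^V J(V^K, -) ∧ X(V)^K` over the representations of `K` and the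
fixed morphisms between them. -/
abbrev geomFixPres (K : Subgroup G) (X : GSpectrum G) : Presentation where
  I := Rep K
  P V := V.fix
  Y V := X.fixedAt K V
  base V := {x | x.1 = X.pt V.V}
  i₀ := Rep.zero
  y₀ := ⟨X.pt _, fun k => by rw [X.act_pt, X.map_pt]⟩
  R {V W} p x y := ∃ h : Rep.Hom V W, p = h.fix ∧ y.1 = X.map h.toJHom x.1
  R_id {V} x := ⟨Rep.Hom.id V, rfl, (X.map_id _).symm⟩

/-- The geometric fixed point spectrum. -/
abbrev geomFix (K : Subgroup G) (X : GSpectrum G) : Spectrum := (geomFixPres K X).spectrum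

namespace geomFix
open Presentation

variable {K : Subgroup G} {X Y : GSpectrum G}

/-- The point of `Φ^K X` given by a point of `X(V)^K`. -/
def pnt {V : Rep K} (x : X.fixedAt K V) : (geomFix K X).obj V.fix :=
  gen (D := geomFixPres K X) (i := V) x

lemma pnt_map {V W : Rep K} (h : Rep.Hom V W) (x : X.fixedAt K V) (y : X.fixedAt K W)
    (hy : y.1 = X.map h.toJHom x.1) : (geomFix K X).map h.fix (pnt x) = pnt y :=
  gen_rel (D := geomFixPres K X) (i := V) (j := W) h.fix ⟨h, rfl, hy⟩

lemma pnt_pt {V : Rep K} {x : X.fixedAt K V} (h : x.1 = X.pt V.V) :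
    pnt x = (geomFix K X).pt _ :=
  gen_base (D := geomFixPres K X) (i := V) h

lemma pnt_kcont (V : Rep K) : KCont fun x : X.fixedAt K V => pnt x :=
  gen_kcont (D := geomFixPres K X) V

/-- An equivariant map on fixed points. -/
def onFixed (f : Spectrum.Hom X.toSpectrum Y.toSpectrum) (hf : f.IsEquivariant) {V : Rep K}
    (x : X.fixedAt K V) : Y.fixedAt K V :=
  ⟨f.app _ x.1, fun k => by rw [← hf, ← f.naturality, x.2]⟩

/-- The functoriality of geometric fixed points. -/
def map (f : Spectrum.Hom X.toSpectrum Y.toSpectrum) (hf : f.IsEquivariant) :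
    Spectrum.Hom (geomFix K X) (geomFix K Y) :=
  (Family.mk (Λ := Unit) (D := geomFixPres K X) (Z := geomFix K Y)
    (fun _ V x => pnt (onFixed f hf x))
    (fun V => (pnt_kcont V).comp (Continuous.kcont
      (((f.continuous_app V.V).comp (continuous_subtype_val.comp continuous_snd)).subtype_mk _)))
    (fun _ V x (h : x.1 = _) => pnt_pt ((congrArg (f.app V.V) h).trans (f.app_pt _)))
    (fun _ V W p x y h => by
      obtain ⟨h, rfl, hy⟩ := h
      exact pnt_map h _ _ ((congrArg (f.app W.V) hy).trans (f.naturality _ _)))).hom ()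

lemma cases {S : Type} [Finite S] {U : S → IPS} (x : ∀ s, (geomFix K X).obj (U s)) :
    (∃ s, x s = (geomFix K X).pt (U s)) ∨
    ∃ (V : S → Rep K) (q : ∀ s, JHom (V s).fix (U s)) (a : ∀ s, X.fixedAt K (V s)),
      x = fun s => (geomFix K X).map (q s) (pnt (a s)) :=
  multi_cases (D := fun _ => geomFixPres K X) x

lemma ind {U : IPS} {motive : (geomFix K X).obj U → Prop}
    (pt : motive ((geomFix K X).pt U))
    (pnt : ∀ (V : Rep K) (q : JHom V.fix U) (a : X.fixedAt K V),
      motive ((geomFix K X).map q (pnt a)))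
    (x : (geomFix K X).obj U) : motive x :=
  spectrum_ind pt pnt x

section
variable {N : GOperad G} (A : GAlgebra N X)

lemma op_fixedAt {S : Type} [Finite S] {V : S → Rep K} (ξ : N.obj S) (hξ : ∀ g, N.act g ξ = ξ)
    (x : ∀ s, X.fixedAt K (V s)) (k : K) :
    X.map (JHom.sum fun s => JHom.ofIso ((V s).ρ k).toLinearIsometry)
      (X.act (k : G) (A.op ξ fun s => (x s).1)) = A.op ξ fun s => (x s).1 := by
  rw [A.op_act, hξ, ← A.op_nat]
  congr 1
  funext s
  exact (x s).2 k

/-- The action of fixed operations on fixed points. -/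
def opFixed {S : Type} [Finite S] {V : S → Rep K} (ξ : N.fixed.obj S)
    (x : ∀ s, X.fixedAt K (V s)) : X.fixedAt K (Rep.sum V) :=
  ⟨A.op ξ.1 fun s => (x s).1, fun k => op_fixedAt A ξ.1 ξ.2 x k⟩

lemma opFixed_val {S : Type} [Finite S] {V : S → Rep K} (ξ : N.fixed.obj S)
    (x : ∀ s, X.fixedAt K (V s)) : (opFixed A ξ x).1 = A.op ξ.1 fun s => (x s).1 := rfl

variable (K) in
/-- The family defining the algebra structure on geometric fixed points. -/
def algFamily (S : Type) [Finite S] :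
    MultiFamily (N.fixed.obj S) (fun _ : S => geomFixPres K X) (geomFix K X) where
  fn ξ (V : S → Rep K) (x : ∀ s, X.fixedAt K (V s)) :=
    (geomFix K X).map (JHom.ofIso (Rep.fixSum V)) (pnt (opFixed A ξ x))
  kcont (V : S → Rep K) := by
    refine (Continuous.kcont (Spectrum.continuous_map _ _)).comp ((pnt_kcont _).comp ?_)
    have h : KCont fun p : N.fixed.obj S × (∀ s, X.fixedAt K (V s)) =>
        A.op p.1.1 fun s => (p.2 s).1 :=
      A.op_kcont.comp (f := fun p : N.fixed.obj S × (∀ s, X.fixedAt K (V s)) =>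
        (p.1.1, fun s => (p.2 s).1)) (Continuous.kcont (by fun_prop))
    exact fun C u => (h C u).subtype_mk _
  base ξ (V : S → Rep K) (x : ∀ s, X.fixedAt K (V s)) h := by
    obtain ⟨s, h⟩ := h
    rw [pnt_pt (A.op_pt ξ.1 (fun s => (x s).1) ⟨s, h⟩), Spectrum.map_pt]
  rel ξ (V W : S → Rep K) p (x : ∀ s, X.fixedAt K (V s)) (y : ∀ s, X.fixedAt K (W s)) h := by
    choose h hp hy using h
    obtain rfl : p = fun s => (h s).fix := funext hp
    have h1 : (opFixed A ξ y).1 = X.map (Rep.Hom.sum h).toJHom (opFixed A ξ x).1 := by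
      rw [opFixed_val, opFixed_val]
      refine Eq.trans ?_ (A.op_nat (fun s => (h s).toJHom) ξ.1 _)
      congr 1
      funext s
      exact hy s
    rw [← pnt_map (Rep.Hom.sum h) _ _ h1, ← Spectrum.map_comp, ← Spectrum.map_comp]
    refine congrArg (fun f => (geomFix K X).map f (pnt (opFixed A ξ x))) ?_
    apply JHom.ext'
    · intro v; rfl
    · apply IPS.sum_ext; intro s
      apply Rep.fix_ext
      simp
      rfl

lemma algFamily_pnt {S : Type} [Finite S] (ξ : N.fixed.obj S) {V : S → Rep K}
    (x : ∀ s, X.fixedAt K (V s)) :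
    (algFamily K A S).lift _ ξ (fun s => pnt (x s)) =
      (geomFix K X).map (JHom.ofIso (Rep.fixSum V)) (pnt (opFixed A ξ x)) :=
  (algFamily K A S).lift_gen ξ x

lemma algFamily_map {S : Type} [Finite S] (ξ : N.fixed.obj S) {V V' : S → IPS}
    (q : ∀ s, JHom (V s) (V' s)) (x : ∀ s, (geomFix K X).obj (V s)) :
    (algFamily K A S).lift V' ξ (fun s => (geomFix K X).map (q s) (x s)) =
      (geomFix K X).map (JHom.sum q) ((algFamily K A S).lift V ξ x) :=
  (algFamily K A S).lift_map ξ q x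

lemma algFamily_pt {S : Type} [Finite S] (ξ : N.fixed.obj S) {V : S → IPS}
    (x : ∀ s, (geomFix K X).obj (V s)) (h : ∃ s, x s = (geomFix K X).pt (V s)) :
    (algFamily K A S).lift V ξ x = (geomFix K X).pt _ :=
  (algFamily K A S).lift_pt ξ x h

variable (K) in
/-- The `N^G`-algebra structure on the geometric fixed points of an `N`-algebra. -/
def algebra : Algebra N.fixed (geomFix K X) where
  op {S _ V} ξ x := (algFamily K A S).lift V ξ x
  op_kcont {S _ V} := (algFamily K A S).lift_kcont V
  op_pt ξ x h := algFamily_pt A ξ x h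
  op_nat f ξ x := algFamily_map A ξ f x
  op_map {S S' _ _ V} e ξ x := by
    rcases cases x with ⟨s, hs⟩ | ⟨W, q, a, rfl⟩
    · rw [algFamily_pt A _ _ ⟨s, hs⟩, algFamily_pt A _ _ ⟨e.symm s, ?_⟩, Spectrum.map_pt]
      have : ∀ s', s' = s → x s' = (geomFix K X).pt (V s') := by
        rintro _ rfl; exact hs
      exact this _ (e.apply_symm_apply s)
    · rw [algFamily_map, algFamily_pnt]
      refine Eq.trans ?_ (algFamily_map A ξ (fun s => q (e s)) fun s => pnt (a (e s))).symm
      rw [algFamily_pnt A ξ fun s => a (e s)]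
      have h := pnt_map (Rep.Hom.ofIso (V := Rep.sum W) (W := Rep.sum fun s => W (e s))
        (IPS.pull e fun s => (W s).V) fun k v => rfl) (opFixed A (N.fixed.map e ξ) a)
        (opFixed A ξ fun s => a (e s)) (A.op_map e ξ.1 fun s => (a s).1).symm
      rw [← h]
      simp only [← Spectrum.map_comp]
      refine congrArg (fun f => (geomFix K X).map f (pnt (opFixed A (N.fixed.map e ξ) a))) ?_
      apply JHom.ext'
      · intro v; rfl
      · apply IPS.sum_ext; intro s
        simp only [JHom.comp_vec, JHom.ofIso_vec, JHom.sum_vec, zero_add, IPS.comp_add,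
          IPS.comp_tup, IPS.pull_comp, JHom.sum_iso, IPS.sumLI_comp, map_zero, add_zero,
          JHom.ofIso_iso]
        exact ((add_eq_left.2 ((congrArg (fun z => (q (e s)).iso (IPS.comp z s))
          (map_zero (Rep.fixSum fun s => W (e s)))).trans (map_zero _)))).symm
  op_one {V} x := by
    induction x using ind with
    | pt => rw [algFamily_pt A _ _ ⟨(), rfl⟩, Spectrum.map_pt]
    | pnt W q a =>
      refine Eq.trans (algFamily_map A N.fixed.one (fun _ : Unit => q) fun _ => pnt a) ?_
      rw [algFamily_pnt A N.fixed.one fun _ => a]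
      have h := pnt_map (Rep.Hom.ofIso (V := W) (W := Rep.sum fun _ : Unit => W)
        (IPS.single W.V) fun k v => rfl) a (opFixed A N.fixed.one fun _ => a) (A.op_one a.1)
      rw [← h]
      simp only [← Spectrum.map_comp]
      refine congrArg (fun f => (geomFix K X).map f (pnt a)) ?_
      apply JHom.ext'
      · intro v; rfl
      · apply IPS.sum_ext; intro s
        simp only [JHom.comp_vec, JHom.ofIso_vec, JHom.sum_vec, zero_add, IPS.comp_add,
          IPS.comp_tup, IPS.single_comp, JHom.sum_iso, IPS.sumLI_comp, map_zero, add_zero,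
          JHom.ofIso_iso]
        exact (add_eq_left.2 ((congrArg (fun z => q.iso (IPS.comp z s))
          (map_zero (Rep.fixSum fun _ : Unit => W))).trans (map_zero _)))
  op_comp {S _ S' _ V} ξ η x := by
    rcases cases x with ⟨⟨s, s'⟩, hs⟩ | ⟨W, q, a, rfl⟩
    · rw [algFamily_pt A _ _ ⟨_, hs⟩, Spectrum.map_pt]
      exact (algFamily_pt A _ _ ⟨s, algFamily_pt A _ _ ⟨s', hs⟩⟩).symm
    · rw [algFamily_map, algFamily_pnt]
      have h1 : ∀ s, (algFamily K A (S' s)).lift _ (η s) (fun s' =>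
          (geomFix K X).map (q ⟨s, s'⟩) (pnt (a ⟨s, s'⟩))) =
          (geomFix K X).map ((JHom.sum fun s' => q ⟨s, s'⟩).comp
            (JHom.ofIso (Rep.fixSum fun s' => W ⟨s, s'⟩)))
            (pnt (opFixed A (η s) fun s' => a ⟨s, s'⟩)) := fun s => by
        refine Eq.trans (algFamily_map A (η s) (fun s' => q ⟨s, s'⟩)
          fun s' => pnt (a ⟨s, s'⟩)) ?_
        rw [algFamily_pnt A (η s) fun s' => a ⟨s, s'⟩, ← Spectrum.map_comp]
      simp only [h1]
      refine Eq.trans ?_ (algFamily_map A ξ (fun s => ((JHom.sum fun s' => q ⟨s, s'⟩).comp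
            (JHom.ofIso (Rep.fixSum fun s' => W ⟨s, s'⟩))))
            fun s => pnt (opFixed A (η s) fun s' => a ⟨s, s'⟩)).symm
      rw [algFamily_pnt A ξ fun s => opFixed A (η s) fun s' => a ⟨s, s'⟩]
      have h := pnt_map (Rep.Hom.ofIso (V := Rep.sum W)
        (W := Rep.sum fun s => Rep.sum fun s' => W ⟨s, s'⟩)
        (IPS.curry fun p => (W p).V) fun k v => rfl) (opFixed A (N.fixed.comp ξ η) a)
        (opFixed A ξ fun s => opFixed A (η s) fun s' => a ⟨s, s'⟩)
        (A.op_comp ξ.1 (fun s => (η s).1) fun p => (a p).1).symm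
      rw [← h]
      simp only [← Spectrum.map_comp]
      refine congrArg (fun f => (geomFix K X).map f (pnt (opFixed A (N.fixed.comp ξ η) a))) ?_
      apply JHom.ext'
      · intro v; rfl
      · apply IPS.sum_ext; intro s
        apply IPS.sum_ext; intro s'
        simp only [JHom.comp_vec, JHom.ofIso_vec, JHom.sum_vec, zero_add, IPS.comp_add,
          IPS.comp_tup, IPS.curry_comp, JHom.sum_iso, IPS.sumLI_comp, map_zero, add_zero,
          JHom.ofIso_iso]
        refine (add_eq_left.2 ((congrArg (q ⟨s, s'⟩).iso ?_).trans (map_zero _))).symm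
        rfl

end
end geomFix
end

/-! ### The residual action of the Weyl group on geometric fixed points -/

section
variable {G : Type} [Group G] [TopologicalSpace G] [IsTopologicalGroup G]

/-- The Weyl group `W K = N_G(K) / K`. -/
abbrev Weyl (K : Subgroup G) : Type :=
  Subgroup.normalizer (K : Set G) ⧸ K.subgroupOf (Subgroup.normalizer (K : Set G))

variable {K : Subgroup G}

lemma conj_mem (n : Subgroup.normalizer (K : Set G)) (k : K) : (n : G)⁻¹ * k * n ∈ K := by
  have h := (Subgroup.mem_normalizer_iff.1 (inv_mem n.2) (k : G)).1 k.2
  simpa using h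

/-- The automorphism `k ↦ n⁻¹ k n` of `K`, as a homomorphism. -/
def conjHom (n : Subgroup.normalizer (K : Set G)) : K →* K where
  toFun k := ⟨(n : G)⁻¹ * k * n, conj_mem n k⟩
  map_one' := Subtype.ext (by simp)
  map_mul' k l := Subtype.ext (by simp [mul_assoc])

lemma continuous_conjHom (n : Subgroup.normalizer (K : Set G)) : Continuous (conjHom n) := by
  refine Continuous.subtype_mk ?_ _
  fun_prop

/-- The representation `V` with `k` acting as `n⁻¹ k n`. -/
def Rep.conj (n : Subgroup.normalizer (K : Set G)) (V : Rep K) : Rep K where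
  V := V.V
  ρ := V.ρ.comp (conjHom n)
  cont v := (V.cont v).comp (continuous_conjHom n)

lemma Rep.conj_ρ (n : Subgroup.normalizer (K : Set G)) (V : Rep K) (k : K) (v : V.V) :
    (V.conj n).ρ k v = V.ρ (conjHom n k) v := rfl

lemma conjHom_surjective (n : Subgroup.normalizer (K : Set G)) : Function.Surjective (conjHom n) := by
  intro k
  refine ⟨⟨(n : G) * k * (n : G)⁻¹, (Subgroup.mem_normalizer_iff.1 n.2 (k : G)).1 k.2⟩, ?_⟩
  apply Subtype.ext
  simp [conjHom, mul_assoc]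

/-- Conjugation does not change the fixed vectors. -/
def Rep.conjFix (n : Subgroup.normalizer (K : Set G)) (V : Rep K) :
    (V.conj n).fix →ₗᵢ[ℝ] V.fix :=
  V.lift (V.conj n).incl fun u k => by
    obtain ⟨k, rfl⟩ := conjHom_surjective n k
    exact (V.conj n).ρ_incl u k

@[simp] lemma Rep.incl_conjFix (n : Subgroup.normalizer (K : Set G)) (V : Rep K)
    (v : (V.conj n).fix) : V.incl (V.conjFix n v) = (V.conj n).incl v := rfl

namespace geomFix
open Presentation
variable {X : GSpectrum G}

lemma act_fixedAt (n : Subgroup.normalizer (K : Set G)) {V : Rep K} (x : X.fixedAt K V) (k : K) :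
    X.map (JHom.ofIso (V.ρ (conjHom n k)).toLinearIsometry) (X.act (k : G) (X.act (n : G) x.1)) =
      X.act (n : G) x.1 := by
  have h := x.2 (conjHom n k)
  conv_rhs => rw [← h]
  rw [X.act_map, ← X.act_mul, ← X.act_mul]
  congr 2
  simp [conjHom, mul_assoc]

/-- The action of `n` on fixed points, as a map `X(V)^K → X(nV)^K`. -/
def conjFixed (n : Subgroup.normalizer (K : Set G)) {V : Rep K} (x : X.fixedAt K V) :
    X.fixedAt K (V.conj n) :=
  ⟨X.act (n : G) x.1, act_fixedAt n x⟩

variable (X) in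
/-- The family defining the action of the normalizer. -/
def conjFamily (n : Subgroup.normalizer (K : Set G)) :
    Family Unit (geomFixPres K X) (geomFix K X) where
  fn _ V x := (geomFix K X).map (JHom.ofIso (V.conjFix n)) (pnt (conjFixed n x))
  kcont V := by
    refine (Continuous.kcont (Spectrum.continuous_map _ _)).comp ((pnt_kcont _).comp ?_)
    exact Continuous.kcont (((X.continuous_act _).comp
      (continuous_subtype_val.comp continuous_snd)).subtype_mk _)
  base _ V x (h : x.1 = _) := by
    rw [pnt_pt (x := conjFixed n x) ((congrArg (X.act (n : G)) h).trans (X.act_pt _)),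
      Spectrum.map_pt]
  rel _ V W p x y h := by
    obtain ⟨h, rfl, hy⟩ := h
    let h' : Rep.Hom (V.conj n) (W.conj n) :=
      ⟨h.toJHom, fun k v => h.iso_ρ (conjHom n k) v, fun k => h.ρ_vec (conjHom n k)⟩
    rw [← pnt_map h' (conjFixed n x) (conjFixed n y)
      ((congrArg (X.act (n : G)) hy).trans (X.act_map _ _ _)), ← Spectrum.map_comp,
      ← Spectrum.map_comp]
    refine congrArg (fun f => (geomFix K X).map f (pnt (conjFixed n x))) ?_
    apply JHom.ext'
    · intro v; rfl
    · apply Rep.fix_ext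
      simp
      rfl

variable (X) in
/-- The action of `n`. -/
def conjMap (n : Subgroup.normalizer (K : Set G)) : Spectrum.Hom (geomFix K X) (geomFix K X) :=
  (conjFamily X n).hom ()

lemma conjMap_pnt (n : Subgroup.normalizer (K : Set G)) {V : Rep K} (x : X.fixedAt K V) :
    (conjMap X n).app _ (pnt x) =
      (geomFix K X).map (JHom.ofIso (V.conjFix n)) (pnt (conjFixed n x)) :=
  (conjFamily X n).hom_gen () x

lemma conjMap_mul (n n' : Subgroup.normalizer (K : Set G)) :
    conjMap X (n * n') = (conjMap X n).comp (conjMap X n') := by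
  refine hom_ext fun (V : Rep K) (x : X.fixedAt K V) => ?_
  change (conjMap X (n * n')).app _ (pnt x) = (conjMap X n).app _ ((conjMap X n').app _ (pnt x))
  rw [conjMap_pnt, conjMap_pnt, Spectrum.Hom.naturality, conjMap_pnt, ← Spectrum.map_comp]
  have hc : ∀ k, conjHom (n * n') k = conjHom n' (conjHom n k) := fun k =>
    Subtype.ext (by simp [conjHom, mul_assoc])
  have h := pnt_map (Rep.Hom.ofIso (V := (V.conj n').conj n) (W := V.conj (n * n'))
    LinearIsometry.id fun k v => by
      change V.ρ (conjHom n' (conjHom n k)) v = V.ρ (conjHom (n * n') k) v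
      rw [hc]) (conjFixed n (conjFixed n' x)) (conjFixed (n * n') x)
      (((X.act_mul (n : G) n' x.1)).trans (X.map_id _).symm)
  rw [← h, ← Spectrum.map_comp]
  refine congrArg (fun f => (geomFix K X).map f (pnt (conjFixed n (conjFixed n' x)))) ?_
  apply JHom.ext'
  · intro v; rfl
  · apply Rep.fix_ext
    simp
    rfl

lemma conjMap_of_mem (n : Subgroup.normalizer (K : Set G)) (hn : (n : G) ∈ K) :
    conjMap X n = Spectrum.Hom.id _ := by
  refine hom_ext fun (V : Rep K) (x : X.fixedAt K V) => ?_
  change (conjMap X n).app _ (pnt x) = pnt x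
  let k : K := ⟨n, hn⟩
  rw [conjMap_pnt]
  have h := pnt_map (Rep.Hom.ofIso (V := V.conj n) (W := V) (V.ρ k).toLinearIsometry fun l (v : V.V) => by
      have hl : k * conjHom n l = l * k := Subtype.ext (by simp [conjHom, k, mul_assoc])
      exact (V.ρ_mul k (conjHom n l) v).symm.trans
        ((congrArg (fun j => V.ρ j v) hl).trans (V.ρ_mul l k v))) (conjFixed n x) x (x.2 k).symm
  rw [← h]
  refine congrArg (fun f => (geomFix K X).map f (pnt (conjFixed n x))) ?_
  apply JHom.ext'
  · intro v
    apply Rep.fix_ext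
    exact (V.ρ_incl (V.conjFix n v) k).symm
  · rfl

variable (K X) in
/-- The residual action of the Weyl group on `Φ^K X`: the class of `n` takes the point given by
`x ∈ X(V)^K` to the point given by `n x ∈ X(nV)^K`. -/
def residual : Weyl K →* Spectrum.Hom (geomFix K X) (geomFix K X) :=
  QuotientGroup.lift _
    { toFun := conjMap X
      map_one' := conjMap_of_mem 1 K.one_mem
      map_mul' := conjMap_mul } fun n hn => conjMap_of_mem n (Subgroup.mem_subgroupOf.1 hn)

end geomFix

/-! ### Induced representations and the diagonal -/

/-- The element `r(t)⁻¹ g r(g⁻¹ t)` of `K`, where `r` are the chosen coset representatives. -/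
def cocycle (K : Subgroup G) (g : G) (t : G ⧸ K) : K :=
  ⟨t.out⁻¹ * (g * (g⁻¹ • t).out), by
    rw [← QuotientGroup.eq, QuotientGroup.out_eq', ← smul_eq_mul g, ← MulAction.Quotient.smul_coe,
      QuotientGroup.out_eq', smul_inv_smul]⟩

lemma cocycle_one (t : G ⧸ K) : cocycle K 1 t = 1 := by
  apply Subtype.ext
  simp [cocycle]

lemma cocycle_mul (g h : G) (t : G ⧸ K) :
    cocycle K (g * h) t = cocycle K g t * cocycle K h (g⁻¹ • t) := by
  apply Subtype.ext
  simp [cocycle, mul_assoc, mul_smul]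

variable [K.FiniteIndex]

/-- The linear map by which `g` acts on an induced representation. -/
def Rep.indLI (V : Rep K) (g : G) :
    (IPS.sum fun _ : G ⧸ K => V.V) →ₗᵢ[ℝ] IPS.sum fun _ : G ⧸ K => V.V :=
  (IPS.sumLI fun t => (V.ρ (cocycle K g t)).toLinearIsometry).comp
    (IPS.pull (MulAction.toPerm g⁻¹) fun _ : G ⧸ K => V.V)

lemma Rep.indLI_comp (V : Rep K) (g : G) (x : IPS.sum fun _ : G ⧸ K => V.V) (t : G ⧸ K) :
    IPS.comp (V.indLI g x) t = V.ρ (cocycle K g t) (IPS.comp x (g⁻¹ • t)) := rfl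

lemma Rep.indLI_mul (V : Rep K) (g h : G) (x : IPS.sum fun _ : G ⧸ K => V.V) :
    V.indLI (g * h) x = V.indLI g (V.indLI h x) := by
  apply IPS.sum_ext; intro t
  rw [indLI_comp, indLI_comp, indLI_comp, cocycle_mul, ρ_mul, mul_inv_rev, mul_smul]

lemma Rep.indLI_one (V : Rep K) (x : IPS.sum fun _ : G ⧸ K => V.V) : V.indLI 1 x = x := by
  apply IPS.sum_ext; intro t
  rw [indLI_comp, cocycle_one, ρ_one, inv_one, one_smul]

/-- The linear isometric automorphism by which `g` acts on an induced representation. -/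
def Rep.indEquiv (V : Rep K) (g : G) :
    (IPS.sum fun _ : G ⧸ K => V.V) ≃ₗᵢ[ℝ] IPS.sum fun _ : G ⧸ K => V.V :=
  LinearIsometryEquiv.ofSurjective (V.indLI g) fun y =>
    ⟨V.indLI g⁻¹ y, by rw [← V.indLI_mul, mul_inv_cancel, V.indLI_one]⟩

lemma Rep.indLI_cont (hK : IsOpen (K : Set G)) (V : Rep K) (x : IPS.sum fun _ : G ⧸ K => V.V) :
    Continuous fun g : G => V.indLI g x := by
  refine IPS.continuous_sum_iff.2 fun t => ?_
  rw [continuous_iff_continuousAt]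
  intro g₀
  let O : Set G := {g | g • (g₀⁻¹ • t) = t}
  have hO : IsOpen O := isOpen_smul_eq K hK (g₀⁻¹ • t) t
  have hg₀ : g₀ ∈ O := smul_inv_smul g₀ t
  have hO' : ∀ g : O, (g : G)⁻¹ • t = g₀⁻¹ • t := fun g => by
    rw [inv_smul_eq_iff]
    exact g.2.symm
  have hc : Continuous fun g : O => cocycle K (g : G) t := by
    refine Continuous.subtype_mk ?_ _
    simp only [hO']
    fun_prop
  have h1 : Continuous fun g : O => IPS.comp (V.indLI (g : G) x) t := by
    simp only [indLI_comp, hO']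
    exact (V.cont _).comp hc
  exact (hO.isOpenEmbedding_subtypeVal.continuousAt_iff (x := ⟨g₀, hg₀⟩)).1 h1.continuousAt

/-- The representation of `G` induced from `V`. -/
def Rep.ind (hK : IsOpen (K : Set G)) (V : Rep K) : Rep (⊤ : Subgroup G) where
  V := IPS.sum fun _ : G ⧸ K => V.V
  ρ :=
    { toFun := fun g => V.indEquiv (g : G)
      map_one' := LinearIsometryEquiv.ext fun x => V.indLI_one x
      map_mul' := fun g h => LinearIsometryEquiv.ext fun x => V.indLI_mul g h x }
  cont x := (V.indLI_cont hK x).comp continuous_subtype_val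

/-- The inclusion of the fixed vectors of an induced representation. -/
def Rep.inclInd (hK : IsOpen (K : Set G)) (V : Rep K) :
    (V.ind hK).fix →ₗᵢ[ℝ] IPS.sum fun _ : G ⧸ K => V.V := (V.ind hK).incl

lemma Rep.ρ_inclInd (hK : IsOpen (K : Set G)) (V : Rep K) (x : (V.ind hK).fix) (g : G)
    (t : G ⧸ K) : V.ρ (cocycle K g t) (IPS.comp (V.inclInd hK x) (g⁻¹ • t)) =
      IPS.comp (V.inclInd hK x) t :=
  congrArg (fun y : IPS.sum fun _ : G ⧸ K => V.V => IPS.comp y t)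
    ((V.ind hK).ρ_incl x ⟨g, Subgroup.mem_top g⟩)

lemma Rep.comp_inclInd_fixed (hK : IsOpen (K : Set G)) (V : Rep K) (x : (V.ind hK).fix)
    (t : G ⧸ K) (k : K) : V.ρ k (IPS.comp (V.inclInd hK x) t) = IPS.comp (V.inclInd hK x) t := by
  have ht : (t.out * k * t.out⁻¹ : G)⁻¹ • t = t := by
    conv_lhs => rw [← QuotientGroup.out_eq' t]
    conv_rhs => rw [← QuotientGroup.out_eq' t]
    rw [MulAction.Quotient.smul_coe, QuotientGroup.eq]
    simp [mul_assoc]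
  have h := V.ρ_inclInd hK x (t.out * k * t.out⁻¹) t
  have hk : cocycle K (t.out * k * t.out⁻¹ : G) t = k := by
    apply Subtype.ext
    simp only [cocycle, ht]
    simp [mul_assoc]
  rwa [hk, ht] at h

lemma Rep.comp_inclInd_eq (hK : IsOpen (K : Set G)) (V : Rep K) (x : (V.ind hK).fix)
    (t t' : G ⧸ K) : IPS.comp (V.inclInd hK x) t = IPS.comp (V.inclInd hK x) t' := by
  have ht : (t.out * t'.out⁻¹ : G)⁻¹ • t = t' := by
    conv_lhs => rw [← QuotientGroup.out_eq' t]
    conv_rhs => rw [← QuotientGroup.out_eq' t']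
    rw [MulAction.Quotient.smul_coe]
    simp
  have h := V.ρ_inclInd hK x (t.out * t'.out⁻¹) t
  have hk : cocycle K (t.out * t'.out⁻¹ : G) t = 1 := by
    apply Subtype.ext
    simp only [cocycle, ht]
    simp [mul_assoc]
  rw [hk, ht, ρ_one] at h
  exact h.symm

/-- The factor by which the diagonal `V^K → (Ind V)^G` changes lengths. -/
def diagScale (K : Subgroup G) : ℝ := Real.sqrt K.index

lemma diagScale_pos : 0 < diagScale K :=
  Real.sqrt_pos.2 (Nat.cast_pos.2 (Nat.pos_of_ne_zero Subgroup.FiniteIndex.index_ne_zero))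

/-- The linear map underlying `undiag`. -/
def Rep.undiagLin (hK : IsOpen (K : Set G)) (V : Rep K) : (V.ind hK).fix →ₗ[ℝ] V.fix where
  toFun x := diagScale K • V.vec (IPS.comp (V.inclInd hK x) ((1 : G) : G ⧸ K))
      (V.comp_inclInd_fixed hK x _)
  map_add' x y := V.fix_ext (by simp)
  map_smul' c x := V.fix_ext (by simp [smul_comm c])

lemma Rep.norm_undiagLin (hK : IsOpen (K : Set G)) (V : Rep K) (x : (V.ind hK).fix) :
    ‖V.undiagLin hK x‖ ^ 2 = ‖x‖ ^ 2 := by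
  cases nonempty_fintype (G ⧸ K)
  have h1 : ‖x‖ ^ 2 = ∑ t : G ⧸ K, ‖IPS.comp (V.inclInd hK x) t‖ ^ 2 := by
    rw [← (V.inclInd hK).norm_map x, IPS.norm_sq_eq]
  have h2 : ‖V.undiagLin hK x‖ = diagScale K * ‖IPS.comp (V.inclInd hK x) ((1 : G) : G ⧸ K)‖ := by
    rw [← V.incl.norm_map (V.undiagLin hK x)]
    change ‖V.incl (diagScale K • V.vec _ _)‖ = _
    rw [map_smul, incl_vec, norm_smul, Real.norm_of_nonneg (diagScale_pos (K := K)).le]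
  rw [h1, h2, Finset.sum_congr rfl fun t _ => by
    rw [V.comp_inclInd_eq hK x t ((1 : G) : G ⧸ K)]]
  rw [Finset.sum_const, Finset.card_univ, nsmul_eq_mul, ← Nat.card_eq_fintype_card,
    ← Subgroup.index_eq_card, mul_pow, diagScale, Real.sq_sqrt (by positivity)]

/-- The isometry `(Ind V)^G → V^K` inverse to the normalized diagonal: the fixed vectors of
`Ind V` are the constant families `(v)ₜ` with `v ∈ V^K`, and `(v)ₜ` goes to `√[G:K] v`. -/
def Rep.undiag (hK : IsOpen (K : Set G)) (V : Rep K) : (V.ind hK).fix →ₗᵢ[ℝ] V.fix :=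
  IPS.isoOfSq (V.undiagLin hK) (V.norm_undiagLin hK)

@[simp] lemma Rep.incl_undiag (hK : IsOpen (K : Set G)) (V : Rep K) (x : (V.ind hK).fix) :
    V.incl (V.undiag hK x) = diagScale K • IPS.comp (V.inclInd hK x) ((1 : G) : G ⧸ K) := rfl

/-- Induction of fixed morphisms. -/
def Rep.Hom.ind (hK : IsOpen (K : Set G)) {V W : Rep K} (h : Rep.Hom V W) :
    Rep.Hom (V.ind hK) (W.ind hK) where
  toJHom := JHom.sum fun _ : G ⧸ K => h.toJHom
  iso_ρ g v := by
    apply IPS.sum_ext; intro t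
    exact h.iso_ρ (cocycle K g t) _
  ρ_vec g := by
    apply IPS.sum_ext; intro t
    exact h.ρ_vec (cocycle K g t)

open smashPower in
lemma norm_fixedAt (hK : IsOpen (K : Set G)) (X : GSpectrum G) {V : Rep K} (x : X.fixedAt K V)
    (g : G) : (norm K hK X).map (JHom.ofIso (V.indLI g)) ((norm K hK X).act g
      (wedge fun t : G ⧸ K => X.act t.out x.1)) = wedge fun t : G ⧸ K => X.act t.out x.1 := by
  change (smashPower X.toSpectrum (G ⧸ K)).spectrum.map (JHom.ofIso (V.indLI g))
    ((permHom X g (MulAction.toPerm g⁻¹)).app _ (wedge fun t : G ⧸ K => X.act t.out x.1)) = _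
  rw [permHom_wedge, ← Spectrum.map_comp]
  have h1 : (fun t : G ⧸ K => X.act g (X.act ((MulAction.toPerm g⁻¹ : Equiv.Perm (G ⧸ K)) t).out
      x.1)) = fun t => X.map (JHom.ofIso (V.ρ (cocycle K g t)⁻¹).toLinearIsometry)
        (X.act t.out x.1) := by
    funext t
    have h2 : X.act (cocycle K g t : G) x.1 =
        X.map (JHom.ofIso (V.ρ (cocycle K g t)⁻¹).toLinearIsometry) x.1 := by
      conv_rhs => rw [← x.2 (cocycle K g t)]
      rw [← Spectrum.map_comp]
      refine (X.map_id _).symm.trans (congrArg (fun f => X.map f _) ?_)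
      apply JHom.ext'
      · intro v
        change v = V.ρ (cocycle K g t)⁻¹ (V.ρ (cocycle K g t) v)
        rw [← V.ρ_mul, inv_mul_cancel, V.ρ_one]
      · simp
    rw [← X.act_map, ← h2, ← X.act_mul, ← X.act_mul]
    congr 1
    simp [cocycle]
  rw [h1, wedge_map (fun t => JHom.ofIso (V.ρ (cocycle K g t)⁻¹).toLinearIsometry),
    ← Spectrum.map_comp]
  refine Eq.trans (congrArg (fun f => (smashPower X.toSpectrum (G ⧸ K)).spectrum.map f
    (wedge fun t : G ⧸ K => X.act t.out x.1)) ?_) (Spectrum.map_id _ _)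
  apply JHom.ext'
  · intro v
    apply IPS.sum_ext; intro t
    change V.ρ (cocycle K g t) (IPS.comp (IPS.push (MulAction.toPerm g⁻¹) (fun _ : G ⧸ K => V.V)
      (IPS.sumLI (fun t => (V.ρ (cocycle K g t)⁻¹).toLinearIsometry) v))
        ((MulAction.toPerm g⁻¹ : Equiv.Perm (G ⧸ K)) t)) = IPS.comp v t
    rw [IPS.push_comp]
    change V.ρ (cocycle K g t) (V.ρ (cocycle K g t)⁻¹ (IPS.comp v t)) = IPS.comp v t
    rw [← V.ρ_mul, mul_inv_cancel, V.ρ_one]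
  · simp

/-- The norm `⋀ₜ r(t) x` of a point `x` of `X(V)^K`, where `r(t)` are the chosen coset
representatives. -/
def normPoint (hK : IsOpen (K : Set G)) {X : GSpectrum G} {V : Rep K} (x : X.fixedAt K V) :
    (norm K hK X).fixedAt ⊤ (V.ind hK) :=
  ⟨smashPower.wedge fun t : G ⧸ K => X.act t.out x.1, fun g => norm_fixedAt hK X x g⟩

open Presentation geomFix in
/-- The diagonal map from `Φ^K X` to `Φ^G N_K^G X`, the latter with sphere coordinates rescaled by
`√[G:K]`.  It takes the point given by `x ∈ X(V)^K` to the point given by the norm of `x`, where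
`V^K` is identified with `(Ind V)^G`. -/
def diagonal (hK : IsOpen (K : Set G)) (X : GSpectrum G) : Spectrum.Hom (geomFix K X)
    ((geomFix ⊤ (norm K hK X)).rescale (diagScale K) diagScale_pos) :=
  (Family.mk (Λ := Unit) (D := geomFixPres K X)
    (Z := (geomFix ⊤ (norm K hK X)).rescale (diagScale K) diagScale_pos)
    (fun _ V x => (geomFix ⊤ (norm K hK X)).map (JHom.ofIso (V.undiag hK)) (pnt (normPoint hK x)))
    (fun V => by
      refine (Continuous.kcont (Spectrum.continuous_map _ _)).comp ((pnt_kcont _).comp ?_)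
      have h : KCont fun p : Unit × X.fixedAt K V =>
          smashPower.wedge fun t : G ⧸ K => X.act t.out p.2.1 :=
        (smashPower.wedge_kcont _).comp (KCont.pi fun t => Continuous.kcont
          ((X.continuous_act _).comp (continuous_subtype_val.comp continuous_snd)))
      exact fun C u => (h C u).subtype_mk _)
    (fun _ V x (h : x.1 = _) => by
      rw [pnt_pt (smashPower.wedge_pt ⟨((1 : G) : G ⧸ K), by rw [h, X.act_pt]⟩)]
      exact Spectrum.map_pt _ _)
    (fun _ V W p x y h => by
      obtain ⟨h, rfl, hy⟩ := h
      have h1 : (normPoint hK y).1 = (norm K hK X).map (h.ind hK).toJHom (normPoint hK x).1 := by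
        refine Eq.trans ?_ (smashPower.wedge_map (fun _ => h.toJHom) _)
        refine congrArg smashPower.wedge (funext fun t => ?_)
        rw [hy, X.act_map]
      rw [← pnt_map (h.ind hK) _ _ h1]
      change (geomFix ⊤ (norm K hK X)).map (h.fix.scale (diagScale K)) _ = _
      rw [← Spectrum.map_comp, ← Spectrum.map_comp]
      refine congrArg (fun f => (geomFix ⊤ (norm K hK X)).map f (pnt (normPoint hK x))) ?_
      apply JHom.ext'
      · intro v
        apply Rep.fix_ext
        change h.iso (diagScale K • IPS.comp (V.inclInd hK v) _) =
          diagScale K • h.iso (IPS.comp (V.inclInd hK v) _)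
        rw [map_smul]
      · apply Rep.fix_ext
        change W.incl (diagScale K • h.fix.vec + h.fix.iso 0) = W.incl (0 + W.undiag hK (h.ind hK).fix.vec)
        rw [map_zero, add_zero, zero_add, map_smul]
        rfl)).hom ()

end

/-! ### `N∞` operads -/

/-- A cell complex for the topological group `Γ`: the union, with the colimit topology, of a sequence
of closed subspaces, each obtained from the preceding one by attaching cells `Γ/H × Dᵈ`, with `H` a
closed subgroup, along `Γ/H × Sᵈ⁻¹`. -/
def IsCellComplex (Γ : Type) [Group Γ] [TopologicalSpace Γ] (Y : Type 1) [TopologicalSpace Y]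
    [MulAction Γ Y] : Prop :=
  ∃ F : ℕ → Set Y, F 0 = ∅ ∧ (∀ n, F n ⊆ F (n + 1)) ∧ (⋃ n, F n) = Set.univ ∧
    (∀ n, IsClosed (F n)) ∧ (∀ s : Set Y, (∀ n, IsClosed (s ∩ F n)) → IsClosed s) ∧
    ∀ n, ∃ (ι : Type 1) (H : ι → Subgroup Γ) (d : ι → ℕ)
      (Φ : ∀ i, Γ × Metric.closedBall (0 : EuclideanSpace ℝ (Fin (d i))) 1 → Y),
      (∀ i, IsClosed (H i : Set Γ)) ∧ (∀ i, Continuous (Φ i)) ∧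
      (∀ i γ γ' x, Φ i (γ * γ', x) = γ • Φ i (γ', x)) ∧
      (∀ i γ, ∀ h ∈ H i, ∀ x, Φ i (γ * h, x) = Φ i (γ, x)) ∧
      (∀ i γ x, ‖x.1‖ = 1 → Φ i (γ, x) ∈ F n) ∧
      (∀ i γ x, ‖x.1‖ < 1 → Φ i (γ, x) ∉ F n) ∧
      (∀ y, y ∈ F (n + 1) ↔ y ∈ F n ∨ ∃ i γ x, Φ i (γ, x) = y) ∧
      (∀ i j γ γ' x x', ‖x.1‖ < 1 → ‖x'.1‖ < 1 → Φ i (γ, x) = Φ j (γ', x') →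
        ∃ h : i = j, γ⁻¹ * γ' ∈ H i ∧ h ▸ x = x') ∧
      (∀ s ⊆ F (n + 1), IsClosed (s ∩ F n) → (∀ i, IsClosed (Φ i ⁻¹' s)) → IsClosed s)

/-- The condition of being equivariantly homotopy equivalent to a cell complex for `Γ`. -/
def HasCellType (Γ : Type) [Group Γ] [TopologicalSpace Γ] (X : Type 1) [TopologicalSpace X]
    [MulAction Γ X] : Prop :=
  ∃ (Y : Type 1) (_ : TopologicalSpace Y) (_ : MulAction Γ Y), ContinuousSMul Γ Y ∧
    IsCellComplex Γ Y ∧ ∃ (f : C(X, Y)) (f' : C(Y, X)) (h : C(unitInterval × X, X))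
      (h' : C(unitInterval × Y, Y)), (∀ (γ : Γ) x, f (γ • x) = γ • f x) ∧
      (∀ (γ : Γ) y, f' (γ • y) = γ • f' y) ∧ (∀ (γ : Γ) t x, h (t, γ • x) = γ • h (t, x)) ∧
      (∀ (γ : Γ) t y, h' (t, γ • y) = γ • h' (t, y)) ∧ (∀ x, h (0, x) = x) ∧
      (∀ x, h (1, x) = f' (f x)) ∧ (∀ y, h' (0, y) = y) ∧ ∀ y, h' (1, y) = f (f' y)

section
variable {G : Type} [Group G] [TopologicalSpace G]

/-- The action of `G × Σₙ` on `N(n)`. -/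
@[reducible] def GOperad.mulAction (N : GOperad G) (n : ℕ) :
    MulAction (G × Equiv.Perm (Fin n)) (N.obj (Fin n)) where
  smul γ ξ := N.act γ.1 (N.map γ.2 ξ)
  one_smul ξ := by
    change N.act 1 (N.map (Equiv.refl _) ξ) = ξ
    rw [N.act_one, N.map_refl]
  mul_smul γ γ' ξ := by
    change N.act (γ.1 * γ'.1) (N.map (γ'.2.trans γ.2) ξ) =
      N.act γ.1 (N.map γ.2 (N.act γ'.1 (N.map γ'.2 ξ)))
    rw [N.act_mul, N.map_trans, N.act_map]

/-- The topology of `G × Σₙ`, with `Σₙ` discrete. -/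
@[reducible] def prodPermTopology (G : Type) [TopologicalSpace G] (n : ℕ) :
    TopologicalSpace (G × Equiv.Perm (Fin n)) :=
  @instTopologicalSpaceProd G (Equiv.Perm (Fin n)) inferInstance ⊥

/-- `N∞` operads for `G`. -/
structure IsNInfty (N : GOperad G) : Prop where
  fixed_nonempty : ∀ n : ℕ, ∃ ξ : N.obj (Fin n), ∀ g, N.act g ξ = ξ
  cell : ∀ n : ℕ, @HasCellType (G × Equiv.Perm (Fin n)) _ (prodPermTopology G n) (N.obj (Fin n)) _
    (N.mulAction n)
  free : ∀ (n : ℕ) (τ : Equiv.Perm (Fin n)) (ξ : N.obj (Fin n)), N.map τ ξ = ξ → τ = 1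
  contractible : ∀ (n : ℕ) (H : Subgroup (G × Equiv.Perm (Fin n))),
    IsClosed[prodPermTopology G n] (H : Set (G × Equiv.Perm (Fin n))) →
    IsEmpty {ξ : N.obj (Fin n) // ∀ γ ∈ H, N.act γ.1 (N.map γ.2 ξ) = ξ} ∨
      ContractibleSpace {ξ : N.obj (Fin n) // ∀ γ ∈ H, N.act γ.1 (N.map γ.2 ξ) = ξ}

/-! ### The Weyl group action on spaces of operations -/

variable {K : Subgroup G} {m : ℕ}

/-- The permutation representation `σ` of `G` on `Fin m` given by an enumeration of `G/K`. -/
def permRep (e : G ⧸ K ≃ Fin m) : G →* Equiv.Perm (Fin m) :=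
  (Equiv.permCongrHom e).toMonoidHom.comp (MulAction.toPermHom G (G ⧸ K))

/-- The fixed points of the graph subgroup `G_σ = {(g, σ(g))}` in `N(m)`. -/
abbrev graphFixed (N : GOperad G) (e : G ⧸ K ≃ Fin m) : Type 1 :=
  {ξ : N.obj (Fin m) // ∀ g : G, N.act g (N.map (permRep e g) ξ) = ξ}

/-- The permutation `gK ↦ g n⁻¹ K` of `G/K`. -/
def rightMul (n : Subgroup.normalizer (K : Set G)) : G ⧸ K → G ⧸ K :=
  Quotient.map' (fun g => g * (n : G)⁻¹) fun a b h => by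
    rw [QuotientGroup.leftRel_apply] at h ⊢
    have := (Subgroup.mem_normalizer_iff.1 n.2 _).1 h
    simpa [mul_assoc] using this

lemma rightMul_mk (n : Subgroup.normalizer (K : Set G)) (g : G) :
    rightMul n (g : G ⧸ K) = ((g * (n : G)⁻¹ : G) : G ⧸ K) := rfl

lemma rightMul_mul (n n' : Subgroup.normalizer (K : Set G)) (t : G ⧸ K) :
    rightMul (n * n') t = rightMul n (rightMul n' t) := by
  induction t using QuotientGroup.induction_on with
  | H g => simp [rightMul_mk, mul_assoc]

lemma rightMul_of_mem (n : Subgroup.normalizer (K : Set G)) (hn : (n : G) ∈ K) (t : G ⧸ K) :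
    rightMul n t = t := by
  induction t using QuotientGroup.induction_on with
  | H g =>
    rw [rightMul_mk, QuotientGroup.eq]
    simpa using hn

/-- The action of the Weyl group on `G/K`, the class of `n` acting as `gK ↦ g n⁻¹ K`. -/
def weylPerm (K : Subgroup G) : Weyl K →* Equiv.Perm (G ⧸ K) :=
  QuotientGroup.lift _
    { toFun := fun n => ⟨rightMul n, rightMul n⁻¹,
        fun t => by rw [← rightMul_mul, inv_mul_cancel, rightMul_of_mem _ K.one_mem],
        fun t => by rw [← rightMul_mul, mul_inv_cancel, rightMul_of_mem _ K.one_mem]⟩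
      map_one' := Equiv.ext fun t => rightMul_of_mem _ K.one_mem t
      map_mul' := fun n n' => Equiv.ext fun t => rightMul_mul n n' t }
    fun n hn => Equiv.ext fun t => rightMul_of_mem n (Subgroup.mem_subgroupOf.1 hn) t

lemma weylPerm_smul (w : Weyl K) (g : G) (t : G ⧸ K) :
    weylPerm K w (g • t) = g • weylPerm K w t := by
  induction w using QuotientGroup.induction_on with
  | H n =>
    induction t using QuotientGroup.induction_on with
    | H a =>
      change ((g * a * (n : G)⁻¹ : G) : G ⧸ K) = ((g * (a * (n : G)⁻¹) : G) : G ⧸ K)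
      rw [mul_assoc]

/-- The permutation representation `α` of the Weyl group on `Fin m`. -/
def weylRep (e : G ⧸ K ≃ Fin m) : Weyl K →* Equiv.Perm (Fin m) :=
  (Equiv.permCongrHom e).toMonoidHom.comp (weylPerm K)

lemma weylRep_comm (e : G ⧸ K ≃ Fin m) (w : Weyl K) (g : G) :
    weylRep e w * permRep e g = permRep e g * weylRep e w := by
  have h : weylPerm K w * MulAction.toPermHom G (G ⧸ K) g =
      MulAction.toPermHom G (G ⧸ K) g * weylPerm K w := Equiv.ext fun t => weylPerm_smul w g t
  have h' := congrArg (Equiv.permCongrHom e) h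
  rwa [map_mul, map_mul] at h'

/-- The action of the Weyl group on `N(m)^{G_σ}` through `1 × α`. -/
instance weylAction (N : GOperad G) (e : G ⧸ K ≃ Fin m) : MulAction (Weyl K) (graphFixed N e) where
  smul w ξ := ⟨N.map (weylRep e w) ξ.1, fun g => by
    conv_rhs => rw [← ξ.2 g]
    rw [N.act_map, N.act_map, N.act_map, ← N.map_trans, ← N.map_trans]
    exact congrArg (fun τ : Equiv.Perm (Fin m) => N.map τ (N.act g ξ.1))
      (weylRep_comm e w g).symm⟩
  one_smul ξ := by
    apply Subtype.ext
    change N.map (weylRep e 1) ξ.1 = ξ.1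
    rw [map_one]
    exact N.map_refl _
  mul_smul w w' ξ := by
    apply Subtype.ext
    change N.map (weylRep e (w * w')) ξ.1 = N.map (weylRep e w) (N.map (weylRep e w') ξ.1)
    rw [map_mul, ← N.map_trans]
    rfl

/-- The map of fixed point spaces induced by a map of operads. -/
def graphFixed.map {N N' : GOperad G} (j : GOperadHom N N') {e : G ⧸ K ≃ Fin m}
    (ξ : graphFixed N e) : graphFixed N' e :=
  ⟨j.app ξ.1, fun g => by rw [← j.app_map, ← j.app_act, ξ.2]⟩

end

/-! ### The multiplication maps -/

section
variable {G : Type} [Group G] [TopologicalSpace G] [IsTopologicalGroup G]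

/-- The algebra structure induced by the interchange map, in which `η` acts through `1 ⊠ η`.  Every
operation `ξ`, acting through `ξ ⊠ 1`, is a map of algebras for this structure. -/
def SelfInterchange.induced {N : GOperad G} (I : SelfInterchange N) {X : GSpectrum G}
    (A : GAlgebra N X) : GAlgebra N X := A.pullback I.rightHom

/-- The family defining the maps `X^{∧T} → X` given by the operations of an algebra. -/
def opFamily {O : Operad} {X : Spectrum} (A : Algebra O X) (T : Type) [Finite T] :
    Presentation.Family (O.obj T) (smashPower X T) X where
  fn ξ (W : T → IPS) (a : ∀ t, X.obj (W t)) := A.op ξ a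
  kcont (W : T → IPS) := A.op_kcont
  base ξ (W : T → IPS) (a : ∀ t, X.obj (W t)) h := A.op_pt ξ a h
  rel ξ (W W' : T → IPS) p (a : ∀ t, X.obj (W t)) (a' : ∀ t, X.obj (W' t)) h := by
    obtain ⟨h, rfl, h'⟩ := h
    rw [← A.op_nat]
    congr 1
    funext t
    exact (h' t).symm

/-- The map `μ_ξ : N_K^G X → X` given by the action of `ξ` (through `ξ ⊠ 1`) on the algebra `A`,
with the factors enumerated by `e`. -/
def mu {N : GOperad G} (I : SelfInterchange N) {K : Subgroup G} [K.FiniteIndex]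
    (hK : IsOpen (K : Set G)) {m : ℕ} (e : G ⧸ K ≃ Fin m) {X : GSpectrum G} (A : GAlgebra N X)
    (ξ : N.obj (Fin m)) : Spectrum.Hom (norm K hK X).toSpectrum X.toSpectrum :=
  (opFamily A.toAlgebra (G ⧸ K)).hom (N.map e.symm (I.left ξ))

end

end MultTransfer
end

open scoped Manifold ContDiff

open Topology

noncomputable section

namespace MultTransfer

/-! ### Mapping spaces -/

/-! The proof consists of an interchange argument, one computation with coset representatives, and a
layer of compactly generated topology.

Spaces of operations. Since `K` is open, `σ` is continuous into a discrete group and its graph is a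
closed subgroup, so the fixed space of the graph is empty or contractible; admissibility rules out
the first case. Right translation on `G/K` commutes with left translation, so the Weyl group
preserves these fixed points. Its action is free because the symmetric group acts freely on
operations and `W K` acts faithfully on `G/K`.

Algebra maps. By an Eckmann–Hilton argument, composing `ξ ⊠ 1` with `1 ⊠ η` in either order gives `ξ
⊠ η` up to the order of the inputs (`comp_left_right`, `comp_right_left`). Hence `μ_ξ` commutes with
all the operations `1 ⊠ η`. Being fixed by the graph means `g ξ = σ(g)⁻¹ ξ`, which cancels the
permutation of the smash factors by `g`; so `μ_ξ` is equivariant. A map out of geometric fixed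
points is determined by its values on the points given by `x ∈ X(V)^K`. Multiplicativity is checked
there, and for the residual action and the diagonal it comes from the fact that a `G`-fixed
operation commutes with every single element of `G`.

Weyl equivariance. Let `r(t)` be the chosen representative of the coset `t`, and let `n` normalize
`K`. Then `r(t n⁻¹) = r(t) n⁻¹ k` with `k ∈ K`, and `k` can be traded for its action on `V`, because
`x` is a `K`-fixed point. So the norm of `n⁻¹ x` is the norm of `x` with its factors permuted by
right translation and corrected by elements of `K` acting on `V`. Permuting the inputs of `ξ` is the
same as replacing `ξ` by `w ξ`, where `w` is the class of `n` (`mu_smul_normPoint`). The permutation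
together with the corrections is an equivariant isometry from `Ind V` to `Ind (n⁻¹ V)`. It becomes
invisible on `G`-fixed vectors, since these are constant families of `K`-fixed vectors
(`undiag_indConj`). This gives `ν_{w ξ} = ν_ξ ∘ w⁻¹`.

Continuity. A map from a compactly generated space into a mapping space of spectra is continuous
when its adjoint is, and conversely evaluation is continuous. Each of the three maps has an
evidently continuous adjoint; the sources that need it are compactly generated because they are
closed subspaces. -/

namespace Spectrum.Hom
variable {X Y : Spectrum}

/-- A family of maps of spectra with continuous adjoints is continuous. -/
lemma continuous_of_kcont {C : CompHaus.{1}} {u : C → Hom X Y}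
    (hu : ∀ V, KCont fun p : C × X.obj V => (u p.1).app V p.2) : Continuous u := by
  rw [continuous_iff_coinduced_le]
  exact le_iSup_of_le C (le_iSup_of_le (⟨u, hu⟩ : {u : C → Hom X Y //
      ∀ V, KCont fun p : C × X.obj V => (u p.1).app V p.2}) le_rfl)

/-- This is the universal property of the topology, which is a supremum of topologies coinduced from
compact Hausdorff test families. -/
lemma continuous_dom {Z : Type*} [TopologicalSpace Z] {f : Hom X Y → Z}
    (hf : ∀ (C : CompHaus.{1}) (u : C → Hom X Y),
      (∀ V, KCont fun p : C × X.obj V => (u p.1).app V p.2) → Continuous (f ∘ u)) :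
    Continuous f := by
  refine continuous_iSup_dom.2 fun C => continuous_iSup_dom.2 fun u => ?_
  exact continuous_coinduced_dom.2 (hf C u.1 u.2)

/-- The topology is final for maps out of compact Hausdorff spaces, so continuity on such spaces
already detects continuity. -/
instance : UCompactlyGeneratedSpace.{1} (Hom X Y) :=
  uCompactlyGeneratedSpace_of_continuous_maps fun _ hf =>
    continuous_dom fun C u hu => hf C ⟨u, continuous_of_kcont hu⟩

/-- Restriction of a map of spectra along a test map. -/
def restrict {V : IPS} {K : Type 1} [TopologicalSpace K] (v : C(K, X.obj V)) (f : Hom X Y) : C(K, Y.obj V) :=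
  ⟨fun k => f.app V (v k), (f.continuous_app V).comp v.continuous⟩

/-- For a test family over `C`, the product `C × K` is again compact Hausdorff, so the adjoint is
continuous on it and can be curried. This reduces evaluation of maps of spectra to evaluation in
ordinary compact-open mapping spaces. -/
lemma continuous_restrict {V : IPS} {K : Type 1} [TopologicalSpace K] [CompactSpace K] [T2Space K]
    (v : C(K, X.obj V)) :
    Continuous (restrict (Y := Y) v) := by
  refine continuous_dom fun C u hu => ?_
  refine ContinuousMap.continuous_of_continuous_uncurry _ ?_
  exact (hu V).test (C := C × K) (u := fun p => (p.1, v p.2)) (by fun_prop)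

/-- The adjoint of a continuous family of maps of spectra is continuous. -/
lemma kcont_of_continuous {C : Type*} [TopologicalSpace C] {u : C → Hom X Y} (hu : Continuous u)
    (V : IPS) : KCont fun p : C × X.obj V => (u p.1).app V p.2 := by
  have key : ∀ (D : Type 1) [TopologicalSpace D] [CompactSpace D] [T2Space D]
      (d : C(D, C × X.obj V)), Continuous fun x => (u (d x).1).app V (d x).2 := by
    intro D _ _ _ d
    -- The second coordinate of `d` is frozen as a test map. The wanted function is then the
    -- uncurried family `C × D → Y(V)`, which is continuous since `D` is compact Hausdorff,
    -- restricted along `x ↦ ((d x).1, x)`.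
    let v : C(D, X.obj V) := ⟨fun x => (d x).2, continuous_snd.comp d.continuous⟩
    have h := ContinuousMap.continuous_uncurry_of_continuous
      ⟨fun c => restrict v (u c), (continuous_restrict v).comp hu⟩
    exact h.comp (f := fun x => ((d x).1, x))
      ((continuous_fst.comp d.continuous).prodMk continuous_id)
  exact fun D d => key D d

lemma continuous_eval (V : IPS) (x : X.obj V) : Continuous fun f : Hom X Y => f.app V x :=
  ((kcont_of_continuous continuous_id V).comp (f := fun f : Hom X Y => (f, x))
    (Continuous.kcont (by fun_prop))).continuous

end Spectrum.Hom

/-! ### Algebra maps and equivariant maps as closed subspaces of mapping spaces -/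

section
variable {G : Type} [Group G] [TopologicalSpace G]

/-- Each instance of multiplicativity, for one operation and one tuple of inputs, equates two
continuous functions of `f`. Coincidence sets are closed because the mapping space is compactly
generated and the target is weak Hausdorff. -/
lemma isClosed_isAlgHom {O : Operad} {X Y : Spectrum} (A : Algebra O X) (B : Algebra O Y) :
    IsClosed {f : Spectrum.Hom X Y | IsAlgHom A B f} := by
  have : {f : Spectrum.Hom X Y | IsAlgHom A B f} =
      ⋂ (S : Type) (_ : Finite S) (V : S → IPS) (ξ : O.obj S) (a : ∀ s, X.obj (V s)),
        {f | f.app _ (A.op ξ a) = B.op ξ fun s => f.app _ (a s)} := by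
    ext f
    simp only [Set.mem_iInter]
    exact ⟨fun h S _ V ξ a => h ξ a, fun h S _ V ξ a => h S _ V ξ a⟩
  rw [this]
  refine isClosed_iInter fun S => isClosed_iInter fun _ => isClosed_iInter fun V =>
    isClosed_iInter fun ξ => isClosed_iInter fun a => ?_
  refine isClosed_eq_of_kcont (Spectrum.Hom.continuous_eval _ _) ?_
  exact (B.op_kcont.comp (f := fun f : Spectrum.Hom X Y => (ξ, fun s => f.app (V s) (a s)))
    (Continuous.kcont (continuous_const.prodMk
      (continuous_pi fun s => Spectrum.Hom.continuous_eval _ _)))).continuous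

lemma isClosed_isEquivariant (X Y : GSpectrum G) :
    IsClosed {f : Spectrum.Hom X.toSpectrum Y.toSpectrum | f.IsEquivariant} := by
  simp only [Spectrum.Hom.IsEquivariant, Set.ofPred_forall]
  refine isClosed_iInter fun V => isClosed_iInter fun g => isClosed_iInter fun x => ?_
  exact isClosed_eq_of_kcont (Spectrum.Hom.continuous_eval _ _)
    ((Y.continuous_act g).comp (Spectrum.Hom.continuous_eval _ _))

/-- A closed subspace of a compactly generated space is compactly generated. This permits continuity
of `f ↦ Φ^G f` to be tested on compact Hausdorff spaces. -/
instance {N : GOperad G} {X Y : GSpectrum G} (A : GAlgebra N X) (B : GAlgebra N Y) :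
    UCompactlyGeneratedSpace.{1} (GAlgHom A B) :=
  cg_subtype_of_isClosed ((isClosed_isEquivariant X Y).inter
    (isClosed_isAlgHom A.toAlgebra B.toAlgebra))

/-- The topology of the mapping space speaks only of compact Hausdorff parameter spaces; compact
generation of `Z` extends the criterion to `Z`. -/
lemma Spectrum.Hom.continuous_of_kcont_test {Z : Type*} [TopologicalSpace Z]
    [UCompactlyGeneratedSpace.{1} Z] {X Y : Spectrum} {F : Z → Spectrum.Hom X Y}
    (hF : ∀ V, KCont fun p : Z × X.obj V => (F p.1).app V p.2) : Continuous F :=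
  continuous_from_uCompactlyGeneratedSpace F fun C u => continuous_of_kcont fun V =>
    (hF V).comp (f := fun p : C × X.obj V => (u p.1, p.2)) (Continuous.kcont (by fun_prop))

end

/-! ### Spaces of operations -/

section
variable {G : Type} [Group G] [TopologicalSpace G]

lemma isClosed_graphFixed {K : Subgroup G} {m : ℕ} (N : GOperad G) (e : G ⧸ K ≃ Fin m) :
    IsClosed {ξ : N.obj (Fin m) | ∀ g : G, N.act g (N.map (permRep e g) ξ) = ξ} := by
  rw [Set.ofPred_forall]
  exact isClosed_iInter fun g => isClosed_eq_of_kcont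
    ((N.continuous_act g).comp (N.continuous_map _)) continuous_id

instance {K : Subgroup G} {m : ℕ} (N : GOperad G) (e : G ⧸ K ≃ Fin m) :
    UCompactlyGeneratedSpace.{1} (graphFixed N e) :=
  cg_subtype_of_isClosed (isClosed_graphFixed N e)

/-- The graph of a continuous homomorphism into a discrete group is closed. This is needed because
the `N∞` condition concerns closed subgroups only. -/
lemma isClosed_graph_permRep [IsTopologicalGroup G] {K : Subgroup G} (hK : IsOpen (K : Set G))
    {m : ℕ} (e : G ⧸ K ≃ Fin m) :
    IsClosed[prodPermTopology G m] ((permRep e).graph : Set (G × Equiv.Perm (Fin m))) := by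
  let _ : TopologicalSpace (Equiv.Perm (Fin m)) := ⊥
  have : DiscreteTopology (Equiv.Perm (Fin m)) := ⟨rfl⟩
  have hc : Continuous (permRep e) := by
    rw [continuous_discrete_rng]
    intro τ
    -- A fibre of `σ` is a finite intersection of transporters between cosets, each of which is open
    -- because `K` is.
    have : permRep e ⁻¹' {τ} = ⋂ i : Fin m, {g : G | g • e.symm i = e.symm (τ i)} := by
      ext g
      simp only [Set.mem_preimage, Set.mem_singleton_iff, Set.mem_iInter, Equiv.ext_iff]
      refine forall_congr' fun i => ?_
      exact (Equiv.eq_symm_apply e).symm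
    rw [this]
    exact isOpen_iInter_of_finite fun i => isOpen_smul_eq K hK _ _
  have : ((permRep e).graph : Set (G × Equiv.Perm (Fin m))) = {p | permRep e p.1 = p.2} := by
    ext p
    exact MonoidHom.mem_graph
  rw [this]
  exact isClosed_eq (hc.comp continuous_fst) continuous_snd

/-- `graphFixed` is the fixed space of the graph of `σ`, indexed by group elements instead of
elements of the graph. Admissibility excludes the empty alternative. -/
lemma contractible_graphFixed [IsTopologicalGroup G] {N : GOperad G} (hN : IsNInfty N)
    {K : Subgroup G} (hK : IsOpen (K : Set G)) {m : ℕ} (e : G ⧸ K ≃ Fin m)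
    (hadm : Nonempty (graphFixed N e)) : ContractibleSpace (graphFixed N e) := by
  have hiff : ∀ ξ : N.obj (Fin m),
      (∀ γ ∈ (permRep e).graph, N.act γ.1 (N.map γ.2 ξ) = ξ) ↔
        ∀ g : G, N.act g (N.map (permRep e g) ξ) = ξ := fun ξ =>
    ⟨fun h g => h (g, permRep e g) (MonoidHom.mem_graph.2 rfl), fun h γ hγ => by
      rw [← MonoidHom.mem_graph.1 hγ]; exact h γ.1⟩
  let φ : {ξ : N.obj (Fin m) // ∀ γ ∈ (permRep e).graph, N.act γ.1 (N.map γ.2 ξ) = ξ} ≃ₜ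
      graphFixed N e := (Homeomorph.refl _).subtype hiff
  rcases hN.contractible m _ (isClosed_graph_permRep hK e) with h | h
  · exact (h.false (φ.symm hadm.some)).elim
  · exact φ.symm.contractibleSpace

/-- Freeness of the symmetric group action reduces the claim to faithfulness of the Weyl group on
`G/K`. -/
lemma weyl_eq_one_of_smul_eq {N : GOperad G} (hN : IsNInfty N) {K : Subgroup G} {m : ℕ}
    {e : G ⧸ K ≃ Fin m} (w : Weyl K) (ξ : graphFixed N e) (h : w • ξ = ξ) : w = 1 := by
  have h1 : weylRep e w = 1 := hN.free m _ ξ.1 (congrArg Subtype.val h)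
  have h2 : weylPerm K w = 1 := (Equiv.permCongrHom e).injective (h1.trans (map_one _).symm)
  induction w using QuotientGroup.induction_on with
  | H n =>
    -- Faithfulness is visible on the trivial coset: it goes to `n⁻¹ K`, so it stays in place only
    -- if `n ∈ K`.
    have h3 : ((1 * (n : G)⁻¹ : G) : G ⧸ K) = ((1 : G) : G ⧸ K) :=
      congrArg (fun p : Equiv.Perm (G ⧸ K) => p ((1 : G) : G ⧸ K)) h2
    rw [QuotientGroup.eq] at h3
    exact (QuotientGroup.eq_one_iff n).2 (Subgroup.mem_subgroupOf.2 (by simpa using h3))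

end

/-! ### The interchange law -/

lemma JHom.ofIso_comp_vec {U V W : IPS} (g : V →ₗᵢ[ℝ] W) (f : U →ₗᵢ[ℝ] V) :
    ((JHom.ofIso g).comp (JHom.ofIso f)).vec = 0 := by
  simp

section
variable {G : Type} [Group G] [TopologicalSpace G]
namespace SelfInterchange
variable {N : GOperad G} (I : SelfInterchange N)

/-- Write `ξ = ξ ∘ (1, …, 1)` and `η = 1 ∘ η`; compatibility of the pairing with composition turns
`ξ ⊠ η` into the composite of `ξ ⊠ 1` with copies of `1 ⊠ η`. The remainder compares reindexing
bijections. -/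
lemma comp_left_right {S T : Type} [Finite S] [Finite T] (ξ : N.obj S) (η : N.obj T) :
    N.comp (I.left ξ) (fun _ => I.right η) =
      N.map (Equiv.sigmaEquivProd S T).symm (I.op ξ η) := by
  have h1 := I.op_map (Equiv.sigmaPUnit S) (Equiv.uniqueSigma fun _ : Unit => T)
    (N.comp ξ fun _ => N.one) (N.comp N.one fun _ => η)
  rw [N.comp_one, N.one_comp, I.op_comp] at h1
  have h3 : N.comp (I.left ξ) (fun _ => I.right η) =
      N.map (Equiv.sigmaCongrLeft (β := fun _ : S => T) (Equiv.prodPUnit S)) (N.map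
        (Equiv.sigmaCongrRight fun _ : S × Unit => Equiv.punitProd T)
        (N.comp (I.op ξ N.one) fun _ : S × Unit => I.op N.one η)) := by
    rw [left, N.comp_map_left]
    exact congrArg _ (N.comp_map_right (fun _ : S × Unit => Equiv.punitProd T)
      (I.op ξ N.one) fun _ => I.op N.one η)
  rw [h1, h3, ← N.map_trans, ← N.map_trans, ← N.map_trans]
  congr 1

/-- The other half of the Eckmann–Hilton argument, from `ξ = 1 ∘ ξ` and `η = η ∘ (1, …, 1)`. The
outer operation now has arity `T`, whence the transposition in the bijection. -/
lemma comp_right_left {S T : Type} [Finite S] [Finite T] (ξ : N.obj S) (η : N.obj T) :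
    N.comp (I.right η) (fun _ => I.left ξ) =
      N.map ((Equiv.prodComm S T).trans (Equiv.sigmaEquivProd T S).symm) (I.op ξ η) := by
  have h1 := I.op_map (Equiv.uniqueSigma fun _ : Unit => S) (Equiv.sigmaPUnit T)
    (N.comp N.one fun _ => ξ) (N.comp η fun _ => N.one)
  rw [N.comp_one, N.one_comp, I.op_comp] at h1
  have h3 : N.comp (I.right η) (fun _ => I.left ξ) =
      N.map (Equiv.sigmaCongrLeft (β := fun _ : T => S) (Equiv.punitProd T)) (N.map
        (Equiv.sigmaCongrRight fun _ : Unit × T => Equiv.prodPUnit S)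
        (N.comp (I.op N.one η) fun _ : Unit × T => I.op ξ N.one)) := by
    rw [right, N.comp_map_left]
    exact congrArg _ (N.comp_map_right (fun _ : Unit × T => Equiv.prodPUnit S)
      (I.op N.one η) fun _ => I.op ξ N.one)
  rw [h1, h3, ← N.map_trans, ← N.map_trans, ← N.map_trans]
  congr 1

/-- The operations `ξ ⊠ 1` and `1 ⊠ η` commute. -/
lemma op_left_right {X : GSpectrum G} (A : GAlgebra N X) {S T : Type} [Finite S] [Finite T]
    (ξ : N.obj T) (η : N.obj S) {W : S → T → IPS} (a : ∀ s t, X.obj (W s t)) :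
    X.map (JHom.ofIso (IPS.swap W))
        (A.op (I.left ξ) fun t => A.op (I.right η) fun s => a s t) =
      A.op (I.right η) fun s => A.op (I.left ξ) fun t => a s t := by
  have h1 := A.op_comp (V := fun p : Σ _ : T, S => W p.2 p.1) (I.left ξ) (fun _ => I.right η)
    fun p => a p.2 p.1
  have h2 := A.op_comp (V := fun p : Σ _ : S, T => W p.1 p.2) (I.right η) (fun _ => I.left ξ)
    fun p => a p.1 p.2
  -- Both composites are `ξ ⊠ η`, with the pairs of inputs listed in the two possible orders; `c`
  -- passes from one order to the other.
  let c : (Σ _ : T, S) ≃ Σ _ : S, T := (Equiv.sigmaEquivProd T S).trans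
    ((Equiv.prodComm T S).trans (Equiv.sigmaEquivProd S T).symm)
  have h3 : N.comp (I.right η) (fun _ => I.left ξ) =
      N.map c (N.comp (I.left ξ) fun _ => I.right η) := by
    rw [comp_left_right, comp_right_left, ← N.map_trans]
    congr 1
  have h4 := A.op_map (V := fun p : Σ _ : S, T => W p.1 p.2) c
    (N.comp (I.left ξ) fun _ => I.right η) fun p => a p.1 p.2
  rw [← h3] at h4
  rw [← h1, ← h2]
  refine (congrArg _ (congrArg _ h4.symm)).trans ?_
  refine (congrArg _ (X.map_comp _ _ _).symm).trans ((X.map_comp _ _ _).symm.trans ?_)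
  -- What is left is an identity of isometries: reindexing along `c`, then currying, then swapping
  -- the two sums is currying in the other order. All the vectors of the complements vanish.
  refine congrArg (fun f => X.map f _) ?_
  apply JHom.ext'
  · intro v; rfl
  · exact (zero_add _).trans ((congrArg _ (JHom.ofIso_comp_vec _ _)).trans (map_zero _))

/-- An operation fixed by the graph satisfies `g ξ = σ(g)⁻¹ ξ`. Transported along the enumeration,
`σ(g)⁻¹` is translation of `G/K` by `g⁻¹`, which is the permutation of factors used in the action of
`g` on the norm. -/
lemma act_map_symm_left {K : Subgroup G} [K.FiniteIndex] {m : ℕ} (e : G ⧸ K ≃ Fin m)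
    (ξ : graphFixed N e) (g : G) :
    N.act g (I.left (N.map e.symm ξ.1)) =
      N.map (MulAction.toPerm g⁻¹ : Equiv.Perm (G ⧸ K)) (I.left (N.map e.symm ξ.1)) := by
  rw [← I.left_act, ← I.left_map, N.act_map, ← N.map_trans]
  conv_rhs => rw [← ξ.2 g, N.act_map, ← N.map_trans]
  congr 1
  refine congrArg (fun τ => N.map τ (N.act g ξ.1)) (Equiv.ext fun i => ?_)
  change e.symm i = g⁻¹ • e.symm (e (g • e.symm i))
  simp

end SelfInterchange
end

/-! ### The multiplication maps -/

section
variable {G : Type} [Group G] [TopologicalSpace G] [IsTopologicalGroup G] {N : GOperad G}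
  (I : SelfInterchange N) {K : Subgroup G} [K.FiniteIndex] (hK : IsOpen (K : Set G)) {m : ℕ}
  (e : G ⧸ K ≃ Fin m) {X : GSpectrum G} (A : GAlgebra N X)

lemma mu_wedge (ξ : N.obj (Fin m)) {W : G ⧸ K → IPS} (a : ∀ t, X.obj (W t)) :
    (mu I hK e A ξ).app _ (smashPower.wedge a) = A.op (I.left (N.map e.symm ξ)) a := by
  rw [I.left_map]
  exact (opFamily A.toAlgebra (G ⧸ K)).hom_gen _ a

lemma mu_kcont (V : IPS) : KCont fun p : N.obj (Fin m) × (norm K hK X).obj V =>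
    (mu I hK e A p.1).app V p.2 :=
  ((opFamily A.toAlgebra (G ⧸ K)).hom_kcont V).comp
    (f := fun p : N.obj (Fin m) × (norm K hK X).obj V => (N.map e.symm (I.left p.1), p.2))
    (Continuous.kcont ((((N.continuous_map _).comp I.continuous_left).comp continuous_fst).prodMk
      continuous_snd))

/-- The action of `g` on the norm permutes the smash factors as well as acting on them. Since `ξ` is
fixed by the graph, its own translate by `g` absorbs the permutation. -/
lemma mu_isEquivariant (ξ : graphFixed N e) : (mu I hK e A ξ.1).IsEquivariant := by
  intro V g x
  change (mu I hK e A ξ.1).app V ((smashPower.permHom X g (MulAction.toPerm g⁻¹)).app V x) = _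
  induction x using smashPower.ind with
  | pt =>
    have h := (mu I hK e A ξ.1).app_pt V
    rw [Spectrum.Hom.app_pt]
    exact h.trans ((congrArg (X.act g) h).trans (X.act_pt g)).symm
  | wedge W q a =>
    rw [Spectrum.Hom.naturality, smashPower.permHom_wedge]
    refine ((mu I hK e A ξ.1).naturality _ _).trans ?_
    refine (congrArg _ (((mu I hK e A ξ.1).naturality _ _).trans
      (congrArg _ (mu_wedge I hK e A ξ.1 _)))).trans ?_
    refine Eq.trans ?_ (congrArg (X.act g) ((mu I hK e A ξ.1).naturality _ _)).symm
    rw [X.act_map, mu_wedge, A.op_act, I.act_map_symm_left e ξ g]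
    refine congrArg _ ?_
    -- Permuting the inputs of an operation costs a pullback of direct sums, which cancels the
    -- pushforward contained in the action on the norm.
    rw [← A.op_map (V := W) (MulAction.toPerm g⁻¹ : Equiv.Perm (G ⧸ K)) _ fun t => X.act g (a t),
      ← Spectrum.map_comp]
    refine Eq.trans (congrArg (fun f => X.map f _) ?_) (X.map_id _)
    apply JHom.ext'
    · intro v
      refine IPS.sum_ext_equiv (MulAction.toPerm g⁻¹) fun t => ?_
      exact IPS.push_comp _ _ _ _
    · simp

/-- By multilinearity it suffices to look at wedges, where the claim is that `ξ ⊠ 1` commutes with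
`1 ⊠ η`. Fixedness of `ξ` plays no role here; it matters for equivariance only. -/
lemma mu_isAlgHom (ξ : N.obj (Fin m)) :
    IsAlgHom (normAlgebra K hK (I.induced A)).toAlgebra (I.induced A).toAlgebra
      (mu I hK e A ξ) := by
  intro S _ V η x
  change (mu I hK e A ξ).app _ ((smashPower.algFamily (I.induced A).toAlgebra (G ⧸ K) S).lift
    V η x) = A.op (I.right η) fun s => (mu I hK e A ξ).app _ (x s)
  rcases smashPower.cases x with ⟨s, hs⟩ | ⟨W, q, a, rfl⟩
  · rw [smashPower.algFamily_pt _ _ _ ⟨s, hs⟩]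
    refine ((mu I hK e A ξ).app_pt _).trans (A.op_pt _ _ ⟨s, ?_⟩).symm
    rw [hs]
    exact (mu I hK e A ξ).app_pt _
  · rw [smashPower.algFamily_map, smashPower.algFamily_wedge]
    refine ((mu I hK e A ξ).naturality _ _).trans ?_
    refine (congrArg _ (((mu I hK e A ξ).naturality _ _).trans
      (congrArg _ (mu_wedge I hK e A ξ _)))).trans ?_
    have h : ∀ s, (mu I hK e A ξ).app _ ((smashPower X.toSpectrum (G ⧸ K)).spectrum.map (q s)
        (smashPower.wedge (a s))) = X.map (q s) (A.op (I.left (N.map e.symm ξ)) (a s)) := fun s =>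
      ((mu I hK e A ξ).naturality _ _).trans (congrArg _ (mu_wedge I hK e A ξ _))
    simp only [h]
    rw [A.op_nat]
    exact congrArg _ (I.op_left_right A (N.map e.symm ξ) η a)

end

/-! ### Maps of algebras -/

section
variable {O : Operad} {X Y Z : Spectrum} {A : Algebra O X} {B : Algebra O Y} {C : Algebra O Z}

lemma IsAlgHom.comp {g : Spectrum.Hom Y Z} {f : Spectrum.Hom X Y} (hg : IsAlgHom B C g)
    (hf : IsAlgHom A B f) : IsAlgHom A C (g.comp f) := by
  intro S _ V ξ a
  change g.app _ (f.app _ _) = _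
  rw [hf, hg]
  rfl

lemma IsAlgHom.rescale {f : Spectrum.Hom X Y} (hf : IsAlgHom A B f) (c : ℝ) (hc : 0 < c) :
    IsAlgHom (A.rescale c hc) (B.rescale c hc) (f.rescale c hc) :=
  fun ξ a => hf ξ a

end

/-- This is applied to a single element, of the normalizer or of the set of coset representatives.
It is the reason why the residual action and the diagonal respect the `N^G`-structures. -/
lemma GAlgebra.act_op_of_fixed {G : Type} [Group G] [TopologicalSpace G] {N : GOperad G}
    {X : GSpectrum G} (A : GAlgebra N X) {S : Type} [Finite S] {V : S → IPS} (g : G)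
    (ξ : {ξ : N.obj S // ∀ g, N.act g ξ = ξ}) (a : ∀ s, X.obj (V s)) :
    X.act g (A.op ξ.1 a) = A.op ξ.1 fun s => X.act g (a s) := by
  rw [A.op_act, ξ.2]

/-! ### Geometric fixed points as a continuous functor on algebras -/

namespace geomFix
open Presentation
section
variable {G : Type} [Group G] [TopologicalSpace G] {K : Subgroup G} {X Y : GSpectrum G}

lemma map_pnt (f : Spectrum.Hom X.toSpectrum Y.toSpectrum) (hf : f.IsEquivariant) {V : Rep K}
    (x : X.fixedAt K V) : (map f hf).app _ (pnt x) = pnt (onFixed f hf x) :=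
  Family.hom_gen _ () (D := geomFixPres K X) (i := V) x

/-- Criterion for a map out of geometric fixed points to be a map of algebras. -/
lemma isAlgHom_of_pnt {N : GOperad G} (A : GAlgebra N X) {Z : Spectrum} (B : Algebra N.fixed Z)
    (f : Spectrum.Hom (geomFix K X) Z)
    (h : ∀ {S : Type} [Finite S] {V : S → Rep K} (ξ : N.fixed.obj S)
      (x : ∀ s, X.fixedAt K (V s)),
      Z.map (JHom.ofIso (Rep.fixSum V)) (f.app _ (pnt (opFixed A ξ x))) =
        B.op ξ fun s => f.app _ (pnt (x s))) :
    IsAlgHom (algebra K A) B f := by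
  intro S _ U ξ x
  change f.app _ ((algFamily K A S).lift U ξ x) = _
  rcases cases x with ⟨s, hs⟩ | ⟨V, q, a, rfl⟩
  · rw [algFamily_pt A _ _ ⟨s, hs⟩, f.app_pt, B.op_pt]
    exact ⟨s, by rw [hs, f.app_pt]⟩
  · rw [algFamily_map, algFamily_pnt, f.naturality, f.naturality, h]
    simp only [f.naturality]
    rw [B.op_nat]

/-- On points, the operations and the map on geometric fixed points are those of the underlying
spectra, so multiplicativity of `f` is all that is required. -/
lemma map_isAlgHom {N : GOperad G} (A : GAlgebra N X) (B : GAlgebra N Y)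
    (f : Spectrum.Hom X.toSpectrum Y.toSpectrum) (hf : f.IsEquivariant)
    (h : IsAlgHom A.toAlgebra B.toAlgebra f) :
    IsAlgHom (algebra K A) (algebra K B) (map f hf) := by
  refine isAlgHom_of_pnt A _ _ fun {S _ V} ξ x => ?_
  simp only [map_pnt]
  refine Eq.trans ?_ (algFamily_pnt B ξ fun s => onFixed f hf (x s)).symm
  exact congrArg (fun y => (geomFix K Y).map (JHom.ofIso (Rep.fixSum V)) (pnt y))
    (Subtype.ext (h ξ.1 _))

/-- The maps induced on geometric fixed points depend continuously on the given map. -/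
lemma map_kcont {Λ : Type*} [TopologicalSpace Λ]
    {f : Λ → Spectrum.Hom X.toSpectrum Y.toSpectrum} (hc : Continuous f)
    (hf : ∀ l, (f l).IsEquivariant) (U : IPS) :
    KCont fun p : Λ × (geomFix K X).obj U => (map (f p.1) (hf p.1)).app U p.2 := by
  -- All the maps are assembled into one family with parameter space `Λ`. Joint continuity then
  -- descends to the coend together with the map, and has to be checked only on the generators
  -- `X(V)^K`.
  let F : Family Λ (geomFixPres K X) (geomFix K Y) :=
    { fn := fun l V x => pnt (onFixed (f l) (hf l) x)
      kcont := fun V => by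
        have h : KCont fun p : Λ × X.fixedAt K V => (f p.1).app V.V p.2.1 :=
          (Spectrum.Hom.kcont_of_continuous hc V.V).comp
            (f := fun p : Λ × X.fixedAt K V => (p.1, p.2.1)) (Continuous.kcont (by fun_prop))
        exact (pnt_kcont V).comp (f := fun p : Λ × X.fixedAt K V => onFixed (f p.1) (hf p.1) p.2)
          fun C u => (h C u).subtype_mk _
      base := fun l V x (h : x.1 = _) =>
        pnt_pt ((congrArg ((f l).app V.V) h).trans ((f l).app_pt _))
      rel := fun l V W p x y h => by
        obtain ⟨h, rfl, hy⟩ := h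
        exact pnt_map h _ _ ((congrArg ((f l).app W.V) hy).trans ((f l).naturality _ _)) }
  have hF : ∀ l, map (f l) (hf l) = F.hom l := fun l =>
    hom_ext fun (V : Rep K) (x : X.fixedAt K V) =>
      (map_pnt (f l) (hf l) x).trans (F.hom_gen l (i := V) x).symm
  simp only [hF]
  exact F.hom_kcont U

end

/-! ### The residual action respects the algebra structure -/

section
variable {G : Type} [Group G] [TopologicalSpace G] [IsTopologicalGroup G] {K : Subgroup G}
  {X : GSpectrum G}

/-- Conjugation commutes with direct sums. -/
def _root_.MultTransfer.Rep.Hom.conjSum (n : Subgroup.normalizer (K : Set G)) {S : Type} [Finite S]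
    (V : S → Rep K) : Rep.Hom ((Rep.sum V).conj n) (Rep.sum fun s => (V s).conj n) :=
  Rep.Hom.ofIso LinearIsometry.id fun k v => by
    apply IPS.sum_ext; intro s
    rfl

/-- The operation is `G`-fixed and so commutes with `n`. The two sides live over different
presentations of the same representation, the conjugate of a sum and the sum of the conjugates. -/
lemma pnt_opFixed_conjFixed {N : GOperad G} (A : GAlgebra N X)
    (n : Subgroup.normalizer (K : Set G)) {S : Type} [Finite S] {V : S → Rep K}
    (ξ : N.fixed.obj S) (x : ∀ s, X.fixedAt K (V s)) :
    (geomFix K X).map (Rep.Hom.conjSum n V).fix (pnt (conjFixed n (opFixed A ξ x))) =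
      pnt (opFixed A ξ fun s => conjFixed n (x s)) := by
  refine pnt_map (Rep.Hom.conjSum n V) _ _ ?_
  refine Eq.trans ?_ (X.map_id _).symm
  exact (A.act_op_of_fixed (n : G) ξ _).symm

/-- All these identifications are the identity on underlying vectors, so both composites send a
fixed vector to the family of its components. -/
lemma conjFix_conjSum (n : Subgroup.normalizer (K : Set G)) {S : Type} [Finite S]
    (V : S → Rep K) : (JHom.ofIso (Rep.fixSum V)).comp (JHom.ofIso ((Rep.sum V).conjFix n)) =
    (JHom.sum fun s => JHom.ofIso ((V s).conjFix n)).comp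
      ((JHom.ofIso (Rep.fixSum fun s => (V s).conj n)).comp (Rep.Hom.conjSum n V).fix) := by
  apply JHom.ext'
  · intro v
    apply IPS.sum_ext; intro s
    apply Rep.fix_ext
    change (V s).incl (IPS.comp (Rep.fixSum V ((Rep.sum V).conjFix n v)) s) =
      (V s).incl ((V s).conjFix n (IPS.comp (Rep.fixSum (fun s => (V s).conj n)
        ((Rep.Hom.conjSum n V).fix.iso v)) s))
    rw [Rep.incl_fixSum, Rep.incl_conjFix]
    have h1 : Rep.inclSum V ((Rep.sum V).conjFix n v) = ((Rep.sum V).conj n).incl v :=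
      Rep.incl_conjFix _ _ _
    have h2 : Rep.inclSum (fun s => (V s).conj n) ((Rep.Hom.conjSum n V).fix.iso v) =
        ((Rep.sum V).conj n).incl v := Rep.Hom.fix_iso _ _
    exact (congrArg (fun y : IPS.sum fun s => (V s).V => IPS.comp y s) (h1.trans h2.symm)).trans
      (Rep.incl_fixSum (fun s => (V s).conj n) _ s).symm
  · have h3 : ((JHom.ofIso (Rep.fixSum fun s => (V s).conj n)).comp
        (Rep.Hom.conjSum n V).fix).vec = 0 := (zero_add _).trans (map_zero _)
    rw [JHom.ofIso_comp_vec, JHom.comp_vec, h3, map_zero, add_zero]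
    rfl

lemma conjMap_isAlgHom {N : GOperad G} (A : GAlgebra N X)
    (n : Subgroup.normalizer (K : Set G)) :
    IsAlgHom (algebra K A) (algebra K A) (conjMap X n) := by
  refine isAlgHom_of_pnt A _ _ fun {S _ V} ξ x => ?_
  simp only [conjMap_pnt]
  refine Eq.trans ?_ ((algFamily_map A ξ (fun s => JHom.ofIso ((V s).conjFix n))
    fun s => pnt (conjFixed n (x s))).trans (congrArg _ (algFamily_pnt A ξ _))).symm
  rw [← pnt_opFixed_conjFixed]
  simp only [← Spectrum.map_comp]
  rw [conjFix_conjSum]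

lemma residual_isAlgHom {N : GOperad G} (A : GAlgebra N X) (w : Weyl K) :
    IsAlgHom (algebra K A) (algebra K A) (residual K X w) := by
  induction w using QuotientGroup.induction_on with
  | H n => exact conjMap_isAlgHom A n

end
end geomFix

/-! ### The diagonal -/

section
open Presentation geomFix
variable {G : Type} [Group G] [TopologicalSpace G] [IsTopologicalGroup G] {K : Subgroup G}
  [K.FiniteIndex] (hK : IsOpen (K : Set G)) {X : GSpectrum G}

lemma diagonal_pnt {V : Rep K} (x : X.fixedAt K V) :
    (diagonal hK X).app _ (pnt x) =
      (geomFix ⊤ (norm K hK X)).map (JHom.ofIso (V.undiag hK)) (pnt (normPoint hK x)) :=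
  Family.hom_gen _ () (D := geomFixPres K X) (i := V) x

/-- The norm of `ξ(x)` has factors `r(t) ξ(x)`, and these equal `ξ(r(t) x)` because `ξ` is
`G`-fixed. So the norm of `ξ(x)` is `ξ` applied factorwise to the norms, up to interchanging the two
direct sums. -/
lemma diagonal_isAlgHom {N : GOperad G} (A : GAlgebra N X) :
    IsAlgHom (geomFix.algebra K A)
      ((geomFix.algebra ⊤ (normAlgebra K hK A)).rescale (diagScale K) diagScale_pos)
      (diagonal hK X) := by
  refine isAlgHom_of_pnt A _ _ fun {S _ V} ξ x => ?_
  simp only [diagonal_pnt]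
  refine Eq.trans ?_ ((algFamily_map (normAlgebra K hK A) ξ
    (fun s => JHom.ofIso ((V s).undiag hK)) fun s => pnt (normPoint hK (x s))).trans
      (congrArg _ (algFamily_pnt (normAlgebra K hK A) ξ _))).symm
  -- Interchange of sums is an isomorphism of `G`-representations from the induction of a sum to the
  -- sum of the inductions.
  have h := pnt_map (X := norm K hK X) (Rep.Hom.ofIso (V := (Rep.sum V).ind hK)
    (W := Rep.sum fun s => (V s).ind hK) (IPS.swap fun s (_ : G ⧸ K) => (V s).V)
    fun k v => rfl) (normPoint hK (opFixed A ξ x))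
    (opFixed (normAlgebra K hK A) ξ fun s => normPoint hK (x s)) (by
      refine (smashPower.algFamily_wedge A.toAlgebra (G ⧸ K) ξ.1
        fun s (t : G ⧸ K) => X.act t.out (x s).1).trans ?_
      refine congrArg (fun y => (smashPower X.toSpectrum (G ⧸ K)).spectrum.map _
        (smashPower.wedge y)) (funext fun t => ?_)
      exact (A.act_op_of_fixed t.out ξ _).symm)
  rw [← h]
  -- The target of the diagonal is rescaled, so its structure maps carry a factor on the sphere
  -- coordinate. For an isometry that coordinate is zero and the factor has no effect.
  change (geomFix ⊤ (norm K hK X)).map ((JHom.ofIso (Rep.fixSum V)).scale (diagScale K)) _ = _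
  simp only [← Spectrum.map_comp]
  refine congrArg (fun f => (geomFix ⊤ (norm K hK X)).map f
    (pnt (normPoint hK (opFixed A ξ x)))) ?_
  apply JHom.ext'
  · intro v; rfl
  · apply IPS.sum_ext; intro s
    apply Rep.fix_ext
    simp
    exact (smul_zero _).symm

/-- Rescaling leaves the component functions unchanged, so the adjoint is evaluation after the
diagonal on the second variable. -/
lemma continuous_comp_diagonal {Z : Spectrum} :
    Continuous fun f : Spectrum.Hom (geomFix ⊤ (norm K hK X)) Z =>
      (f.rescale (diagScale K) diagScale_pos).comp (diagonal hK X) :=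
  Spectrum.Hom.continuous_of_kcont_test fun V =>
    (Spectrum.Hom.kcont_of_continuous continuous_id V).comp
      (f := fun p : Spectrum.Hom (geomFix ⊤ (norm K hK X)) Z × (geomFix K X).obj V =>
        (p.1, (diagonal hK X).app V p.2))
      (Continuous.kcont (continuous_fst.prodMk
        (((diagonal hK X).continuous_app V).comp continuous_snd)))

end

/-! ### Equivariance for the Weyl group -/

section
variable {G : Type} [Group G] [TopologicalSpace G] {K : Subgroup G}

/-- The element `n r(t)⁻¹ r(t n⁻¹)` of `K`, where `r` are the chosen coset representatives. -/
def weylCocycle (n : Subgroup.normalizer (K : Set G)) (t : G ⧸ K) : K :=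
  ⟨n * (t.out⁻¹ * (rightMul n t).out), by
    have h : ((t.out * (n : G)⁻¹ : G) : G ⧸ K) = ((rightMul n t).out : G ⧸ K) := by
      rw [QuotientGroup.out_eq', ← rightMul_mk, QuotientGroup.out_eq']
    rw [QuotientGroup.eq] at h
    simpa [mul_assoc] using h⟩

lemma rightMul_smul (n : Subgroup.normalizer (K : Set G)) (g : G) (t : G ⧸ K) :
    rightMul n (g • t) = g • rightMul n t :=
  weylPerm_smul (n : Weyl K) g t

/-- Both sides telescope to `n r(t)⁻¹ g r(g⁻¹ t n⁻¹)`. This identity makes the comparison of induced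
representations equivariant. -/
lemma weylCocycle_mul_cocycle [IsTopologicalGroup G]
    (n : Subgroup.normalizer (K : Set G)) (g : G) (t : G ⧸ K) :
    weylCocycle n t * cocycle K g (rightMul n t) =
      conjHom n⁻¹ (cocycle K g t) * weylCocycle n (g⁻¹ • t) := by
  apply Subtype.ext
  simp [weylCocycle, cocycle, conjHom, mul_assoc, rightMul_smul]

/-- The factor at `t` in the norm of `n⁻¹ x` is thereby expressed through the factor at `t n⁻¹` in
the norm of `x`. The discrepancy is an element of `K`, which disappears because `x` is fixed by its
combined action on the spectrum and on `V`. -/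
lemma map_act_out_rightMul {X : GSpectrum G}
    (n : Subgroup.normalizer (K : Set G)) {V : Rep K} (x : X.fixedAt K V) (t : G ⧸ K) :
    X.map (JHom.ofIso (V.ρ (weylCocycle n t)).toLinearIsometry) (X.act (rightMul n t).out x.1) =
      X.act t.out (X.act ((n⁻¹ : Subgroup.normalizer (K : Set G)) : G) x.1) := by
  -- The cocycle is defined to be the correction `k` in `r(t n⁻¹) = r(t) n⁻¹ k`.
  have h : (rightMul n t).out = t.out * ((n : G)⁻¹ * (weylCocycle n t : G)) := by
    simp [weylCocycle]
  rw [h, X.act_mul, X.act_mul, ← X.act_map, ← X.act_map, x.2 (weylCocycle n t)]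
  rfl

/-- The isometry underlying the isomorphism of representations induced from `V` and from a
conjugate of `V`. -/
def Rep.indConjLI [K.FiniteIndex] (n : Subgroup.normalizer (K : Set G)) (V : Rep K) :
    (IPS.sum fun _ : G ⧸ K => V.V) →ₗᵢ[ℝ] IPS.sum fun _ : G ⧸ K => V.V :=
  (IPS.sumLI fun t => (V.ρ (weylCocycle n t)).toLinearIsometry).comp
    (IPS.pull (weylPerm K (n : Weyl K)) fun _ : G ⧸ K => V.V)

lemma Rep.indConjLI_comp [K.FiniteIndex] (n : Subgroup.normalizer (K : Set G))
    (V : Rep K) (x : IPS.sum fun _ : G ⧸ K => V.V) (t : G ⧸ K) :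
    IPS.comp (V.indConjLI n x) t = V.ρ (weylCocycle n t) (IPS.comp x (rightMul n t)) := rfl

end

/-! ### Induction from conjugate representations and the equivariance of the composite -/

section
open Presentation geomFix
variable {G : Type} [Group G] [TopologicalSpace G] [IsTopologicalGroup G] {K : Subgroup G}
  [K.FiniteIndex] (hK : IsOpen (K : Set G)) {X : GSpectrum G}

lemma Rep.indConjLI_indLI (n : Subgroup.normalizer (K : Set G)) (V : Rep K) (g : G)
    (x : IPS.sum fun _ : G ⧸ K => V.V) :
    V.indConjLI n (V.indLI g x) = (V.conj n⁻¹).indLI g (V.indConjLI n x) := by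
  apply IPS.sum_ext; intro t
  refine Eq.trans ?_ ((Rep.indLI_comp (V.conj n⁻¹) g (V.indConjLI n x) t).trans
    ((Rep.conj_ρ n⁻¹ V _ _).trans (congrArg _ (V.indConjLI_comp n x (g⁻¹ • t))))).symm
  rw [Rep.indConjLI_comp, Rep.indLI_comp, ← V.ρ_mul, ← V.ρ_mul, weylCocycle_mul_cocycle,
    rightMul_smul]

/-- The representations induced from `V` and from a conjugate of `V` are isomorphic. -/
def Rep.Hom.indConj (n : Subgroup.normalizer (K : Set G)) (V : Rep K) :
    Rep.Hom (V.ind hK) ((V.conj n⁻¹).ind hK) :=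
  Rep.Hom.ofIso (V := V.ind hK) (W := (V.conj n⁻¹).ind hK) (V.indConjLI n)
    fun g v => V.indConjLI_indLI n g v

/-- A fixed vector of an induced representation is a constant family with `K`-fixed entries. Neither
permuting the entries nor acting on them by elements of `K` changes it. -/
lemma undiag_indConj (n : Subgroup.normalizer (K : Set G)) (V : Rep K) (v : (V.ind hK).fix) :
    V.conjFix n⁻¹ ((V.conj n⁻¹).undiag hK ((Rep.Hom.indConj hK n V).fix.iso v)) =
      V.undiag hK v := by
  apply Rep.fix_ext
  rw [Rep.incl_conjFix, V.incl_undiag]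
  refine ((V.conj n⁻¹).incl_undiag hK _).trans (congrArg (diagScale K • ·) ?_)
  have h1 : (V.conj n⁻¹).inclInd hK ((Rep.Hom.indConj hK n V).fix.iso v) =
      V.indConjLI n (V.inclInd hK v) := Rep.Hom.fix_iso _ _
  refine (congrArg (fun y : IPS.sum fun _ : G ⧸ K => V.V => IPS.comp y ((1 : G) : G ⧸ K))
    h1).trans ?_
  rw [Rep.indConjLI_comp, V.comp_inclInd_fixed, V.comp_inclInd_eq hK v _ ((1 : G) : G ⧸ K)]

variable {N : GOperad G} (I : SelfInterchange N) {m : ℕ} (e : G ⧸ K ≃ Fin m) (A : GAlgebra N X)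

/-- The heart of the equivariance: up to elements of `K` acting on `V`, the norm of `n⁻¹ x` is the
norm of `x` with its factors moved by right translation, and feeding permuted inputs to `ξ` amounts
to applying `w ξ` to the original ones, for `w` the class of `n`. -/
lemma mu_smul_normPoint (n : Subgroup.normalizer (K : Set G)) (ξ : graphFixed N e) {V : Rep K}
    (x : X.fixedAt K V) :
    (mu I hK e A ξ.1).app _ (normPoint hK (conjFixed n⁻¹ x)).1 =
      X.map (JHom.ofIso (V.indConjLI n))
        ((mu I hK e A ((n : Weyl K) • ξ).1).app _ (normPoint hK x).1) := by
  have h1 : I.left (N.map e.symm ((n : Weyl K) • ξ).1) =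
      N.map (weylPerm K (n : Weyl K)) (I.left (N.map e.symm ξ.1)) := by
    rw [← I.left_map, ← N.map_trans]
    change I.left (N.map e.symm (N.map (weylRep e (n : Weyl K)) ξ.1)) = _
    rw [← N.map_trans]
    refine congrArg (fun τ => I.left (N.map τ ξ.1)) (Equiv.ext fun i => ?_)
    exact e.symm_apply_apply _
  have h2 : (fun t : G ⧸ K => X.act t.out (conjFixed n⁻¹ x).1) = fun t =>
      X.map (JHom.ofIso (V.ρ (weylCocycle n t)).toLinearIsometry)
        (X.act (rightMul n t).out x.1) := funext fun t => (map_act_out_rightMul n x t).symm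
  refine (mu_wedge I hK e A ξ.1 fun t : G ⧸ K => X.act t.out (conjFixed n⁻¹ x).1).trans ?_
  refine Eq.trans ?_ (congrArg _ (mu_wedge I hK e A ((n : Weyl K) • ξ).1
    fun t : G ⧸ K => X.act t.out x.1)).symm
  refine (congrArg _ h2).trans ?_
  -- Multilinearity pulls the corrections by `K` out of the operation; what remains inside is the
  -- norm of `x` with permuted factors.
  refine (A.op_nat (fun t => JHom.ofIso (V.ρ (weylCocycle n t)).toLinearIsometry) _
    fun t => X.act (rightMul n t).out x.1).trans ?_
  rw [h1]
  refine (congrArg _ (A.op_map (V := fun _ => V.V) (weylPerm K (n : Weyl K))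
    (I.left (N.map e.symm ξ.1)) fun t => X.act t.out x.1).symm).trans ?_
  rw [← Spectrum.map_comp]
  -- The corrections after the reindexing of summands are by construction `indConjLI`.
  refine congrArg (fun f => X.map f _) ?_
  apply JHom.ext'
  · intro v; rfl
  · simp

/-- The value of a map on the image of a point under the diagonal. -/
lemma map_diagonal_pnt (f : Spectrum.Hom (norm K hK X).toSpectrum X.toSpectrum)
    (hf : f.IsEquivariant) {V : Rep K} (x : X.fixedAt K V) :
    (((geomFix.map f hf).rescale (diagScale K) diagScale_pos).comp (diagonal hK X)).app _
      (pnt x) = (geomFix ⊤ X).map (JHom.ofIso (V.undiag hK))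
        (pnt (onFixed f hf (normPoint hK x))) := by
  rw [← map_pnt]
  refine (congrArg ((geomFix.map f hf).app _) (diagonal_pnt hK x)).trans ?_
  exact (geomFix.map f hf).naturality _ _

/-- It is enough to compare values on the points given by `x ∈ X(V)^K`. There the two sides are
points over `Ind V` and over `Ind (n⁻¹ V)`, which the coend identifies along the comparison
isomorphism. -/
lemma map_mu_smul_comp_diagonal (w : Weyl K) (ξ : graphFixed N e) :
    ((geomFix.map (mu I hK e A (w • ξ).1) (mu_isEquivariant I hK e A (w • ξ))).rescale
        (diagScale K) diagScale_pos).comp (diagonal hK X) =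
      (((geomFix.map (mu I hK e A ξ.1) (mu_isEquivariant I hK e A ξ)).rescale
        (diagScale K) diagScale_pos).comp (diagonal hK X)).comp (residual K X w⁻¹) := by
  induction w using QuotientGroup.induction_on with
  | H n =>
    refine hom_ext fun (V : Rep K) (x : X.fixedAt K V) => ?_
    refine (map_diagonal_pnt hK _ _ x).trans ?_
    refine Eq.trans ?_ (congrArg ((((geomFix.map (mu I hK e A ξ.1)
      (mu_isEquivariant I hK e A ξ)).rescale (diagScale K) diagScale_pos).comp
        (diagonal hK X)).app V.fix) (conjMap_pnt n⁻¹ x)).symm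
    rw [Spectrum.Hom.naturality, map_diagonal_pnt]
    -- The gluing relation of the coend for `indConj` rewrites the point over the conjugate
    -- representation as the one over `Ind V`, leaving an identity of isometries of fixed vectors.
    rw [← pnt_map (Rep.Hom.indConj hK n V)
      (onFixed _ (mu_isEquivariant I hK e A ((n : Weyl K) • ξ)) (normPoint hK x))
      (onFixed _ (mu_isEquivariant I hK e A ξ) (normPoint hK (conjFixed n⁻¹ x)))
      (mu_smul_normPoint hK I e A n ξ x)]
    -- The residual action was moved past a map into a rescaled spectrum, so its isometry appears
    -- rescaled; its vector is zero, so nothing changes.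
    change _ = (geomFix ⊤ X).map ((JHom.ofIso (V.conjFix n⁻¹)).scale (diagScale K)) _
    rw [← Spectrum.map_comp, ← Spectrum.map_comp]
    refine congrArg (fun f => (geomFix ⊤ X).map f _) ?_
    apply JHom.ext'
    · intro v
      exact (undiag_indConj hK n V v).symm
    · have h : (Rep.Hom.indConj hK n V).fix.vec = 0 := rfl
      rw [JHom.comp_vec, h, map_zero, add_zero, JHom.comp_vec]
      simp

end

end MultTransfer

end

/-! ### Assembly of the theorem -/

theorem theorem2p4 {E : Type*} [NormedAddCommGroup E] [NormedSpace ℝ E] [FiniteDimensional ℝ E]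
    {G : Type} [Group G] [TopologicalSpace G] [IsTopologicalGroup G] [ChartedSpace E G]
    [LieGroup 𝓘(ℝ, E) ∞ G] [CompactSpace G] [T2Space G]
    (N : MultTransfer.GOperad G) (hN : MultTransfer.IsNInfty N)
    (I : MultTransfer.SelfInterchange N)
    (K : Subgroup G) [K.FiniteIndex] (hK : IsOpen (K : Set G))
    (m : ℕ) (e : G ⧸ K ≃ Fin m)
    (hadm : Nonempty (MultTransfer.graphFixed N e)) :
    -- the space of operations is contractible, with a natural free action of the Weyl group
    ContractibleSpace (MultTransfer.graphFixed N e) ∧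
    (∀ w : MultTransfer.Weyl K,
      Continuous fun ξ : MultTransfer.graphFixed N e => w • ξ) ∧
    (∀ (w : MultTransfer.Weyl K) (ξ : MultTransfer.graphFixed N e), w • ξ = ξ → w = 1) ∧
    (∀ (N' : MultTransfer.GOperad G) (j : MultTransfer.GOperadHom N N')
      (w : MultTransfer.Weyl K) (ξ : MultTransfer.graphFixed N e),
      (w • ξ).map j = w • ξ.map j) ∧
    ∀ (X : MultTransfer.GSpectrum G) (A : MultTransfer.GAlgebra N X),
      -- the residual action is by maps of algebras
      (∀ w : MultTransfer.Weyl K,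
        MultTransfer.IsAlgHom (MultTransfer.geomFix.algebra K (I.induced A))
          (MultTransfer.geomFix.algebra K (I.induced A))
          (MultTransfer.geomFix.residual K X w)) ∧
      -- the three maps are well defined and continuous, and their composite is equivariant
      ∃ (M : C(MultTransfer.graphFixed N e,
            MultTransfer.GAlgHom (MultTransfer.normAlgebra K hK (I.induced A)) (I.induced A)))
        (F : C(MultTransfer.GAlgHom (MultTransfer.normAlgebra K hK (I.induced A)) (I.induced A),
            MultTransfer.AlgHom
              (MultTransfer.geomFix.algebra ⊤ (MultTransfer.normAlgebra K hK (I.induced A)))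
              (MultTransfer.geomFix.algebra ⊤ (I.induced A))))
        (D : C(MultTransfer.AlgHom
              (MultTransfer.geomFix.algebra ⊤ (MultTransfer.normAlgebra K hK (I.induced A)))
              (MultTransfer.geomFix.algebra ⊤ (I.induced A)),
            MultTransfer.AlgHom (MultTransfer.geomFix.algebra K (I.induced A))
              ((MultTransfer.geomFix.algebra ⊤ (I.induced A)).rescale
                (MultTransfer.diagScale K) MultTransfer.diagScale_pos))),
        (∀ ξ, (M ξ).1 = MultTransfer.mu I hK e A ξ.1) ∧
        (∀ f, (F f).1 = MultTransfer.geomFix.map f.1 f.2.1) ∧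
        (∀ f, (D f).1 = (f.1.rescale (MultTransfer.diagScale K) MultTransfer.diagScale_pos).comp
          (MultTransfer.diagonal hK X)) ∧
        ∀ (w : MultTransfer.Weyl K) (ξ : MultTransfer.graphFixed N e),
          (D (F (M (w • ξ)))).1 =
            (D (F (M ξ))).1.comp (MultTransfer.geomFix.residual K X w⁻¹) := by
  refine ⟨MultTransfer.contractible_graphFixed hN hK e hadm, fun w => ?_,
    MultTransfer.weyl_eq_one_of_smul_eq hN, fun N' j w ξ => Subtype.ext (j.app_map _ _),
    fun X A => ⟨MultTransfer.geomFix.residual_isAlgHom _, ?_⟩⟩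
  -- Continuity for each single `w` is the full statement, as the Weyl group is discrete when `K` is
  -- open.
  · exact ((N.continuous_map _).comp continuous_subtype_val).subtype_mk _
  · refine ⟨⟨fun ξ => ⟨MultTransfer.mu I hK e A ξ.1, MultTransfer.mu_isEquivariant I hK e A ξ,
        MultTransfer.mu_isAlgHom I hK e A ξ.1⟩, Continuous.subtype_mk ?_ _⟩,
      ⟨fun f => ⟨MultTransfer.geomFix.map f.1 f.2.1,
        MultTransfer.geomFix.map_isAlgHom _ _ f.1 f.2.1 f.2.2⟩, Continuous.subtype_mk ?_ _⟩,
      ⟨fun f => ⟨(f.1.rescale (MultTransfer.diagScale K) MultTransfer.diagScale_pos).comp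
        (MultTransfer.diagonal hK X),
        MultTransfer.IsAlgHom.comp (MultTransfer.IsAlgHom.rescale f.2 _ _)
          (MultTransfer.diagonal_isAlgHom hK _)⟩,
        Continuous.subtype_mk ?_ _⟩,
      fun _ => rfl, fun _ => rfl, fun _ => rfl,
      MultTransfer.map_mu_smul_comp_diagonal hK I e A⟩
    -- Continuity of `ξ ↦ μ_ξ`: the adjoint is the action of the operad, and the space of fixed
    -- operations is closed in `N(m)`, hence compactly generated.
    · refine MultTransfer.Spectrum.Hom.continuous_of_kcont_test fun V => ?_
      exact (MultTransfer.mu_kcont I hK e A V).comp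
        (f := fun p : MultTransfer.graphFixed N e × (MultTransfer.norm K hK X).obj V =>
          (p.1.1, p.2)) (Continuous.kcont (by fun_prop))
    -- Continuity of `f ↦ Φ^G f`, where compact generation of the space of equivariant algebra maps
    -- is used.
    · exact MultTransfer.Spectrum.Hom.continuous_of_kcont_test fun V =>
        MultTransfer.geomFix.map_kcont continuous_subtype_val (fun f => f.2.1) V
    · exact (MultTransfer.continuous_comp_diagonal hK).comp continuous_subtype_val
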